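/- Let $k$ be a field of characteristic zero and let $R=\bigoplus_{i\ge 0}R_i$ be a commutative Noetherian $\mathbb N$-graded Cohen–Macaulay ring with $R_0=k$; put $\mathfrak m=\bigoplus_{i>0}R_i$ and $d=\dim R$. Graded modules are finitely generated $\mathbb Z$-graded $R$-modules, with degree-preserving homomorphisms. A graded module $M$ is called graded Cohen–Macaulay (CM) if $\operatorname{Ext}^i_R(R/\mathfrak m,M)=0$ for all $i<d$ (in particular $0$ is CM). Write $M(j)$ for the shift $M(j)_n=M_{n+j}$, $h(M)=(\dim_k M_n)_{n\in\mathbb Z}$, and $[M,X]=\dim_k\operatorname{Hom}_R(M,X)$, where $\operatorname{Hom}_R(M,X)$ is the space of degree-preserving $R$-linear maps. For graded CM modules $M,N$ write $M\le_{hom}N$ if $[M,X]\le[N,X]$ for every graded CM module $X$. Let $M$ and $N$ be graded CM modules with $h(M)=h(N)$ and $M\le_{hom}N$. (1) Suppose that $R$ is a graded isolated singularity, that is, for every graded prime ideal $\mathfrak p\neq\mathfrak m$ the homogeneous localization $R_{(\mathfrak p)}$ (obtained by inverting the homogeneous elements outside $\mathfrak p$) is regular. Then for every graded CM module $X$ there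 is an integer $l_X$ such that $[M,X(l)]=[N,X(l)]$ and $[M,X(-l)]=[N,X(-l)]$ for all $l\ge l_X$. (2) Suppose that $R$ is of graded finite representation type, that is, up to isomorphism and shift there are only finitely many indecomposable graded CM modules. Then, up to isomorphism, there are only finitely many indecomposable graded CM modules $X$ with $[N,X]-[M,X]>0$. -/

import Mathlib

universe u v

/-- An object of `mod^ℤ(R)`: a finitely generated `ℤ`-graded module over the `ℕ`-graded
`k`-algebra `R = ⨁ 𝒜 i`, with homogeneous components `deg n` for `n : ℤ`. -/
structure GrMod {k : Type v} [Field k] {R : Type u} [CommRing R] [Algebra k R]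
    (𝒜 : ℕ → Submodule k R) where
  carrier : Type u
  [addCommGroup : AddCommGroup carrier]
  [moduleBase : Module k carrier]
  [module : Module R carrier]
  [isScalarTower : IsScalarTower k R carrier]
  [finite : Module.Finite R carrier]
  deg : ℤ → Submodule k carrier
  isInternal : DirectSum.IsInternal deg
  smul_mem : ∀ (i : ℕ) (n : ℤ) (a : R) (m : carrier),
    a ∈ 𝒜 i → m ∈ deg n → a • m ∈ deg (n + i)

namespace GrMod

variable {k : Type v} [Field k] {R : Type u} [CommRing R] [Algebra k R]
  {𝒜 : ℕ → Submodule k R}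

attribute [instance] addCommGroup moduleBase module isScalarTower finite

/-- The shift `M(j)`, with `M(j)_n = M_{n+j}`. -/
def shift (M : GrMod 𝒜) (j : ℤ) : GrMod 𝒜 where
  carrier := M.carrier
  deg n := M.deg (n + j)
  isInternal := by
    have h := (DirectSum.isInternal_submodule_iff_iSupIndep_and_iSup_eq_top _).1 M.isInternal
    refine (DirectSum.isInternal_submodule_iff_iSupIndep_and_iSup_eq_top _).2 ⟨?_, ?_⟩
    · exact h.1.comp (add_left_injective j)
    · exact ((Equiv.addRight j).iSup_comp (g := M.deg)).trans h.2
  smul_mem i n a m ha hm := by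
    have h := M.smul_mem i (n + j) a m ha hm
    rwa [add_right_comm] at h

/-- `Hom_R(M, X)` in `mod^ℤ(R)`: the `k`-space of `R`-linear maps that preserve degrees. -/
def hom (M X : GrMod 𝒜) : Submodule k (M.carrier →ₗ[R] X.carrier) where
  carrier := {f | ∀ (n : ℤ) (m : M.carrier), m ∈ M.deg n → f m ∈ X.deg n}
  zero_mem' n _ _ := (X.deg n).zero_mem
  add_mem' hf hg n m hm := (X.deg n).add_mem (hf n m hm) (hg n m hm)
  smul_mem' c _ hf n m hm := (X.deg n).smul_mem c (hf n m hm)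

/-- `[M, X] = dim_k Hom_R(M, X)`. -/
noncomputable def homDim (M X : GrMod 𝒜) : ℕ := Module.finrank k (hom M X)

/-- The Hilbert function `h(M) = (dim_k M_n)_{n ∈ ℤ}`. -/
noncomputable def hilb (M : GrMod 𝒜) : ℤ → ℕ := fun n => Module.finrank k (M.deg n)

/-- Isomorphism in `mod^ℤ(R)`. -/
def Iso (M N : GrMod 𝒜) : Prop :=
  ∃ e : M.carrier ≃ₗ[R] N.carrier, ∀ (n : ℤ) (m : M.carrier), m ∈ M.deg n ↔ e m ∈ N.deg n

/-- `A` is a graded submodule of `M`: it is generated by its homogeneous elements. -/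
def IsGradedSubmodule (M : GrMod 𝒜) (A : Submodule R M.carrier) : Prop :=
  A = Submodule.span R {x | x ∈ A ∧ ∃ n : ℤ, x ∈ M.deg n}

/-- `M` is indecomposable in `mod^ℤ(R)`: it is nonzero and is not the direct sum of two nonzero
graded submodules. -/
def Indecomposable (M : GrMod 𝒜) : Prop :=
  Nontrivial M.carrier ∧ ∀ A B : Submodule R M.carrier,
    M.IsGradedSubmodule A → M.IsGradedSubmodule B → IsCompl A B → A = ⊥ ∨ B = ⊥

end GrMod

section Ring

variable {k : Type v} [Field k] {R : Type u} [CommRing R] [Algebra k R]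
  (𝒜 : ℕ → Submodule k R) [GradedAlgebra 𝒜]

/-- The ideal `𝔪 = ⨁_{i > 0} R_i`. -/
def grMaxIdeal : Ideal R := (HomogeneousIdeal.irrelevant 𝒜).toIdeal

/-- The Cohen-Macaulay condition `Ext^i_R(R/𝔪, M) = 0` for all `i < dim R`.
As `R` is Noetherian and `R/𝔪` is finitely generated, for a graded module `M` the module
`Ext^i_R(R/𝔪, M)` is the underlying module of the graded `*Ext^i_R(R/𝔪, M)`. -/
def IsGradedCM (M : Type u) [AddCommGroup M] [Module R M] : Prop :=
  ∀ i : ℕ, ((i : ℕ∞) : WithBot ℕ∞) < ringKrullDim R →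
    Subsingleton (CategoryTheory.Abelian.Ext
      (ModuleCat.of R (R ⧸ grMaxIdeal 𝒜)) (ModuleCat.of R M) i)

/-- The homogeneous elements of `R` outside the prime ideal `p`. -/
def homogeneousCompl (p : Ideal R) [p.IsPrime] : Submonoid R :=
  SetLike.homogeneousSubmonoid 𝒜 ⊓ p.primeCompl

/-- `R` is a graded isolated singularity: the homogeneous localization `R_(p)`, which inverts the
homogeneous elements outside `p`, is a regular ring for every graded prime `p ≠ 𝔪`. -/
def IsGradedIsolatedSingularity : Prop :=
  ∀ (p : Ideal R) [p.IsPrime], p.IsHomogeneous 𝒜 → p ≠ grMaxIdeal 𝒜 →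
    IsRegularRing (Localization (homogeneousCompl 𝒜 p))

variable {𝒜}

/-- `M ∈ CM^ℤ(R)`. -/
def GrMod.IsCM (M : GrMod 𝒜) : Prop := IsGradedCM 𝒜 M.carrier

/-- The hom order on `CM^ℤ(R)`: `[M, X] ≤ [N, X]` for every `X ∈ CM^ℤ(R)`. -/
def GrMod.HomLE (M N : GrMod 𝒜) : Prop :=
  ∀ X : GrMod 𝒜, X.IsCM → M.homDim X ≤ N.homDim X

variable (𝒜) in
/-- `CM^ℤ(R)` is of graded finite representation type: up to isomorphism and shift there are only
finitely many indecomposable graded Cohen-Macaulay modules. -/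
def IsGradedFiniteRepType : Prop :=
  ∃ (r : ℕ) (Y : Fin r → GrMod 𝒜), ∀ X : GrMod 𝒜, X.IsCM → X.Indecomposable →
    ∃ (i : Fin r) (j : ℤ), X.Iso ((Y i).shift j)

end Ring

/-!
Choose homogeneous parameters of positive degree that are regular on `R`, `M`, `N` and `X`, and let
`S` be the polynomial subalgebra of `R` they generate, over which these modules are free. Since `M`
and `N` have the same Hilbert function, they are isomorphic as graded `S`-modules, so
`[M, W(l)] = [N, W(l)]` for the coinduced module `W = Hom_S(R, X)`. The embedding `X → W` splits
over `S`, hence its cokernel `Y` is Cohen-Macaulay. If the cokernel of `Hom(L, W) → Hom(L, Y)` is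
`𝔪`-torsion for `L = M, N`, then it is finite-dimensional, so `[L, X(l)] + [L, Y(l)] = [L, W(l)]`
for all but finitely many `l`, and the inequalities `[M, X(l)] ≤ [N, X(l)]` and
`[M, Y(l)] ≤ [N, Y(l)]` are equalities.

Torsion of that cokernel says that for `f : L → Y` and `r ∈ 𝔪` homogeneous some `r ^ n • f` lifts to
`W`. For an isolated singularity, `L` is free at the homogeneous primes `𝔭 ≠ 𝔪`, so some `s ∉ 𝔭`
acts on `L` through a free module. For finite representation type, the pullbacks of `W → Y` along
the maps `r ^ n • f` fall into finitely many isomorphism classes, and if those along `g` and `a • g`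
with `a ∈ 𝔪` are isomorphic, then counting homomorphisms as in Miyata's theorem makes `g` lift.
-/

section GradedProj

open DirectSum Filter

variable {ι k V V' : Type*} [DecidableEq ι] [Semiring k]

section

variable [AddCommMonoid V] [Module k V] (ℳ : ι → Submodule k V) [Decomposition ℳ]

/-- The projection of a graded module onto its component of degree `i`, as an endomorphism. -/
def gradedProj (i : ι) : V →ₗ[k] V :=
  (ℳ i).subtype ∘ₗ DirectSum.component k ι (fun i => ℳ i) i ∘ₗ (decomposeLinearEquiv ℳ).toLinearMap

theorem gradedProj_mem (i : ι) (x : V) : gradedProj ℳ i x ∈ ℳ i :=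
  SetLike.coe_mem (decompose ℳ x i)

variable {ℳ}

theorem gradedProj_of_mem {i : ι} {x : V} (hx : x ∈ ℳ i) : gradedProj ℳ i x = x :=
  decompose_of_mem_same ℳ hx

theorem gradedProj_of_mem_ne {i j : ι} {x : V} (hx : x ∈ ℳ i) (hij : i ≠ j) :
    gradedProj ℳ j x = 0 :=
  decompose_of_mem_ne ℳ hx hij

variable (ℳ)

theorem homogeneous_induction {P : V → Prop} (mem : ∀ i, ∀ x ∈ ℳ i, P x)
    (add : ∀ x y, P x → P y → P (x + y)) (x : V) (zero : P 0 := by simp) : P x :=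
  Decomposition.inductionOn ℳ zero (fun m => mem _ m m.2) add x

theorem span_homogeneous_eq_top : Submodule.span k {x | ∃ i, x ∈ ℳ i} = ⊤ := by
  rw [← (Decomposition.isInternal ℳ).submodule_iSup_eq_top, Submodule.iSup_eq_span,
    Set.ofPred_exists]
  rfl

theorem gradedProj_mem_span {s : Set V} (hs : ∀ x ∈ s, ∃ i, x ∈ ℳ i) {x : V}
    (hx : x ∈ Submodule.span k s) (j : ι) : gradedProj ℳ j x ∈ Submodule.span k s := by
  induction hx using Submodule.span_induction with
  | mem x hx =>
    obtain ⟨i, hi⟩ := hs x hx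
    by_cases h : i = j
    · rw [← h, gradedProj_of_mem hi]
      exact Submodule.subset_span hx
    · rw [gradedProj_of_mem_ne hi h]
      exact Submodule.zero_mem _
  | zero => rw [map_zero]; exact Submodule.zero_mem _
  | add x y _ _ hx hy => rw [map_add]; exact Submodule.add_mem _ hx hy
  | smul c x _ hx => rw [map_smul]; exact Submodule.smul_mem _ c hx

theorem eventually_sum_gradedProj (x : V) :
    ∀ᶠ s : Finset ι in atTop, ∑ i ∈ s, gradedProj ℳ i x = x := by
  classical
  refine (eventually_ge_atTop (decompose ℳ x).support).mono fun s hs => ?_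
  have hzero : ∀ i ∈ s, i ∉ (decompose ℳ x).support → gradedProj ℳ i x = 0 := fun i _ hi =>
    congrArg Subtype.val (DFinsupp.notMem_support_iff (f := decompose ℳ x).1 hi)
  exact (Finset.sum_subset hs hzero).symm.trans (sum_support_decompose ℳ x)

variable {ℳ} in
theorem ext_gradedProj {x y : V} (h : ∀ i, gradedProj ℳ i x = gradedProj ℳ i y) : x = y :=
  (decompose ℳ).injective (DFinsupp.ext fun i => Subtype.ext (h i))

variable {ℳ} in
theorem linearMap_ext_of_homogeneous {A : Type*} [Semiring A] [Module A V] [AddCommMonoid V']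
    [Module A V'] {f g : V →ₗ[A] V'} (h : ∀ i, ∀ x ∈ ℳ i, f x = g x) : f = g :=
  LinearMap.ext (homogeneous_induction ℳ h fun x y hx hy => by rw [map_add, map_add, hx, hy])

end

theorem isInternal_of_proj {k V : Type*} [Ring k] [AddCommGroup V] [Module k V]
    {ℳ : ι → Submodule k V} (π : ι → V →+ V) (hmem : ∀ i x, π i x ∈ ℳ i)
    (hself : ∀ i, ∀ x ∈ ℳ i, π i x = x) (hne : ∀ i j, i ≠ j → ∀ x ∈ ℳ i, π j x = 0)
    (hsum : ∀ x, ∃ s : Finset ι, ∑ i ∈ s, π i x = x) : DirectSum.IsInternal ℳ := by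
  refine (isInternal_submodule_iff_iSupIndep_and_iSup_eq_top _).2
    ⟨fun i => Submodule.disjoint_def.2 fun x hx hx' => ?_, eq_top_iff.2 fun x _ => ?_⟩
  · have hsub : ⨆ j, ⨆ (_ : j ≠ i), ℳ j = ⨆ j : {j // j ≠ i}, ℳ j := iSup_subtype'
    rw [hsub] at hx'
    rw [← hself i x hx]
    exact Submodule.iSup_induction (fun j : {j // j ≠ i} => ℳ j) (motive := fun x => π i x = 0) hx'
      (fun j y hy => hne j i j.2 y hy) (map_zero _)
      fun y z hy hz => by rw [map_add, hy, hz, add_zero]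
  · obtain ⟨s, hs⟩ := hsum x
    rw [← hs]
    exact Submodule.sum_mem _ fun i _ => Submodule.mem_iSup_of_mem i (hmem i x)

theorem finite_setOf_ne_bot_of_isInternal {k V : Type*} [Ring k] [AddCommGroup V] [Module k V]
    [IsNoetherian k V] {ℳ : ι → Submodule k V} (h : DirectSum.IsInternal ℳ) :
    {i | ℳ i ≠ ⊥}.Finite :=
  WellFoundedGT.finite_ne_bot_of_iSupIndep h.submodule_iSupIndep

section Shift

variable [AddCommMonoid V] [Module k V] [AddCommMonoid V'] [Module k V'] {ℳ : ι → Submodule k V}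
  [Decomposition ℳ] {ℳ' : ι → Submodule k V'} [Decomposition ℳ'] [AddCommGroup ι]

theorem gradedProj_map {l : ι} {f : V →+ V'} (hf : ∀ i, ∀ x ∈ ℳ i, f x ∈ ℳ' (i + l)) (i : ι)
    (x : V) : gradedProj ℳ' (i + l) (f x) = f (gradedProj ℳ i x) := by
  refine homogeneous_induction ℳ (P := fun x => gradedProj ℳ' (i + l) (f x) = f (gradedProj ℳ i x))
    (fun j x hx => ?_) (fun x y hx hy => by simp only [map_add, hx, hy]) x
  by_cases hj : j = i
  · subst hj
    rw [gradedProj_of_mem hx, gradedProj_of_mem (hf _ _ hx)]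
  · rw [gradedProj_of_mem_ne hx hj,
      gradedProj_of_mem_ne (hf _ _ hx) fun h => hj (add_right_cancel h), map_zero]

end Shift

end GradedProj

section GradedHom

open DirectSum Filter

variable {ι k A V V' : Type*} [DecidableEq ι] [AddCommGroup ι] [CommRing k] [CommRing A]
  [Algebra k A] [AddCommGroup V] [Module k V] [Module A V] [IsScalarTower k A V]
  [AddCommGroup V'] [Module k V'] [Module A V'] [IsScalarTower k A V']
  (ℳ : ι → Submodule k V) (ℳ' : ι → Submodule k V')

variable (A) in
/-- The `A`-linear maps that raise degrees by `l`. -/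
def homDeg (l : ι) : Submodule k (V →ₗ[A] V') where
  carrier := {f | ∀ i, ∀ x ∈ ℳ i, f x ∈ ℳ' (i + l)}
  zero_mem' i _ _ := (ℳ' (i + l)).zero_mem
  add_mem' hf hg i x hx := (ℳ' (i + l)).add_mem (hf i x hx) (hg i x hx)
  smul_mem' c _ hf i x hx := (ℳ' (i + l)).smul_mem c (hf i x hx)

/-- The scalar `a` acts on both graded spaces as a map of degree `e`. -/
def IsHomogeneousScalar (a : A) (e : ι) : Prop :=
  (∀ i, ∀ x ∈ ℳ i, a • x ∈ ℳ (i + e)) ∧ ∀ i, ∀ x ∈ ℳ' i, a • x ∈ ℳ' (i + e)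

variable [Decomposition ℳ] [Decomposition ℳ'] {ℳ ℳ'}

variable (ℳ ℳ')

/-- The component of degree `l` of a linear map: on `ℳ i` it is `f` followed by the projection onto
`ℳ' (i + l)`. -/
noncomputable def linearMapComponent (l : ι) (f : V →ₗ[k] V') : V →ₗ[k] V' :=
  DirectSum.toModule k ι V' (fun i => gradedProj ℳ' (i + l) ∘ₗ f ∘ₗ (ℳ i).subtype) ∘ₗ
    (decomposeLinearEquiv ℳ).toLinearMap

variable {ℳ ℳ'}

theorem linearMapComponent_of_mem (l : ι) (f : V →ₗ[k] V') {i : ι} {x : V} (hx : x ∈ ℳ i) :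
    linearMapComponent ℳ ℳ' l f x = gradedProj ℳ' (i + l) (f x) := by
  lift x to ℳ i using hx
  simp [linearMapComponent]

theorem linearMapComponent_smul (l : ι) (f : V →ₗ[A] V') {a : A} {e : ι}
    (ha : IsHomogeneousScalar ℳ ℳ' a e) (x : V) :
    linearMapComponent ℳ ℳ' l (f.restrictScalars k) (a • x) =
      a • linearMapComponent ℳ ℳ' l (f.restrictScalars k) x := by
  refine homogeneous_induction ℳ
    (P := fun x => linearMapComponent ℳ ℳ' l (f.restrictScalars k) (a • x) =
      a • linearMapComponent ℳ ℳ' l (f.restrictScalars k) x) (fun i x hx => ?_)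
    (fun x y hx hy => by rw [smul_add, map_add, map_add, hx, hy, smul_add]) x
  rw [linearMapComponent_of_mem l _ hx, linearMapComponent_of_mem l _ (ha.1 i x hx),
    LinearMap.restrictScalars_apply, LinearMap.restrictScalars_apply, map_smul, add_right_comm]
  exact gradedProj_map (f := DistribSMul.toAddMonoidHom V' a) ha.2 (i + l) (f x)

variable (hA : Submodule.span k {a : A | ∃ e, IsHomogeneousScalar ℳ ℳ' a e} = ⊤)

/-- The component of degree `l` of an `A`-linear map, when `A` is spanned by homogeneous scalars. -/
noncomputable def homComponent (l : ι) (f : V →ₗ[A] V') : V →ₗ[A] V' where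
  toFun := linearMapComponent ℳ ℳ' l (f.restrictScalars k)
  map_add' := map_add _
  map_smul' a x := by
    have ha : a ∈ Submodule.span k {a : A | ∃ e, IsHomogeneousScalar ℳ ℳ' a e} := hA ▸ trivial
    induction ha using Submodule.span_induction with
    | mem a ha => exact linearMapComponent_smul l f ha.choose_spec x
    | zero => simp
    | add a b _ _ ha hb => rw [add_smul, map_add, ha, hb, ← add_smul]; rfl
    | smul c a _ ha => rw [smul_assoc, map_smul, ha]; exact (smul_assoc c a _).symm

theorem homComponent_of_mem (l : ι) (f : V →ₗ[A] V') {i : ι} {x : V} (hx : x ∈ ℳ i) :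
    homComponent hA l f x = gradedProj ℳ' (i + l) (f x) :=
  linearMapComponent_of_mem l (f.restrictScalars k) hx

theorem homComponent_mem (l : ι) (f : V →ₗ[A] V') : homComponent hA l f ∈ homDeg A ℳ ℳ' l := by
  intro i x hx
  rw [homComponent_of_mem hA l f hx]
  exact gradedProj_mem ℳ' _ _

theorem eventually_sum_homComponent_apply (f : V →ₗ[A] V') (x : V) :
    ∀ᶠ s : Finset ι in atTop, ∑ l ∈ s, homComponent hA l f x = f x := by
  refine homogeneous_induction ℳ
    (P := fun x => ∀ᶠ s : Finset ι in atTop, ∑ l ∈ s, homComponent hA l f x = f x)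
    (fun i x hx => ?_) (fun x y hx hy => ?_) x
  · have hshift : Tendsto (Finset.image (i + ·)) atTop atTop :=
      tendsto_finset_image_atTop_atTop (i := (-i + ·)) (add_neg_cancel_left i)
    filter_upwards [hshift.eventually (eventually_sum_gradedProj ℳ' (f x))] with s hs
    rw [Finset.sum_image fun a _ b _ => add_left_cancel] at hs
    simpa only [homComponent_of_mem hA _ f hx] using hs
  · filter_upwards [hx, hy] with s hs ht
    simp only [map_add, Finset.sum_add_distrib, hs, ht]

include hA in
theorem isInternal_homDeg [Module.Finite A V] : DirectSum.IsInternal (homDeg A ℳ ℳ') := by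
  refine isInternal_of_proj (fun l => AddMonoidHom.mk' (homComponent hA l) fun f g => ?_)
    (homComponent_mem hA) (fun l f hf => ?_) (fun l n hln f hf => ?_) fun f => ?_
  · refine linearMap_ext_of_homogeneous (ℳ := ℳ) fun i x hx => ?_
    simp only [LinearMap.add_apply, homComponent_of_mem hA l _ hx, map_add]
  · refine linearMap_ext_of_homogeneous (ℳ := ℳ) fun i x hx => ?_
    exact (homComponent_of_mem hA l _ hx).trans (gradedProj_of_mem (hf i x hx))
  · refine linearMap_ext_of_homogeneous (ℳ := ℳ) fun i x hx => ?_
    exact (homComponent_of_mem hA n _ hx).trans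
      (gradedProj_of_mem_ne (hf i x hx) fun h => hln (add_left_cancel h))
  · obtain ⟨S, hS⟩ := Module.Finite.fg_top (R := A) (M := V)
    obtain ⟨s, hs⟩ := ((eventually_all_finset S).2 fun x _ =>
      eventually_sum_homComponent_apply hA f x).exists
    exact ⟨s, LinearMap.ext_on hS fun x hx => (LinearMap.sum_apply s _ x).trans (hs x hx)⟩

end GradedHom

section GradedModules

open DirectSum Filter

variable {k : Type v} [Field k] {R : Type u} [CommRing R] [Algebra k R] {𝒜 : ℕ → Submodule k R}

namespace GrMod

noncomputable instance (M : GrMod 𝒜) : Decomposition M.deg := M.isInternal.chooseDecomposition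

/-- The projection of a graded module onto its component of degree `n`. -/
noncomputable abbrev proj (M : GrMod 𝒜) (n : ℤ) : M.carrier →ₗ[k] M.carrier := gradedProj M.deg n

theorem proj_smul (M : GrMod 𝒜) {i : ℕ} {a : R} (ha : a ∈ 𝒜 i) (n : ℤ) (x : M.carrier) :
    M.proj n (a • x) = a • M.proj (n - i) x := by
  have h := gradedProj_map (f := DistribSMul.toAddMonoidHom M.carrier a)
    (fun n x hx => M.smul_mem i n a x ha hx) (n - i) x
  rwa [sub_add_cancel] at h

theorem proj_map {M N : GrMod 𝒜} {f : M.carrier →ₗ[R] N.carrier} (hf : f ∈ hom M N) (n : ℤ)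
    (x : M.carrier) : N.proj n (f x) = f (M.proj n x) := by
  have h := gradedProj_map (f := f.toAddMonoidHom) (ℳ := M.deg) (ℳ' := N.deg) (l := 0)
    (fun n x hx => (add_zero n).symm ▸ hf n x hx) n x
  rwa [add_zero] at h

theorem isHomogeneous_ker {M N : GrMod 𝒜} {f : M.carrier →ₗ[R] N.carrier} (hf : f ∈ hom M N) :
    (LinearMap.ker f).IsHomogeneous M.deg := fun n x hx => by
  rw [LinearMap.mem_ker] at hx ⊢
  exact (proj_map hf n x).symm.trans (by rw [hx, map_zero])

theorem isHomogeneous_range {M N : GrMod 𝒜} {f : M.carrier →ₗ[R] N.carrier} (hf : f ∈ hom M N) :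
    (LinearMap.range f).IsHomogeneous N.deg := by
  rintro n _ ⟨x, rfl⟩
  exact ⟨M.proj n x, (proj_map hf n x).symm⟩

/-- A homogeneous submodule as a graded module. -/
noncomputable def ofSub [IsNoetherianRing R] (M : GrMod 𝒜) (A : Submodule R M.carrier)
    (hA : A.IsHomogeneous M.deg) : GrMod 𝒜 where
  carrier := A
  deg n := (M.deg n).comap (A.subtype.restrictScalars k)
  isInternal := by
    refine isInternal_of_proj
      (fun n => AddMonoidHom.mk' (fun x : A => ⟨M.proj n x, hA n x.2⟩) fun x y => ?_)
      (fun n x => gradedProj_mem M.deg n x) (fun n x hx => Subtype.ext (gradedProj_of_mem hx))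
      (fun m n hmn x hx => Subtype.ext (gradedProj_of_mem_ne hx hmn)) fun x => ?_
    · exact Subtype.ext (map_add _ _ _)
    · obtain ⟨s, hs⟩ := (eventually_sum_gradedProj M.deg (x : M.carrier)).exists
      exact ⟨s, Subtype.ext ((AddSubmonoidClass.coe_finsetSum _ _).trans hs)⟩
  smul_mem i n a m ha hm := M.smul_mem i n a m ha hm

/-- The quotient by a homogeneous submodule as a graded module. -/
noncomputable def ofQuot (M : GrMod 𝒜) (A : Submodule R M.carrier)
    (hA : A.IsHomogeneous M.deg) : GrMod 𝒜 where
  carrier := M.carrier ⧸ A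
  deg n := (M.deg n).map (A.mkQ.restrictScalars k)
  isInternal := by
    let π : ℤ → (M.carrier ⧸ A) →+ (M.carrier ⧸ A) := fun n =>
      QuotientAddGroup.map A.toAddSubgroup A.toAddSubgroup (M.proj n).toAddMonoidHom
        fun _ hx => hA n hx
    have hπ : ∀ n x, π n (A.mkQ x) = A.mkQ (M.proj n x) := fun n x => rfl
    refine isInternal_of_proj π (fun n x => ?_) ?_ ?_ fun x => ?_
    · obtain ⟨x, rfl⟩ := A.mkQ_surjective x
      exact ⟨_, gradedProj_mem M.deg n x, rfl⟩
    · rintro n _ ⟨x, hx, rfl⟩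
      exact (hπ n x).trans (congrArg _ (gradedProj_of_mem hx))
    · rintro m n hmn _ ⟨x, hx, rfl⟩
      exact (hπ n x).trans (by rw [gradedProj_of_mem_ne hx hmn, map_zero])
    · obtain ⟨x, rfl⟩ := A.mkQ_surjective x
      obtain ⟨s, hs⟩ := (eventually_sum_gradedProj M.deg x).exists
      exact ⟨s, by simp only [hπ, ← map_sum, hs]⟩
  smul_mem i n a m ha hm := by
    obtain ⟨x, hx, rfl⟩ := hm
    exact ⟨a • x, M.smul_mem i n a x ha hx, rfl⟩

theorem mkQ_mem_hom (M : GrMod 𝒜) (A : Submodule R M.carrier) (hA : A.IsHomogeneous M.deg) :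
    (A.mkQ : M.carrier →ₗ[R] (M.ofQuot A hA).carrier) ∈ hom M (M.ofQuot A hA) :=
  fun _ m hm => ⟨m, hm, rfl⟩

/-- The direct sum of two graded modules. -/
noncomputable def prod (M N : GrMod 𝒜) : GrMod 𝒜 where
  carrier := M.carrier × N.carrier
  deg n := (M.deg n).prod (N.deg n)
  isInternal := by
    refine isInternal_of_proj (fun n => ((M.proj n).prodMap (N.proj n)).toAddMonoidHom)
      (fun n x => ⟨gradedProj_mem M.deg n x.1, gradedProj_mem N.deg n x.2⟩)
      (fun n x hx => Prod.ext (gradedProj_of_mem hx.1) (gradedProj_of_mem hx.2))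
      (fun m n hmn x hx =>
        Prod.ext (gradedProj_of_mem_ne hx.1 hmn) (gradedProj_of_mem_ne hx.2 hmn)) fun x => ?_
    obtain ⟨s, hs₁, hs₂⟩ := ((eventually_sum_gradedProj M.deg x.1).and
      (eventually_sum_gradedProj N.deg x.2)).exists
    exact ⟨s, Prod.ext (Prod.fst_sum.trans hs₁) (Prod.snd_sum.trans hs₂)⟩
  smul_mem i n a m ha hm := ⟨M.smul_mem i n a m.1 ha hm.1, N.smul_mem i n a m.2 ha hm.2⟩

theorem exists_homogeneous_generators (M : GrMod 𝒜) :
    ∃ s : Finset M.carrier, Submodule.span R (s : Set M.carrier) = ⊤ ∧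
      ∀ x ∈ s, ∃ n, x ∈ M.deg n := by
  classical
  obtain ⟨s, hs⟩ := Module.Finite.fg_top (R := R) (M := M.carrier)
  obtain ⟨t, ht⟩ := ((eventually_all_finset s).2 fun x _ =>
    eventually_sum_gradedProj M.deg x).exists
  refine ⟨s.biUnion fun x => t.image fun n => M.proj n x, ?_, fun x hx => ?_⟩
  · rw [eq_top_iff, ← hs, Submodule.span_le]
    intro x hx
    rw [← ht x hx]
    refine Submodule.sum_mem _ fun n hn => Submodule.subset_span ?_
    exact Finset.mem_biUnion.2 ⟨x, hx, Finset.mem_image_of_mem _ hn⟩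
  · obtain ⟨y, -, n, -, rfl⟩ : ∃ y ∈ s, ∃ n ∈ t, M.proj n y = x := by simpa using hx
    exact ⟨n, gradedProj_mem M.deg n y⟩

theorem exists_generators_bounded (M : GrMod 𝒜) :
    ∃ (s : Finset M.carrier) (B : ℕ), Submodule.span R (s : Set M.carrier) = ⊤ ∧
      ∀ x ∈ s, ∃ n : ℤ, -B ≤ n ∧ n ≤ B ∧ x ∈ M.deg n := by
  classical
  obtain ⟨s, hs, hd⟩ := M.exists_homogeneous_generators
  choose! d hd using hd
  refine ⟨s, s.sup fun x => (d x).natAbs, hs, fun x hx => ⟨d x, ?_, ?_, hd x hx⟩⟩ <;>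
  · have hle : (d x).natAbs ≤ s.sup fun x => (d x).natAbs :=
      Finset.le_sup (f := fun x => (d x).natAbs) hx
    omega

section Graded

variable [GradedAlgebra 𝒜]

theorem isHomogeneous_span (M : GrMod 𝒜) {s : Set M.carrier} (hs : ∀ x ∈ s, ∃ n, x ∈ M.deg n) :
    (Submodule.span R s).IsHomogeneous M.deg := by
  intro n x hx
  have hspan := Submodule.span_smul_of_span_eq_top (span_homogeneous_eq_top 𝒜) s
  refine hspan.le (gradedProj_mem_span M.deg ?_ (hspan.ge hx) n)
  rintro _ ⟨a, ⟨e, ha⟩, x, hx, rfl⟩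
  exact (hs x hx).imp' (· + (e : ℤ)) fun n hn => M.smul_mem e n a x ha hn

theorem IsGradedSubmodule.isHomogeneous {M : GrMod 𝒜} {A : Submodule R M.carrier}
    (hA : M.IsGradedSubmodule A) : A.IsHomogeneous M.deg := by
  rw [hA]
  exact M.isHomogeneous_span fun x hx => hx.2

/-- The truncation `⨁_{n ≥ b} M_n`, described by the vanishing of the lower components. -/
noncomputable def ge (M : GrMod 𝒜) (b : ℤ) : Submodule R M.carrier where
  carrier := {x | ∀ n < b, M.proj n x = 0}
  zero_mem' n _ := map_zero _
  add_mem' hx hy n hn := by rw [map_add, hx n hn, hy n hn, add_zero]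
  smul_mem' r x hx n hn := by
    induction r using Decomposition.inductionOn 𝒜 with
    | zero => simp
    | homogeneous a => rw [M.proj_smul a.2, hx _ (by omega), smul_zero]
    | add a b ha hb => rw [add_smul, map_add, ha, hb, add_zero]

theorem mem_ge_of_mem (M : GrMod 𝒜) {b n : ℤ} (hb : b ≤ n) {x : M.carrier} (hx : x ∈ M.deg n) :
    x ∈ M.ge b :=
  fun _ hm => gradedProj_of_mem_ne hx (by omega)

theorem exists_ge_eq_top (M : GrMod 𝒜) : ∃ b : ℤ, M.ge b = ⊤ := by
  obtain ⟨s, B, hs, hB⟩ := M.exists_generators_bounded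
  refine ⟨-B, eq_top_iff.2 ?_⟩
  rw [← hs, Submodule.span_le]
  intro x hx
  obtain ⟨n, hn, -, h⟩ := hB x hx
  exact M.mem_ge_of_mem hn h

theorem deg_eq_bot_of_ge_eq_top {M : GrMod 𝒜} {b : ℤ} (hb : M.ge b = ⊤) {n : ℤ} (hn : n < b) :
    M.deg n = ⊥ := by
  refine eq_bot_iff.2 fun x hx => ?_
  have hx' : x ∈ M.ge b := hb ▸ trivial
  exact (gradedProj_of_mem hx).symm.trans (hx' n hn)

end Graded

end GrMod

section Irrelevant

variable (𝒜) [GradedAlgebra 𝒜]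

theorem mem_grMaxIdeal_of_mem {i : ℕ} (hi : 0 < i) {a : R} (ha : a ∈ 𝒜 i) : a ∈ grMaxIdeal 𝒜 :=
  HomogeneousIdeal.mem_irrelevant_of_mem 𝒜 hi ha

theorem grMaxIdeal_eq_span : grMaxIdeal 𝒜 = Ideal.span {a : R | ∃ i, 0 < i ∧ a ∈ 𝒜 i} := by
  classical
  refine le_antisymm (fun a ha => ?_) (Ideal.span_le.2 ?_)
  · rw [← sum_support_decompose 𝒜 a]
    refine Ideal.sum_mem _ fun i hi => Ideal.subset_span ⟨i, ?_, SetLike.coe_mem _⟩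
    refine Nat.pos_of_ne_zero ?_
    rintro rfl
    exact DFinsupp.mem_support_iff.1 hi
      (Subtype.ext ((HomogeneousIdeal.mem_irrelevant_iff 𝒜 a).1 ha))
  · rintro a ⟨i, hi, ha⟩
    exact mem_grMaxIdeal_of_mem 𝒜 hi ha

variable (hR0 : Function.Bijective (algebraMap k (𝒜 0)))

include hR0

theorem exists_proj_zero_eq_algebraMap (a : R) :
    ∃ c : k, (decompose 𝒜 a 0 : R) = algebraMap k R c := by
  obtain ⟨c, hc⟩ := hR0.2 (decompose 𝒜 a 0)
  exact ⟨c, (congrArg Subtype.val hc).symm⟩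

theorem exists_sub_mem_grMaxIdeal (a : R) : ∃ c : k, a - algebraMap k R c ∈ grMaxIdeal 𝒜 := by
  obtain ⟨c, hc⟩ := exists_proj_zero_eq_algebraMap 𝒜 hR0 a
  refine ⟨c, (HomogeneousIdeal.mem_irrelevant_iff 𝒜 _).2 ?_⟩
  rw [map_sub, GradedRing.proj_apply, GradedRing.proj_apply,
    decompose_of_mem_same 𝒜 (SetLike.algebraMap_mem_graded 𝒜 c), hc, sub_self]

theorem le_grMaxIdeal_of_isHomogeneous {I : Ideal R} (hI : I.IsHomogeneous 𝒜) (hne : I ≠ ⊤) :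
    I ≤ grMaxIdeal 𝒜 := by
  intro a ha
  obtain ⟨c, hc⟩ := exists_proj_zero_eq_algebraMap 𝒜 hR0 a
  refine (HomogeneousIdeal.mem_irrelevant_iff 𝒜 _).2 (hc.trans ?_)
  by_contra hc0
  have hunit : IsUnit (algebraMap k R c) := (Ne.isUnit fun h => hc0 (by rw [h, map_zero])).map _
  exact hne (I.eq_top_of_isUnit_mem (hc ▸ hI 0 ha) hunit)

theorem grMaxIdeal_ne_top : grMaxIdeal 𝒜 ≠ ⊤ := by
  intro h
  have h1 := (HomogeneousIdeal.mem_irrelevant_iff 𝒜 _).1 ((Ideal.eq_top_iff_one _).1 h)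
  rw [GradedRing.proj_apply, decompose_of_mem_same 𝒜 SetLike.GradedOne.one_mem] at h1
  refine one_ne_zero (hR0.1 (a₁ := 1) (a₂ := 0) ?_)
  rw [map_one, map_zero]
  exact Subtype.ext h1

theorem grMaxIdeal_isMaximal : (grMaxIdeal 𝒜).IsMaximal := by
  refine Ideal.isMaximal_iff.2 ⟨fun h => grMaxIdeal_ne_top 𝒜 hR0 ((Ideal.eq_top_iff_one _).2 h),
    fun J x hJ hx hxJ => ?_⟩
  obtain ⟨c, hc⟩ := exists_sub_mem_grMaxIdeal 𝒜 hR0 x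
  have hcJ : algebraMap k R c ∈ J := by simpa using J.sub_mem hxJ (hJ hc)
  have hc0 : c ≠ 0 := fun h => hx (by simpa [h] using hc)
  exact (Ideal.eq_top_iff_one J).1 (J.eq_top_of_isUnit_mem hcJ (hc0.isUnit.map _))

theorem finite_of_smul_top_eq_bot {D : Type*} [AddCommGroup D] [Module k D] [Module R D]
    [IsScalarTower k R D] [Module.Finite R D]
    (hD : grMaxIdeal 𝒜 • (⊤ : Submodule R D) = ⊥) : Module.Finite k D := by
  obtain ⟨s, hs⟩ := Module.Finite.fg_top (R := R) (M := D)
  refine ⟨⟨s, eq_top_iff.2 fun x _ => ?_⟩⟩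
  have hx : x ∈ Submodule.span R (s : Set D) := hs ▸ trivial
  induction hx using Submodule.span_induction with
  | mem x hx => exact Submodule.subset_span hx
  | zero => exact Submodule.zero_mem _
  | add x y _ _ hx hy => exact Submodule.add_mem _ (hx trivial) (hy trivial)
  | smul a x _ hx =>
    obtain ⟨c, hc⟩ := exists_sub_mem_grMaxIdeal 𝒜 hR0 a
    have hcx : (a - algebraMap k R c) • x ∈ grMaxIdeal 𝒜 • (⊤ : Submodule R D) :=
      Submodule.smul_mem_smul hc trivial
    rw [hD, Submodule.mem_bot, sub_smul, sub_eq_zero, algebraMap_smul] at hcx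
    rw [hcx]
    exact Submodule.smul_mem _ _ (hx trivial)

omit [GradedAlgebra 𝒜] hR0 in
theorem map_mkQ_smul_top {C : Type*} [AddCommGroup C] [Module R C] (I : Ideal R)
    (A : Submodule R C) :
    (I • (⊤ : Submodule R C)).map A.mkQ = I • (⊤ : Submodule R (C ⧸ A)) := by
  rw [Submodule.map_smul'', Submodule.map_top, Submodule.range_mkQ]

theorem finite_of_pow_smul_top_eq_bot [IsNoetherianRing R] (K : ℕ) {C : Type*} [AddCommGroup C]
    [Module k C] [Module R C] [IsScalarTower k R C] [Module.Finite R C]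
    (h : (grMaxIdeal 𝒜) ^ K • (⊤ : Submodule R C) = ⊥) : Module.Finite k C := by
  induction K generalizing C with
  | zero =>
    rw [pow_zero, Ideal.one_eq_top, Submodule.top_smul] at h
    have : Subsingleton C :=
      (Submodule.subsingleton_iff R).1 (subsingleton_of_bot_eq_top h.symm)
    infer_instance
  | succ K ih =>
    let A : Submodule R C := (grMaxIdeal 𝒜) ^ K • ⊤
    have hsub : Module.Finite k (A.restrictScalars k) := by
      refine finite_of_smul_top_eq_bot 𝒜 hR0 (D := A)
        (Submodule.map_injective_of_injective A.injective_subtype ?_)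
      rw [Submodule.map_smul'', Submodule.map_top, Submodule.range_subtype, Submodule.map_bot,
        ← h, pow_succ', Submodule.mul_smul]
    have hquot : Module.Finite k (C ⧸ A.restrictScalars k) :=
      ih (C := C ⧸ A) ((map_mkQ_smul_top _ A).symm.trans (Submodule.mkQ_map_self A))
    exact Module.Finite.of_submodule_quotient (A.restrictScalars k)

end Irrelevant

namespace GrMod

variable [GradedAlgebra 𝒜]

theorem smul_ge_le (M : GrMod 𝒜) (b : ℤ) : grMaxIdeal 𝒜 • M.ge b ≤ M.ge (b + 1) := by
  rw [grMaxIdeal_eq_span, ← Submodule.span_eq (M.ge b), Submodule.span_smul_span,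
    Submodule.span_le]
  rintro _ ⟨a, ⟨i, hi, ha⟩, x, hx, rfl⟩ n hn
  exact (M.proj_smul ha n x).trans (by rw [hx _ (by omega), smul_zero])

theorem pow_smul_top_le (M : GrMod 𝒜) {b : ℤ} (hb : M.ge b = ⊤) (K : ℕ) :
    (grMaxIdeal 𝒜) ^ K • (⊤ : Submodule R M.carrier) ≤ M.ge (b + K) := by
  induction K with
  | zero => simp [hb]
  | succ K ih =>
    rw [pow_succ', Submodule.mul_smul, Nat.cast_succ, ← add_assoc]
    exact (smul_mono_right _ ih).trans (M.smul_ge_le _)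

theorem subsingleton_of_smul_top_eq_top (M : GrMod 𝒜)
    (h : grMaxIdeal 𝒜 • (⊤ : Submodule R M.carrier) = ⊤) : Subsingleton M.carrier := by
  obtain ⟨b, hb⟩ := M.exists_ge_eq_top
  have hpow : ∀ K, (grMaxIdeal 𝒜) ^ K • (⊤ : Submodule R M.carrier) = ⊤ := fun K => by
    induction K with
    | zero => simp
    | succ K ih => rw [pow_succ, Submodule.mul_smul, h, ih]
  refine subsingleton_of_forall_eq 0 fun x => ext_gradedProj (ℳ := M.deg) fun n => ?_
  rw [map_zero]
  have hx : x ∈ (grMaxIdeal 𝒜) ^ (n + 1 - b).toNat • (⊤ : Submodule R M.carrier) :=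
    (hpow _).symm ▸ trivial
  exact M.pow_smul_top_le hb _ hx n (by omega)

section FiniteDim

variable [IsNoetherianRing R] (hR0 : Function.Bijective (algebraMap k (𝒜 0)))

include hR0

theorem finite_quot_ge (M : GrMod 𝒜) (j : ℤ) : Module.Finite k (M.carrier ⧸ M.ge j) := by
  obtain ⟨b, hb⟩ := M.exists_ge_eq_top
  refine finite_of_pow_smul_top_eq_bot 𝒜 hR0 (j - b).toNat ?_
  rw [← map_mkQ_smul_top, ← le_bot_iff, Submodule.map_le_iff_le_comap, Submodule.comap_bot,
    Submodule.ker_mkQ]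
  exact fun x hx n hn => M.pow_smul_top_le hb _ hx n (by omega)

theorem finite_deg (M : GrMod 𝒜) (n : ℤ) : Module.Finite k (M.deg n) := by
  have := M.finite_quot_ge hR0 (n + 1)
  let f : M.deg n →ₗ[k] M.carrier ⧸ M.ge (n + 1) :=
    (M.ge (n + 1)).mkQ.restrictScalars k ∘ₗ (M.deg n).subtype
  refine Module.Finite.of_injective f ((injective_iff_map_eq_zero f).2 ?_)
  rintro ⟨x, hx⟩ h
  have hge : x ∈ M.ge (n + 1) := (Submodule.Quotient.mk_eq_zero _).1 h
  exact Subtype.ext ((gradedProj_of_mem hx).symm.trans (hge n (by omega)))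

theorem finite_hom (M N : GrMod 𝒜) : Module.Finite k (hom M N) := by
  obtain ⟨s, hs, hd⟩ := M.exists_homogeneous_generators
  choose! d hd using hd
  have := N.finite_deg hR0
  let f : hom M N →ₗ[k] (∀ x : s, N.deg (d x)) :=
    LinearMap.pi fun x =>
      { toFun := fun g => ⟨g.1 x, g.2 _ _ (hd x x.2)⟩
        map_add' := fun _ _ => rfl
        map_smul' := fun _ _ => rfl }
  refine Module.Finite.of_injective f fun g g' h => ?_
  refine Subtype.ext (LinearMap.ext_on hs fun x hx => ?_)
  exact congrArg Subtype.val (congrFun h ⟨x, hx⟩)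

end FiniteDim

end GrMod

end GradedModules

section RegularLocal

open IsLocalRing
open scoped Pointwise

theorem exists_span_insert_erase_eq {A M : Type*} [CommRing A] [IsLocalRing A] [AddCommGroup M]
    [Module A M] [DecidableEq M] {s : Finset M} {x : M} (hx : x ∈ Submodule.span A (s : Set M))
    (hx' : x ∉ maximalIdeal A • Submodule.span A (s : Set M)) :
    ∃ g ∈ s, Submodule.span A (insert x (s.erase g : Set M)) = Submodule.span A s := by
  obtain ⟨f, -, hfx⟩ := Submodule.mem_span_finset.1 hx
  obtain ⟨g, hg, hfg⟩ : ∃ g ∈ s, f g ∉ maximalIdeal A := by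
    by_contra! hcon
    exact hx' (hfx ▸ Submodule.sum_mem _ fun a ha =>
      Submodule.smul_mem_smul (hcon a ha) (Submodule.subset_span ha))
  refine ⟨g, hg, le_antisymm (Submodule.span_le.2 (Set.insert_subset hx ?_))
    (Submodule.span_le.2 fun a ha => ?_)⟩
  · exact fun a ha => Submodule.subset_span (Finset.mem_of_mem_erase ha)
  by_cases hag : a = g
  · have hunit : IsUnit (f g) := notMem_maximalIdeal.1 hfg
    rw [hag, SetLike.mem_coe, ← Submodule.smul_mem_iff_of_isUnit _ hunit,
      eq_sub_of_add_eq ((Finset.add_sum_erase s (fun a => f a • a) hg).trans hfx)]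
    exact Submodule.sub_mem _ (Submodule.subset_span (Set.mem_insert _ _))
      (Submodule.sum_mem _ fun b hb =>
        Submodule.smul_mem _ _ (Submodule.subset_span (Set.mem_insert_of_mem _ hb)))
  · exact Submodule.subset_span (Set.mem_insert_of_mem _ (Finset.mem_erase.2 ⟨hag, ha⟩))

theorem spanFinrank_maximalIdeal_quotient_add_one_le {A : Type*} [CommRing A] [IsLocalRing A]
    [IsNoetherianRing A] {x : A} (hx : x ∈ maximalIdeal A) (hx2 : x ∉ maximalIdeal A ^ 2)
    [IsLocalRing (A ⧸ Ideal.span {x})] :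
    (maximalIdeal (A ⧸ Ideal.span {x})).spanFinrank + 1 ≤ (maximalIdeal A).spanFinrank := by
  classical
  obtain ⟨s, hs, hspan⟩ :=
    Submodule.FG.exists_span_finset_card_eq_spanFinrank (maximalIdeal A).fg_of_isNoetherianRing
  obtain ⟨g, hg, hgs⟩ := exists_span_insert_erase_eq (A := A) (s := s) (x := x) (hspan ▸ hx)
    (by rwa [hspan, smul_eq_mul, ← pow_two])
  have hmax : maximalIdeal (A ⧸ Ideal.span {x}) =
      Ideal.span (Ideal.Quotient.mk (Ideal.span {x}) '' (s.erase g : Set A)) := by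
    rw [← map_maximalIdeal_of_surjective _ (Ideal.Quotient.mk_surjective (I := Ideal.span {x})),
      ← hspan, ← hgs, ← Ideal.span, Ideal.map_span, Set.image_insert_eq,
      Ideal.Quotient.eq_zero_iff_mem.2 (Ideal.mem_span_singleton_self x), Ideal.span_insert_zero]
  have hle : (maximalIdeal (A ⧸ Ideal.span {x})).spanFinrank ≤ (s.erase g).card := by
    rw [hmax, ← Set.ncard_coe_finset]
    exact (Submodule.spanFinrank_span_le_ncard_of_finite ((Finset.finite_toSet _).image _)).trans
      (Set.ncard_image_le (Finset.finite_toSet _))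
  have := Finset.card_erase_add_one hg
  lia

theorem isRegularLocalRing_quotient_span_singleton {A : Type*} [CommRing A] [IsRegularLocalRing A]
    {t : ℕ} (hA : ringKrullDim A = (t + 1 : ℕ)) {x : A} (hx : x ∈ maximalIdeal A)
    (hx2 : x ∉ maximalIdeal A ^ 2) :
    IsRegularLocalRing (A ⧸ Ideal.span {x}) ∧ ringKrullDim (A ⧸ Ideal.span {x}) = t := by
  have hne : Ideal.span {x} ≠ ⊤ := fun h =>
    (mem_maximalIdeal x).1 hx (Ideal.span_singleton_eq_top.1 h)
  have : Nontrivial (A ⧸ Ideal.span {x}) := Ideal.Quotient.nontrivial_iff.2 hne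
  have : IsLocalRing (A ⧸ Ideal.span {x}) :=
    IsLocalRing.of_surjective' (Ideal.Quotient.mk _) Ideal.Quotient.mk_surjective
  have hrank : (maximalIdeal A).spanFinrank = t + 1 := by
    exact_mod_cast (IsRegularLocalRing.spanFinrank_maximalIdeal (R := A)).trans hA
  have hle : (maximalIdeal (A ⧸ Ideal.span {x})).spanFinrank ≤ t := by
    have := spanFinrank_maximalIdeal_quotient_add_one_le hx hx2
    lia
  have hdim : (t : WithBot ℕ∞) ≤ ringKrullDim (A ⧸ Ideal.span {x}) := by
    have h := ringKrullDim_le_ringKrullDim_quotSMulTop_succ hx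
    rw [← Submodule.ideal_span_singleton_smul, smul_eq_mul, Ideal.mul_top, hA, Nat.cast_succ] at h
    exact ENat.WithBot.add_le_add_one_right_iff.1 h
  have hreg := IsRegularLocalRing.of_spanFinrank_maximalIdeal_le (A ⧸ Ideal.span {x})
    (le_trans (by exact_mod_cast hle) hdim)
  refine ⟨hreg, le_antisymm ?_ hdim⟩
  rw [← hreg.spanFinrank_maximalIdeal]
  exact_mod_cast hle

theorem isField_of_ringKrullDim_eq_zero {A : Type*} [CommRing A] [IsRegularLocalRing A]
    (hA : ringKrullDim A = (0 : ℕ)) : IsField A := by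
  rw [isField_iff_maximalIdeal_eq,
    ← Submodule.spanFinrank_eq_zero_iff_eq_bot (IsNoetherian.noetherian _)]
  exact_mod_cast (IsRegularLocalRing.spanFinrank_maximalIdeal (R := A)).trans hA

theorem exists_mem_maximalIdeal_notMem_sq {A : Type*} [CommRing A] [IsRegularLocalRing A]
    {t : ℕ} (hA : ringKrullDim A = (t + 1 : ℕ)) :
    ∃ x ∈ maximalIdeal A, x ∉ maximalIdeal A ^ 2 ∧ ∀ P ∈ minimalPrimes A, x ∉ P := by
  by_contra! hcon
  have hfin : (minimalPrimes A).Finite := Ideal.finite_minimalPrimes_of_isNoetherianRing A ⊥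
  have hsub : (maximalIdeal A : Set A) ⊆
      ⋃ i ∈ insert (maximalIdeal A ^ 2) (minimalPrimes A), ((id i : Ideal A) : Set A) := by
    intro x hx
    by_cases h2 : x ∈ maximalIdeal A ^ 2
    · exact Set.mem_biUnion (Set.mem_insert _ _) h2
    · obtain ⟨P, hP, hxP⟩ := hcon x hx h2
      exact Set.mem_biUnion (Set.mem_insert_of_mem _ hP) hxP
  obtain ⟨I, rfl | hI, hle⟩ := (Ideal.subset_union_prime_finite (hfin.insert _) (f := id)
    (maximalIdeal A ^ 2) (maximalIdeal A ^ 2)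
    (fun i hi hne _ => (hi.resolve_left hne).1.1)).1 hsub
  · have hbot : maximalIdeal A = ⊥ :=
      Submodule.eq_bot_of_le_smul_of_le_jacobson_bot (maximalIdeal A) _
        (IsNoetherian.noetherian _) (by simpa [pow_two] using hle) (maximalIdeal_le_jacobson _)
    have h := IsRegularLocalRing.spanFinrank_maximalIdeal (R := A)
    rw [hA, hbot, Submodule.spanFinrank_bot] at h
    exact absurd (by exact_mod_cast h : 0 = t + 1) (by lia)
  · have := hI.1.1
    obtain rfl : I = maximalIdeal A := le_antisymm (le_maximalIdeal this.ne_top) hle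
    have h := maximalIdeal_height_eq_ringKrullDim (R := A)
    rw [hA, Ideal.height_eq_zero_iff.2 hI] at h
    exact absurd (by exact_mod_cast h : 0 = t + 1) (by lia)

theorem isDomain_of_isRegularLocalRing (t : ℕ) :
    ∀ (A : Type u) [CommRing A] [IsRegularLocalRing A], ringKrullDim A = t → IsDomain A := by
  induction t with
  | zero =>
    intro A _ _ hA
    exact (isField_of_ringKrullDim_eq_zero hA).isDomain
  | succ t ih =>
    intro A _ _ hA
    obtain ⟨x, hx, hx2, hxP⟩ := exists_mem_maximalIdeal_notMem_sq hA
    obtain ⟨_, hdim⟩ := isRegularLocalRing_quotient_span_singleton hA hx hx2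
    have hprime : (Ideal.span {x}).IsPrime := (Ideal.Quotient.isDomain_iff_prime _).1 (ih _ hdim)
    -- A minimal prime `P` below the prime `(x)` does not contain `x`, so `P = x P` and `P = 0`.
    obtain ⟨P, hP, hPx⟩ := Ideal.exists_minimalPrimes_le (bot_le : ⊥ ≤ Ideal.span {x})
    have hPprime := hP.1.1
    have hbot : P = ⊥ := by
      refine Submodule.eq_bot_of_le_smul_of_le_jacobson_bot (maximalIdeal A) _
        (IsNoetherian.noetherian _) (fun y hy => ?_) (maximalIdeal_le_jacobson _)
      obtain ⟨a, rfl⟩ := Ideal.mem_span_singleton'.1 (hPx hy)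
      rw [mul_comm]
      exact Submodule.smul_mem_smul hx ((hPprime.mem_or_mem hy).resolve_right (hxP P hP))
    rw [hbot] at hPprime
    exact IsDomain.of_bot_isPrime A

/-- The projective dimension of `L` is at most `n`, in the form that suits finitely generated
modules over a local ring: every `n`-th syzygy of `L` in a resolution by finite free modules is
free. -/
def HasFreeSyzygy (A : Type u) [CommRing A] :
    ℕ → ∀ (L : Type u) [AddCommGroup L] [Module A L], Prop
  | 0, L, _, _ => Module.Free A L
  | n + 1, L, _, _ => ∀ (K F : Type u) [AddCommGroup K] [AddCommGroup F] [Module A K] [Module A F]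
      (i : K →ₗ[A] F) (g : F →ₗ[A] L), Module.Free A F → Module.Finite A F →
      Function.Injective i → Function.Exact i g → Function.Surjective g → HasFreeSyzygy A n K

theorem injective_quotSMulTop_map {A K F L : Type*} [CommRing A] [AddCommGroup K] [AddCommGroup F]
    [AddCommGroup L] [Module A K] [Module A F] [Module A L] {i : K →ₗ[A] F} {g : F →ₗ[A] L}
    (hi : Function.Injective i) (hig : Function.Exact i g) {z : A} (hz : IsSMulRegular L z) :
    Function.Injective (QuotSMulTop.map z i) := by
  rw [injective_iff_map_eq_zero]
  intro x hx
  obtain ⟨x, rfl⟩ := Submodule.mkQ_surjective _ x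
  have hix : i x ∈ z • (⊤ : Submodule A F) := (Submodule.Quotient.mk_eq_zero _).1 hx
  obtain ⟨f, -, hf⟩ := (Submodule.mem_smul_pointwise_iff_exists _ _ _).1 hix
  have hgf : g f = 0 := hz.right_eq_zero_of_smul (by
    rw [← map_smul, hf, hig.apply_apply_eq_zero])
  obtain ⟨x', rfl⟩ := (hig f).1 hgf
  rw [← map_smul] at hf
  refine (Submodule.Quotient.mk_eq_zero _).2 ?_
  rw [← hi hf]
  exact Submodule.smul_mem_pointwise_smul _ _ _ trivial

theorem hasFreeSyzygy_of_quotSMulTop {A : Type u} [CommRing A] [IsDomain A] [IsLocalRing A]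
    [IsNoetherianRing A] {z : A} (hz : z ∈ maximalIdeal A) (hz0 : z ≠ 0) (n : ℕ) :
    ∀ (L : Type u) [AddCommGroup L] [Module A L] [Module.Finite A L], IsSMulRegular L z →
      HasFreeSyzygy (A ⧸ Ideal.span {z}) n (QuotSMulTop z L) → HasFreeSyzygy A n L := by
  induction n with
  | zero =>
    intro L _ _ _ hreg h
    have : Module.FinitePresentation A L := Module.finitePresentation_of_finite A L
    exact (Module.free_quotSMulTop_iff_free A L (maximalIdeal_le_jacobson _ hz) hreg).1 h
  | succ n ih =>
    intro L _ _ _ hreg h K F _ _ _ _ i g hF hFfin hi hig hg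
    have : Module.Finite A K := Module.Finite.of_injective i hi
    have hsurj : Function.Surjective (algebraMap A (A ⧸ Ideal.span {z})) :=
      Ideal.Quotient.mk_surjective
    exact ih K (IsSMulRegular.of_injective i hi (smul_right_injective F hz0))
      (h _ _ ((QuotSMulTop.map z i).extendScalarsOfSurjective hsurj)
        ((QuotSMulTop.map z g).extendScalarsOfSurjective hsurj) inferInstance
        (Module.Finite.of_restrictScalars_finite A _ _) (injective_quotSMulTop_map hi hig hreg)
        (QuotSMulTop.map_exact z hig hg) (QuotSMulTop.map_surjective z hg))

theorem hasFreeSyzygy_of_isRegularLocalRing (t : ℕ) :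
    ∀ (A : Type u) [CommRing A] [IsRegularLocalRing A], ringKrullDim A = t →
      ∀ (L : Type u) [AddCommGroup L] [Module A L] [Module.Finite A L], HasFreeSyzygy A t L := by
  induction t with
  | zero =>
    intro A _ _ hA L _ _ _
    let := (isField_of_ringKrullDim_eq_zero hA).toField
    exact Module.Free.of_divisionRing A L
  | succ t ih =>
    intro A _ _ hA L _ _ _ K F _ _ _ _ i _ hF hFfin hi _ _
    have := isDomain_of_isRegularLocalRing _ A hA
    obtain ⟨z, hz, hz2, -⟩ := exists_mem_maximalIdeal_notMem_sq hA
    have hz0 : z ≠ 0 := fun h => hz2 (h ▸ Submodule.zero_mem _)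
    obtain ⟨_, hdim⟩ := isRegularLocalRing_quotient_span_singleton hA hz hz2
    have : Module.Finite A K := Module.Finite.of_injective i hi
    have : Module.Finite (A ⧸ Ideal.span {z}) (QuotSMulTop z K) :=
      Module.Finite.of_restrictScalars_finite A _ _
    exact hasFreeSyzygy_of_quotSMulTop hz hz0 t K
      (IsSMulRegular.of_injective i hi (smul_right_injective F hz0)) (ih _ hdim _)

theorem mem_maximalIdeal_smul_top_of_smul_mem {A K : Type*} [CommRing A] [IsLocalRing A]
    [AddCommGroup K] [Module A K] [Module.Free A K] {J : Ideal A} {a : A} (ha : a ∉ J) {x : K}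
    (hx : a • x ∈ J • (⊤ : Submodule A K)) : x ∈ maximalIdeal A • (⊤ : Submodule A K) := by
  let β := Module.Free.chooseBasis A K
  rw [← β.linearCombination_repr x, Finsupp.linearCombination_apply]
  refine Submodule.sum_mem _ fun j _ => Submodule.smul_mem_smul ?_ Submodule.mem_top
  have hcoord : a * β.repr x j ∈ J := by
    have h := Submodule.smul_top_le_comap_smul_top J (β.coord j) hx
    rwa [Submodule.mem_comap, map_smul, smul_eq_mul, smul_eq_mul, Ideal.mul_top] at h
  exact (mem_maximalIdeal _).2 fun hu => ha ((Ideal.mul_unit_mem_iff_mem J hu).1 hcoord)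

theorem free_of_exact_of_comap_maximalIdeal_le {A K F L : Type*} [CommRing A] [IsLocalRing A]
    [AddCommGroup K] [AddCommGroup F] [AddCommGroup L] [Module A K] [Module A F] [Module A L]
    [Module.Finite A K] [Module.Finite A F] [Module.Free A F] [Module.Free A K]
    {i : K →ₗ[A] F} {g : F →ₗ[A] L} (hig : Function.Exact i g) (hg : Function.Surjective g)
    (h : (maximalIdeal A • (⊤ : Submodule A F)).comap i ≤ maximalIdeal A • ⊤) :
    Module.Free A L := by
  refine Module.free_of_lTensor_residueField_injective i g hg hig
    ((injective_iff_map_eq_zero _).2 fun y hy => ?_)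
  obtain ⟨x, rfl⟩ := TensorProduct.mk_surjective A K (ResidueField A) Ideal.Quotient.mk_surjective y
  have hx : i x ∈ maximalIdeal A • (⊤ : Submodule A F) := by
    have h0 := congrArg (TensorProduct.quotTensorEquivQuotSMul F (maximalIdeal A)) hy
    exact (Submodule.Quotient.mk_eq_zero _).1
      ((TensorProduct.quotTensorEquivQuotSMul_mk_one_tmul (maximalIdeal A) (i x)).symm.trans
        (h0.trans (map_zero _)))
  exact (TensorProduct.quotTensorEquivQuotSMul K (maximalIdeal A)).injective
    ((TensorProduct.quotTensorEquivQuotSMul_mk_one_tmul (maximalIdeal A) x).trans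
      (((Submodule.Quotient.mk_eq_zero _).2 (h hx)).trans (map_zero _).symm))

theorem exists_notMem_forall_mul_mem {A : Type*} [CommRing A] [IsLocalRing A] [IsNoetherianRing A]
    {J : Ideal A} (hJ : J.radical = maximalIdeal A) :
    ∃ a ∉ J, ∀ b ∈ maximalIdeal A, b * a ∈ J := by
  classical
  have hpow : ∃ n, maximalIdeal A ^ n ≤ J :=
    Ideal.exists_pow_le_of_le_radical_of_fg hJ.ge (IsNoetherian.noetherian _)
  have hJne : J ≠ ⊤ := fun h =>
    (maximalIdeal.isMaximal A).ne_top (by rw [← hJ, h, Ideal.radical_top])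
  obtain ⟨n, hn⟩ : ∃ n, Nat.find hpow = n + 1 := by
    refine Nat.exists_eq_succ_of_ne_zero fun h => hJne ?_
    have := Nat.find_spec hpow
    rwa [h, pow_zero, Ideal.one_eq_top, top_le_iff] at this
  obtain ⟨a, ha, haJ⟩ := SetLike.not_le_iff_exists.1 (Nat.find_min hpow (m := n) (by lia))
  refine ⟨a, haJ, fun b hb => Nat.find_spec hpow ?_⟩
  rw [hn, pow_succ']
  exact Ideal.mul_mem_mul hb ha

-- The kernel `i` need only be tested against an element of the socle of `A / J`.
theorem free_of_exact_of_comap_smul_top_le {A K F L : Type*} [CommRing A] [IsLocalRing A]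
    [IsNoetherianRing A] [AddCommGroup K] [AddCommGroup F] [AddCommGroup L] [Module A K]
    [Module A F] [Module A L] [Module.Finite A K] [Module.Finite A F] [Module.Free A F]
    [Module.Free A K] {i : K →ₗ[A] F} {g : F →ₗ[A] L} (hig : Function.Exact i g)
    (hg : Function.Surjective g) {J : Ideal A} (hJ : J.radical = maximalIdeal A)
    (h : (J • (⊤ : Submodule A F)).comap i ≤ J • ⊤) : Module.Free A L := by
  obtain ⟨a, ha, haJ⟩ := exists_notMem_forall_mul_mem hJ
  refine free_of_exact_of_comap_maximalIdeal_le hig hg fun x hx =>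
    mem_maximalIdeal_smul_top_of_smul_mem ha (h ?_)
  rw [Submodule.mem_comap, map_smul]
  refine Submodule.smul_induction_on (Submodule.mem_comap.1 hx) (fun b hb f _ => ?_)
    (fun y z hy hz => ?_)
  · rw [smul_smul, mul_comm]
    exact Submodule.smul_mem_smul (haJ b hb) Submodule.mem_top
  · rw [smul_add]
    exact Submodule.add_mem _ hy hz

end RegularLocal

section Descent

theorem map_smul_top_localizedModule {R : Type*} [CommRing R] (T : Submonoid R) (J : Ideal R)
    (V : Type*) [AddCommGroup V] [Module R V] :
    J.map (algebraMap R (Localization T)) • (⊤ : Submodule (Localization T) (LocalizedModule T V)) =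
      (J • (⊤ : Submodule R V)).localized' (Localization T) T
        (LocalizedModule.mkLinearMap T V) := by
  rw [Submodule.localized'_smul, Ideal.localized'_eq_map, Submodule.localized'_top]

theorem comap_map_smul_top_le {R : Type*} [CommRing R] (T : Submonoid R) {J : Ideal R}
    {K F : Type*} [AddCommGroup K] [AddCommGroup F] [Module R K] [Module R F] {i : K →ₗ[R] F}
    (h : (J • (⊤ : Submodule R F)).comap i ≤ J • ⊤) :
    (J.map (algebraMap R (Localization T)) •
      (⊤ : Submodule (Localization T) (LocalizedModule T F))).comap (LocalizedModule.map T i) ≤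
    J.map (algebraMap R (Localization T)) • ⊤ := by
  rw [map_smul_top_localizedModule, map_smul_top_localizedModule]
  intro y hy
  induction y using LocalizedModule.induction_on with
  | h x s =>
    obtain ⟨f, hf, t, hft⟩ := (Submodule.mem_localized' _ _ _ _ _).1 (Submodule.mem_comap.1 hy)
    rw [LocalizedModule.map_mk, ← IsLocalizedModule.mk_eq_mk', LocalizedModule.mk_eq] at hft
    obtain ⟨w, hw⟩ := hft
    refine (Submodule.mem_localized' _ _ _ _ _).2 ⟨(w * t) • x, h ?_, w * t * s, ?_⟩
    · have hi : i ((w * t) • x) = w • s • f := by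
        rw [hw, mul_smul]
        exact (i.map_smul (w : R) _).trans (congrArg _ (i.map_smul (t : R) x))
      rw [Submodule.mem_comap, hi]
      exact Submodule.smul_mem _ (w : R) (Submodule.smul_mem _ (s : R) hf)
    · rw [← IsLocalizedModule.mk_eq_mk', LocalizedModule.mk_cancel_common_left]

variable {S R : Type u} [CommRing S] [CommRing R] [Algebra S R]

theorem comap_map_smul_top_le_of_leftInverse {K F : Type*} [AddCommGroup K] [AddCommGroup F]
    [Module R K] [Module R F] [Module S K] [Module S F] [IsScalarTower S R K] [IsScalarTower S R F]
    {i : K →ₗ[R] F} {ρ : F →ₗ[S] K} (hρ : Function.LeftInverse ρ i) (q : Ideal S) :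
    (q.map (algebraMap S R) • (⊤ : Submodule R F)).comap i ≤ q.map (algebraMap S R) • ⊤ := by
  intro x hx
  rw [Submodule.mem_comap, ← Submodule.restrictScalars_mem S,
    Submodule.restrictScalars_map_smul_eq] at hx
  rw [← Submodule.restrictScalars_mem S, Submodule.restrictScalars_map_smul_eq, ← hρ x]
  exact Submodule.smul_top_le_comap_smul_top q ρ hx

variable (R) in
theorem exists_ker_retraction {L : Type*} [AddCommGroup L] [Module R L] [Module S L]
    [IsScalarTower S R L] [Module.Projective S L] {F : Type*} [AddCommGroup F] [Module R F]
    [Module S F] [IsScalarTower S R F] {g : F →ₗ[R] L} (hg : Function.Surjective g) :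
    ∃ ρ : F →ₗ[S] LinearMap.ker g, Function.LeftInverse ρ (LinearMap.ker g).subtype := by
  obtain ⟨σ, hσ⟩ := Module.projective_lifting_property (g.restrictScalars S) LinearMap.id hg
  have hσ' (x : L) : g (σ x) = x := LinearMap.congr_fun hσ x
  refine ⟨LinearMap.codRestrict ((LinearMap.ker g).restrictScalars S)
    (LinearMap.id - σ ∘ₗ g.restrictScalars S) fun f => ?_, fun x => Subtype.ext ?_⟩
  · simp [hσ']
  · change (x : F) - σ (g x) = x
    rw [LinearMap.mem_ker.1 x.2, map_zero, sub_zero]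

variable [Module.Projective S R] [IsNoetherianRing R] (p : Ideal R) [p.IsPrime]

theorem free_localizedModule_of_hasFreeSyzygy
    (hp : p ∈ ((p.comap (algebraMap S R)).map (algebraMap S R)).minimalPrimes) (n : ℕ) :
    ∀ (L : Type u) [AddCommGroup L] [Module R L] [Module S L] [IsScalarTower S R L]
      [Module.Finite R L] [Module.Projective S L],
      HasFreeSyzygy (Localization.AtPrime p) n (LocalizedModule p.primeCompl L) →
      Module.Free (Localization.AtPrime p) (LocalizedModule p.primeCompl L) := by
  induction n with
  | zero => exact fun L _ _ _ _ _ _ h => h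
  | succ n ih =>
    intro L _ _ _ _ _ _ h
    obtain ⟨m, g, hg⟩ := Module.Finite.exists_fin' R L
    let i := (LinearMap.ker g).subtype
    obtain ⟨ρ, hρ⟩ := exists_ker_retraction (S := S) R hg
    have : Module.Projective S (Fin m → R) := Module.Projective.of_equiv'
      (DFinsupp.linearEquivFunOnFintype (R := S) (M := fun _ : Fin m => R))
    have : Module.Projective S (LinearMap.ker g) :=
      Module.Projective.of_split (i.restrictScalars S) ρ (LinearMap.ext hρ)
    have hF : Module.Free (Localization.AtPrime p) (LocalizedModule p.primeCompl (Fin m → R)) :=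
      Module.free_of_isLocalizedModule p.primeCompl
        (LocalizedModule.mkLinearMap p.primeCompl (Fin m → R))
    have hi' := LocalizedModule.map_injective p.primeCompl i (Submodule.injective_subtype _)
    have hg' := LocalizedModule.map_surjective p.primeCompl g hg
    have hig' : Function.Exact (LocalizedModule.map p.primeCompl i)
        (LocalizedModule.map p.primeCompl g) :=
      LocalizedModule.map_exact p.primeCompl i g (LinearMap.exact_subtype_ker_map g)
    have hK := ih (LinearMap.ker g) (h _ _ _ _ hF inferInstance hi' hig' hg')
    have hrad := IsLocalization.AtPrime.radical_map_of_mem_minimalPrimes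
      (Localization.AtPrime p) p _ hp
    rw [Localization.AtPrime.map_eq_maximalIdeal] at hrad
    have : IsNoetherianRing (Localization.AtPrime p) :=
      IsLocalization.isNoetherianRing p.primeCompl _ inferInstance
    exact free_of_exact_of_comap_smul_top_le hig' hg' hrad
      (comap_map_smul_top_le p.primeCompl (comap_map_smul_top_le_of_leftInverse hρ _))

theorem mem_minimalPrimes_map_comap {S R : Type*} [CommRing S] [CommRing R] [Algebra S R]
    [Algebra.IsIntegral S R] (p : Ideal R) [p.IsPrime] :
    p ∈ ((p.comap (algebraMap S R)).map (algebraMap S R)).minimalPrimes := by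
  refine ⟨⟨inferInstance, Ideal.map_comap_le⟩, fun q ⟨_, hle⟩ hqp => ?_⟩
  by_contra hpq
  exact (Ideal.IsIntegral.comap_lt_comap (R := S) (lt_of_le_not_ge hqp hpq)).not_ge
    (Ideal.le_comap_of_map_le hle)

theorem free_localizedModule_of_isRegularLocalRing [Algebra.IsIntegral S R]
    [IsRegularLocalRing (Localization.AtPrime p)]
    (L : Type u) [AddCommGroup L] [Module R L] [Module S L] [IsScalarTower S R L]
    [Module.Finite R L] [Module.Projective S L] :
    Module.Free (Localization.AtPrime p) (LocalizedModule p.primeCompl L) :=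
  free_localizedModule_of_hasFreeSyzygy (S := S) p (mem_minimalPrimes_map_comap p) _ L
    (hasFreeSyzygy_of_isRegularLocalRing _ _ IsRegularLocalRing.spanFinrank_maximalIdeal.symm _)

end Descent

section Factorization

theorem exists_notMem_comp_eq_smul_id {R L : Type*} [CommRing R] [IsNoetherianRing R]
    (p : Ideal R) [p.IsPrime] [AddCommGroup L] [Module R L] [Module.Finite R L]
    [Module.Free (Localization.AtPrime p) (LocalizedModule p.primeCompl L)] :
    ∃ s ∉ p, ∃ (m : ℕ) (j : L →ₗ[R] (Fin m → R)) (g : (Fin m → R) →ₗ[R] L),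
      g ∘ₗ j = s • LinearMap.id := by
  obtain ⟨m, g, hg⟩ := Module.Finite.exists_fin' R L
  have hfp : Module.FinitePresentation R L := Module.finitePresentation_of_finite R L
  obtain ⟨σ, hσ⟩ := Module.projective_lifting_property (LocalizedModule.map p.primeCompl g)
    LinearMap.id (LocalizedModule.map_surjective p.primeCompl g hg)
  obtain ⟨j, s, hj⟩ := Module.FinitePresentation.exists_lift_of_isLocalizedModule p.primeCompl
    (LocalizedModule.mkLinearMap p.primeCompl (Fin m → R))
    (σ.restrictScalars R ∘ₗ LocalizedModule.mkLinearMap p.primeCompl L)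
  have hloc : LocalizedModule.mkLinearMap p.primeCompl L ∘ₗ (g ∘ₗ j) =
      LocalizedModule.mkLinearMap p.primeCompl L ∘ₗ ((s : R) • LinearMap.id) := by
    refine LinearMap.ext fun x => ?_
    calc LocalizedModule.mk (g (j x)) 1
        = LocalizedModule.map p.primeCompl g (LocalizedModule.mk (j x) 1) :=
          (LocalizedModule.map_mk _ _ _ _).symm
      _ = LocalizedModule.map p.primeCompl g ((s : R) • σ (LocalizedModule.mk x 1)) :=
          congrArg _ (LinearMap.congr_fun hj x)
      _ = (s : R) • LocalizedModule.mk x 1 := by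
          rw [LinearMap.map_smul_of_tower]
          exact congrArg _ (LinearMap.congr_fun hσ _)
      _ = LocalizedModule.mk ((s : R) • x) 1 := LocalizedModule.smul'_mk _ _ _
  obtain ⟨t, ht⟩ :=
    Module.Finite.exists_smul_of_comp_eq_of_isLocalizedModule p.primeCompl _ _ _ hloc
  refine ⟨(t * s : p.primeCompl), (t * s).2, m, j, (t : R) • g, ?_⟩
  rw [LinearMap.smul_comp, Submonoid.coe_mul, mul_smul]
  exact ht

end Factorization
section Avoidance

variable {k : Type v} [Field k] {R : Type u} [CommRing R] [Algebra k R]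
  (𝒜 : ℕ → Submodule k R) [GradedAlgebra 𝒜]

theorem exists_pos_degree_notMem {P : Ideal R} (hP : ¬ grMaxIdeal 𝒜 ≤ P) :
    ∃ i, 0 < i ∧ ∃ a ∈ 𝒜 i, a ∉ P := by
  by_contra! h
  refine hP ?_
  rw [grMaxIdeal_eq_span, Ideal.span_le]
  rintro a ⟨i, hi, ha⟩
  exact h i hi a ha

theorem exists_pos_degree_notMem_forall_mem {P : Ideal R} [P.IsPrime] (hP : ¬ grMaxIdeal 𝒜 ≤ P)
    (t : Finset (Ideal R)) (ht : ∀ Q ∈ t, ∃ i, ∃ a ∈ 𝒜 i, a ∈ Q ∧ a ∉ P) :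
    ∃ i, 0 < i ∧ ∃ w ∈ 𝒜 i, w ∉ P ∧ ∀ Q ∈ t, w ∈ Q := by
  classical
  induction t using Finset.induction_on with
  | empty =>
    obtain ⟨i, hi, a, ha, haP⟩ := exists_pos_degree_notMem 𝒜 hP
    exact ⟨i, hi, a, ha, haP, by simp⟩
  | insert Q t _ ih =>
    obtain ⟨i, hi, w, hw, hwP, hwt⟩ := ih fun Q' hQ' => ht Q' (Finset.mem_insert_of_mem hQ')
    obtain ⟨j, a, ha, haQ, haP⟩ := ht Q (Finset.mem_insert_self Q t)
    refine ⟨i + j, by lia, w * a, SetLike.mul_mem_graded hw ha,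
      Ideal.IsPrime.mul_notMem ‹_› hwP haP, fun Q' hQ' => ?_⟩
    obtain rfl | hQ' := Finset.mem_insert.1 hQ'
    · exact Ideal.mul_mem_left _ _ haQ
    · exact Ideal.mul_mem_right _ _ (hwt Q' hQ')

theorem exists_pos_degree_notMem_forall_notMem {P : Ideal R} [P.IsPrime] {t : Finset (Ideal R)}
    (ht : ∀ Q ∈ t, Q.IsPrime) {i j : ℕ} (hi : 0 < i) (hj : 0 < j) {u w : R} (hu : u ∈ 𝒜 i)
    (hw : w ∈ 𝒜 j) (huP : u ∈ P) (hut : ∀ Q ∈ t, u ∉ Q) (hwP : w ∉ P) (hwt : ∀ Q ∈ t, w ∈ Q) :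
    ∃ l, 0 < l ∧ ∃ a ∈ 𝒜 l, a ∉ P ∧ ∀ Q ∈ t, a ∉ Q := by
  have hu' : u ^ j ∈ 𝒜 (j * i) := SetLike.pow_mem_graded j hu
  have hw' : w ^ i ∈ 𝒜 (j * i) := mul_comm i j ▸ SetLike.pow_mem_graded i hw
  refine ⟨j * i, Nat.mul_pos hj hi, u ^ j + w ^ i, Submodule.add_mem _ hu' hw', fun h => ?_,
    fun Q hQ h => ?_⟩
  · exact hwP (Ideal.IsPrime.mem_of_pow_mem ‹_› _
      ((Ideal.add_mem_iff_right P (P.pow_mem_of_mem huP j hj)).1 h))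
  · exact hut Q hQ ((ht Q hQ).mem_of_pow_mem _
      ((Ideal.add_mem_iff_left Q (Q.pow_mem_of_mem (hwt Q hQ) i hi)).1 h))

theorem exists_pos_degree_forall_notMem (s : Finset (Ideal R)) (hs : ∀ P ∈ s, P.IsPrime)
    (hm : ∀ P ∈ s, ¬ grMaxIdeal 𝒜 ≤ P) : ∃ i, 0 < i ∧ ∃ a ∈ 𝒜 i, ∀ P ∈ s, a ∉ P := by
  classical
  induction s using Finset.strongInduction with
  | H s ih =>
    obtain rfl | ⟨P, hP⟩ := s.eq_empty_or_nonempty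
    · exact ⟨1, one_pos, 0, Submodule.zero_mem _, by simp⟩
    have := hs P hP
    have ih' := fun Q hQ => ih (s.erase Q) (Finset.erase_ssubset hQ)
      (fun Q' hQ' => hs Q' (Finset.mem_of_mem_erase hQ'))
      (fun Q' hQ' => hm Q' (Finset.mem_of_mem_erase hQ'))
    rw [← Finset.insert_erase hP]
    simp only [Finset.forall_mem_insert]
    by_cases hcomp : ∀ Q ∈ s.erase P, ∃ i, ∃ a ∈ 𝒜 i, a ∈ Q ∧ a ∉ P
    · obtain ⟨i, hi, u, hu, hut⟩ := ih' P hP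
      by_cases huP : u ∈ P
      · obtain ⟨j, hj, w, hw, hwP, hwt⟩ :=
          exists_pos_degree_notMem_forall_mem 𝒜 (hm P hP) (s.erase P) hcomp
        exact exists_pos_degree_notMem_forall_notMem 𝒜
          (fun Q hQ => hs Q (Finset.mem_of_mem_erase hQ)) hi hj hu hw huP hut hwP hwt
      · exact ⟨i, hi, u, hu, huP, hut⟩
    · -- The homogeneous elements of `Q` lie in `P`, so that `Q` need not be avoided.
      push Not at hcomp
      obtain ⟨Q, hQ, hQP⟩ := hcomp
      obtain ⟨i, hi, a, ha, has⟩ := ih' Q (Finset.mem_of_mem_erase hQ)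
      have haP := has P (Finset.mem_erase.2 ⟨(Finset.ne_of_mem_erase hQ).symm, hP⟩)
      refine ⟨i, hi, a, ha, haP, fun Q' hQ' haQ' => ?_⟩
      obtain rfl | hne := eq_or_ne Q' Q
      · exact haP (hQP i a ha haQ')
      · exact has Q' (Finset.mem_erase.2 ⟨hne, Finset.mem_of_mem_erase hQ'⟩) haQ'

end Avoidance

section Depth

open CategoryTheory CategoryTheory.Abelian RingTheory.Sequence
open scoped Pointwise

variable {k : Type v} [Field k] {R : Type u} [CommRing R] [Algebra k R]
  {𝒜 : ℕ → Submodule k R} [GradedAlgebra 𝒜]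

variable (𝒜) in
/-- The depth of `M` at `𝔪` is at least `n`, in terms of the vanishing of `Ext^i(R/𝔪, M)`. -/
def ExtVanish (n : ℕ) (M : Type u) [AddCommGroup M] [Module R M] : Prop :=
  ∀ i < n, Subsingleton (Ext (ModuleCat.of R (R ⧸ grMaxIdeal 𝒜)) (ModuleCat.of R M) i)

section

variable {M₁ M₂ M₃ : Type u} [AddCommGroup M₁] [AddCommGroup M₂] [AddCommGroup M₃] [Module R M₁]
  [Module R M₂] [Module R M₃]

theorem subsingleton_ext_of_exact {f : M₁ →ₗ[R] M₂} {g : M₂ →ₗ[R] M₃}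
    (hf : Function.Injective f) (hfg : Function.Exact f g) (hg : Function.Surjective g)
    {T : ModuleCat.{u} R} {i : ℕ} (h₁ : Subsingleton (Ext T (ModuleCat.of R M₁) i))
    (h₃ : Subsingleton (Ext T (ModuleCat.of R M₃) i)) :
    Subsingleton (Ext T (ModuleCat.of R M₂) i) := by
  have hS : (ModuleCat.shortComplexOfCompEqZero f g hfg.linearMap_comp_eq_zero).ShortExact :=
    ModuleCat.shortComplex_shortExact _ hfg hf hg
  refine subsingleton_of_forall_eq 0 fun x => ?_
  obtain ⟨y, rfl⟩ := Ext.covariant_sequence_exact₂ T hS x (h₃.elim _ _)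
  rw [h₁.elim y 0, Ext.zero_comp]

theorem subsingleton_ext_of_leftInverse {f : M₁ →ₗ[R] M₂} {g : M₂ →ₗ[R] M₁}
    (hgf : Function.LeftInverse g f) {T : ModuleCat.{u} R} {i : ℕ}
    (h : Subsingleton (Ext T (ModuleCat.of R M₂) i)) :
    Subsingleton (Ext T (ModuleCat.of R M₁) i) := by
  have hid : ModuleCat.ofHom f ≫ ModuleCat.ofHom g = 𝟙 (ModuleCat.of R M₁) :=
    ModuleCat.hom_ext (LinearMap.ext hgf)
  refine subsingleton_of_forall_eq 0 fun x => ?_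
  calc x = (x.comp (Ext.mk₀ (ModuleCat.ofHom f)) (add_zero i)).comp
        (Ext.mk₀ (ModuleCat.ofHom g)) (add_zero i) := by
          rw [Ext.comp_assoc_of_third_deg_zero, Ext.mk₀_comp_mk₀, hid, Ext.comp_mk₀_id]
    _ = 0 := by rw [h.elim (x.comp _ _) 0, Ext.zero_comp]

theorem isGradedCM_of_exact {f : M₁ →ₗ[R] M₂} {g : M₂ →ₗ[R] M₃}
    (hf : Function.Injective f) (hfg : Function.Exact f g) (hg : Function.Surjective g)
    (h₁ : IsGradedCM 𝒜 M₁) (h₃ : IsGradedCM 𝒜 M₃) : IsGradedCM 𝒜 M₂ :=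
  fun i hi => subsingleton_ext_of_exact hf hfg hg (h₁ i hi) (h₃ i hi)

theorem isGradedCM_of_leftInverse {f : M₁ →ₗ[R] M₂} {g : M₂ →ₗ[R] M₁}
    (hgf : Function.LeftInverse g f) (h : IsGradedCM 𝒜 M₂) : IsGradedCM 𝒜 M₁ :=
  fun i hi => subsingleton_ext_of_leftInverse hgf (h i hi)

theorem isGradedCM_prod (h₁ : IsGradedCM 𝒜 M₁) (h₂ : IsGradedCM 𝒜 M₂) :
    IsGradedCM 𝒜 (M₁ × M₂) :=
  isGradedCM_of_exact (f := LinearMap.inl R M₁ M₂) (g := LinearMap.snd R M₁ M₂)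
    LinearMap.inl_injective Function.Exact.inl_snd LinearMap.snd_surjective h₁ h₂

theorem extVanish_quotSMulTop {n : ℕ} (h₁ : ExtVanish 𝒜 (n + 1) M₁) {a : R}
    (ha : IsSMulRegular M₁ a) : ExtVanish 𝒜 n (QuotSMulTop a M₁) := by
  intro i hi
  have zero_i := AddCommGrpCat.isZero_of_iff_subsingleton.mpr (h₁ i (by lia))
  have zero_succ := AddCommGrpCat.isZero_of_iff_subsingleton.mpr (h₁ (i + 1) (by lia))
  have ha' : IsSMulRegular (ModuleCat.of R M₁) a := ha
  exact AddCommGrpCat.subsingleton_of_isZero <| ShortComplex.Exact.isZero_of_both_zeros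
    ((Ext.covariant_sequence_exact₃' _ ha'.smulShortComplex_shortExact) i (i + 1) rfl)
    (zero_i.eq_zero_of_src _) (zero_succ.eq_zero_of_tgt _)

end

theorem isWeaklyRegular_of_leftInverse {A : Type*} [CommRing A] (rs : List A) {M N : Type*}
    [AddCommGroup M] [AddCommGroup N] [Module A M] [Module A N] {f : M →ₗ[A] N} {g : N →ₗ[A] M}
    (hgf : Function.LeftInverse g f) (h : IsWeaklyRegular N rs) : IsWeaklyRegular M rs := by
  induction rs generalizing M N with
  | nil => exact IsWeaklyRegular.nil A _
  | cons r rs ih =>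
    rw [isWeaklyRegular_cons_iff] at h ⊢
    refine ⟨h.1.of_injective f hgf.injective,
      ih (f := QuotSMulTop.map r f) (g := QuotSMulTop.map r g) (fun x => ?_) h.2⟩
    obtain ⟨x, rfl⟩ := Submodule.mkQ_surjective _ x
    exact congrArg (Submodule.mkQ _) (hgf x)

omit [GradedAlgebra 𝒜] in
theorem GrMod.isHomogeneous_smul_top (M : GrMod 𝒜) {i : ℕ} {a : R} (ha : a ∈ 𝒜 i) :
    (a • (⊤ : Submodule R M.carrier)).IsHomogeneous M.deg := by
  rintro n _ ⟨y, -, rfl⟩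
  have h : M.proj n (a • y) ∈ a • (⊤ : Submodule R M.carrier) :=
    M.proj_smul ha n y ▸ Submodule.smul_mem_pointwise_smul _ _ _ trivial
  exact h

section Noetherian

variable [IsNoetherianRing R]

theorem exists_mem_grMaxIdeal_isSMulRegular {M : Type u} [AddCommGroup M] [Module R M]
    [Module.Finite R M] (hM : ExtVanish 𝒜 1 M) : ∃ a ∈ grMaxIdeal 𝒜, IsSMulRegular M a := by
  have hHom : Subsingleton (ModuleCat.of R (R ⧸ grMaxIdeal 𝒜) ⟶ ModuleCat.of R M) :=
    Ext.addEquiv₀.subsingleton_congr.mp (hM 0 one_pos)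
  have := ModuleCat.homAddEquiv.subsingleton_congr.mp hHom
  simpa only [Ideal.annihilator_quotient] using
    (IsSMulRegular.subsingleton_linearMap_iff (N := R ⧸ grMaxIdeal 𝒜)).1 this

theorem exists_homogeneous_isSMulRegular {M : Type u} [AddCommGroup M] [Module R M]
    [Module.Finite R M] (hM : ExtVanish 𝒜 1 M) :
    ∃ i, 0 < i ∧ ∃ a ∈ 𝒜 i, IsSMulRegular M a := by
  obtain ⟨r, hr, hreg⟩ := exists_mem_grMaxIdeal_isSMulRegular hM
  have hass (a : R) : (∀ P ∈ associatedPrimes R M, a ∉ P) ↔ IsSMulRegular M a := by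
    rw [← not_iff_not, ← Set.mem_ofPred (p := IsSMulRegular M), ← Set.mem_compl_iff,
      ← biUnion_associatedPrimes_eq_compl_regular R M]
    simp
  have hfin := associatedPrimes.finite R M
  obtain ⟨i, hi, a, ha, haP⟩ := exists_pos_degree_forall_notMem 𝒜 hfin.toFinset
    (fun P hP => (hfin.mem_toFinset.1 hP).isPrime)
    (fun P hP hle => (hass r).2 hreg P (hfin.mem_toFinset.1 hP) (hle hr))
  exact ⟨i, hi, a, ha, (hass a).1 fun P hP => haP P (hfin.mem_toFinset.2 hP)⟩

theorem exists_homogeneous_isWeaklyRegular (n : ℕ) (M : GrMod 𝒜) (hM : ExtVanish 𝒜 n M.carrier) :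
    ∃ rs : List R, rs.length = n ∧ (∀ r ∈ rs, ∃ i, 0 < i ∧ r ∈ 𝒜 i) ∧
      IsWeaklyRegular M.carrier rs := by
  induction n generalizing M with
  | zero => exact ⟨[], rfl, by simp, IsWeaklyRegular.nil R _⟩
  | succ n ih =>
    obtain ⟨i, hi, a, ha, hreg⟩ :=
      exists_homogeneous_isSMulRegular (M := M.carrier) fun j hj => hM j (by lia)
    obtain ⟨rs, hlen, hrs, hw⟩ :=
      ih (M.ofQuot _ (M.isHomogeneous_smul_top ha)) (extVanish_quotSMulTop hM hreg)
    exact ⟨a :: rs, by rw [List.length_cons, hlen],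
      List.forall_mem_cons.2 ⟨⟨i, hi, ha⟩, hrs⟩, (isWeaklyRegular_cons_iff _ _ _).2 ⟨hreg, hw⟩⟩

theorem extVanish_of_isWeaklyRegular (M : GrMod 𝒜) {rs : List R} (hrs : ∀ r ∈ rs, r ∈ grMaxIdeal 𝒜)
    (h : IsWeaklyRegular M.carrier rs) : ExtVanish 𝒜 rs.length M.carrier := by
  obtain htop | htop := eq_or_ne (grMaxIdeal 𝒜 • (⊤ : Submodule R M.carrier)) ⊤
  · have := M.subsingleton_of_smul_top_eq_top htop
    refine fun i _ => subsingleton_of_forall_eq 0 fun x => ?_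
    have hid : 𝟙 (ModuleCat.of R M.carrier) = 0 :=
      ModuleCat.hom_ext (LinearMap.ext fun _ => Subsingleton.elim _ _)
    rw [← Ext.comp_mk₀_id x, hid, Ext.mk₀_zero, Ext.comp_zero]
  · refine ModuleCat.subsingleton_ext_of_exists_isRegular (grMaxIdeal 𝒜)
      (ModuleCat.of R (R ⧸ grMaxIdeal 𝒜))
      (by rw [Module.support_eq_zeroLocus, Ideal.annihilator_quotient])
      (ModuleCat.of R M.carrier) htop.lt_top rs hrs ⟨h, fun hsmul => htop ?_⟩
    exact eq_top_iff.2 (hsmul.le.trans (Submodule.smul_mono_left (Ideal.span_le.2 hrs)))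

end Noetherian

end Depth

section Dimension

open RingTheory.Sequence

theorem supportDim_quotient_add_length_le {A M : Type*} [CommRing A] [IsNoetherianRing A]
    [AddCommGroup M] [Module A M] [Module.Finite A M] {rs : List A} (h : IsWeaklyRegular M rs) :
    Module.supportDim A (M ⧸ Ideal.ofList rs • (⊤ : Submodule A M)) + rs.length ≤
      Module.supportDim A M := by
  induction rs generalizing M with
  | nil =>
    rw [List.length_nil, Nat.cast_zero, add_zero]
    exact Module.supportDim_le_of_surjective _ (Submodule.mkQ_surjective _)
  | cons r rs ih =>
    rw [isWeaklyRegular_cons_iff] at h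
    rw [Module.supportDim_eq_of_equiv
      (Submodule.quotOfListConsSMulTopEquivQuotSMulTopInner M r rs), List.length_cons,
      Nat.cast_succ, ← add_assoc]
    refine (add_le_add_left (ih h.2) 1).trans
      (Module.supportDim_quotSMulTop_succ_le_of_notMem_minimalPrimes fun p hp hrp => ?_)
    have hr : r ∈ {a : A | IsSMulRegular M a}ᶜ :=
      biUnion_associatedPrimes_eq_compl_regular A M ▸ Set.mem_biUnion
        (Module.associatedPrimes.minimalPrimes_annihilator_subset_associatedPrimes A M hp) hrp
    exact hr h.1

theorem ringKrullDim_quotient_ofList_add_length_le {A : Type*} [CommRing A] [IsNoetherianRing A]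
    {rs : List A} (h : IsWeaklyRegular A rs) :
    ringKrullDim (A ⧸ Ideal.ofList rs) + rs.length ≤ ringKrullDim A := by
  have hdim := supportDim_quotient_add_length_le h
  rwa [smul_eq_mul, Ideal.mul_top, Module.supportDim_quotient_eq_ringKrullDim,
    Module.supportDim_self_eq_ringKrullDim] at hdim

variable {k : Type v} [Field k] {R : Type u} [CommRing R] [Algebra k R]
  (𝒜 : ℕ → Submodule k R) [GradedAlgebra 𝒜]

/-- The ring as a graded module over itself. -/
noncomputable def GrMod.self : GrMod 𝒜 where
  carrier := R
  deg
    | .ofNat i => 𝒜 i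
    | .negSucc _ => ⊥
  isInternal := by
    let π : ℤ → R →+ R
      | .ofNat i => GradedRing.proj 𝒜 i
      | .negSucc _ => 0
    classical
    refine isInternal_of_proj π ?_ ?_ ?_ fun x =>
      ⟨(DirectSum.decompose 𝒜 x).support.map Nat.castEmbedding, ?_⟩
    · rintro (i | i) x
      · exact SetLike.coe_mem (DirectSum.decompose 𝒜 x i)
      · exact Submodule.zero_mem _
    · rintro (i | i) x hx
      · exact DirectSum.decompose_of_mem_same 𝒜 hx
      · exact ((Submodule.mem_bot k).1 hx).symm
    · rintro (i | i) (j | j) hij x hx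
      · exact DirectSum.decompose_of_mem_ne 𝒜 hx fun h => hij (congrArg _ h)
      · rfl
      · exact (congrArg _ ((Submodule.mem_bot k).1 hx)).trans (map_zero _)
      · rfl
    · exact (Finset.sum_map _ _ _).trans (DirectSum.sum_support_decompose 𝒜 x)
  smul_mem := by
    rintro i (j | j) a m ha hm
    · have h := SetLike.mul_mem_graded ha hm
      rw [add_comm] at h
      exact h
    · rw [(Submodule.mem_bot k).1 hm, smul_zero]
      exact Submodule.zero_mem _

variable {𝒜}

theorem isHomogeneous_of_mem_minimalPrimes {I p : Ideal R} (hI : I.IsHomogeneous 𝒜)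
    (hp : p ∈ I.minimalPrimes) : p.IsHomogeneous 𝒜 := by
  have hle : I ≤ (p.homogeneousCore 𝒜).toIdeal :=
    hI.toIdeal_homogeneousCore_eq_self.symm.le.trans (Ideal.homogeneousCore_mono 𝒜 hp.1.2)
  have heq : (p.homogeneousCore 𝒜).toIdeal = p :=
    (Ideal.toIdeal_homogeneousCore_le 𝒜 p).antisymm
      (hp.2 ⟨hp.1.1.homogeneousCore, hle⟩ (Ideal.toIdeal_homogeneousCore_le 𝒜 p))
  exact heq ▸ (p.homogeneousCore 𝒜).isHomogeneous

theorem isGradedCM_iff_extVanish {d : ℕ} (hd : ringKrullDim R = d) (M : Type u) [AddCommGroup M]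
    [Module R M] : IsGradedCM 𝒜 M ↔ ExtVanish 𝒜 d M := by
  simp only [IsGradedCM, ExtVanish, hd, ENat.WithBot.coe_eq_natCast, Nat.cast_lt]

section

variable [IsNoetherianRing R] (hR0 : Function.Bijective (algebraMap k (𝒜 0)))

include hR0

theorem finite_quotient_ofList_smul_top {rs : List R}
    (h : grMaxIdeal 𝒜 ≤ (Ideal.ofList rs).radical) (M : Type*) [AddCommGroup M] [Module k M]
    [Module R M] [IsScalarTower k R M] [Module.Finite R M] :
    Module.Finite k (M ⧸ Ideal.ofList rs • (⊤ : Submodule R M)) := by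
  obtain ⟨K, hK⟩ := Ideal.exists_pow_le_of_le_radical_of_fg h (IsNoetherian.noetherian _)
  refine finite_of_pow_smul_top_eq_bot 𝒜 hR0 K ?_
  rw [← map_mkQ_smul_top, ← le_bot_iff, Submodule.map_le_iff_le_comap, Submodule.comap_bot,
    Submodule.ker_mkQ]
  exact Submodule.smul_mono_left hK

omit hR0 in
theorem natCast_le_ringKrullDim_localization (hR : IsGradedCM 𝒜 R) [(grMaxIdeal 𝒜).IsPrime] {n : ℕ}
    (hn : n ≤ ringKrullDim R) : n ≤ ringKrullDim (Localization.AtPrime (grMaxIdeal 𝒜)) := by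
  obtain ⟨rs, rfl, hrs, hw⟩ := exists_homogeneous_isWeaklyRegular n (GrMod.self 𝒜)
    fun i hi => hR i (lt_of_lt_of_le (by exact_mod_cast hi) hn)
  have hreg := IsWeaklyRegular.isRegular_of_isLocalization_of_mem
    (Localization.AtPrime (grMaxIdeal 𝒜)) (grMaxIdeal 𝒜) hw fun r hr => by
      obtain ⟨i, hi, h⟩ := hrs r hr
      exact mem_grMaxIdeal_of_mem 𝒜 hi h
  have : Nontrivial (Localization.AtPrime (grMaxIdeal 𝒜) ⧸
      Ideal.ofList (rs.map (algebraMap R (Localization.AtPrime (grMaxIdeal 𝒜))))) :=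
    Ideal.Quotient.nontrivial_iff.2 fun h => hreg.top_ne_smul (by rw [h, Submodule.top_smul])
  have hdim := ringKrullDim_add_length_eq_ringKrullDim_of_isRegular _ hreg
  rw [List.length_map] at hdim
  exact hdim ▸ le_add_of_nonneg_left ringKrullDim_nonneg_of_nontrivial

theorem finiteRingKrullDim_of_isGradedCM (hR : IsGradedCM 𝒜 R) : FiniteRingKrullDim R := by
  have hmax := grMaxIdeal_isMaximal 𝒜 hR0
  have : Nontrivial R := ⟨⟨0, 1, fun h => grMaxIdeal_ne_top 𝒜 hR0
    ((Ideal.eq_top_iff_one _).2 (h ▸ Ideal.zero_mem _))⟩⟩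
  refine finiteRingKrullDim_iff_ne_bot_and_top.2 ⟨?_, fun htop => ?_⟩
  · exact fun h => (ringKrullDim_nonneg_of_nontrivial (R := R)).not_gt
      (h ▸ WithBot.bot_lt_coe _)
  · refine ringKrullDim_ne_top (R := Localization.AtPrime (grMaxIdeal 𝒜)) ?_
    exact ENat.WithBot.eq_top_iff_forall_ge.2 fun n =>
      natCast_le_ringKrullDim_localization hR (htop ▸ le_top)

theorem grMaxIdeal_le_radical_ofList {rs : List R} (hd : ringKrullDim R = rs.length)
    (hrs : ∀ r ∈ rs, ∃ i, 0 < i ∧ r ∈ 𝒜 i) (hw : IsWeaklyRegular R rs) :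
    grMaxIdeal 𝒜 ≤ (Ideal.ofList rs).radical := by
  have hhom : (Ideal.ofList rs).IsHomogeneous 𝒜 :=
    Ideal.homogeneous_span 𝒜 _ fun r hr => (hrs r hr).imp fun _ h => h.2
  have hzero : Ring.KrullDimLE 0 (R ⧸ Ideal.ofList rs) := by
    have hle : ringKrullDim (R ⧸ Ideal.ofList rs) + rs.length ≤ 0 + rs.length := by
      rw [zero_add, ← hd]
      exact hd ▸ ringKrullDim_quotient_ofList_add_length_le hw
    exact Ring.krullDimLE_iff.2 (ENat.WithBot.add_le_add_natCast_right_iff.1 hle)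
  rw [← Ideal.sInf_minimalPrimes]
  refine le_sInf fun p hp => ?_
  have hmax := Ideal.krullDimLE_zero_quotient_iff_forall_minimalPrimes_isMaximal.1 hzero p hp
  exact (hmax.eq_of_le (grMaxIdeal_ne_top 𝒜 hR0) (le_grMaxIdeal_of_isHomogeneous 𝒜 hR0
    (isHomogeneous_of_mem_minimalPrimes hhom hp) hmax.ne_top)).ge

end

end Dimension
section HomogeneousBases

open RingTheory.Sequence
open scoped Pointwise

variable {k : Type v} [Field k] {R : Type u} [CommRing R] [Algebra k R]

theorem exists_add_mul_of_mem_adjoin_insert {r : R} {s : Set R} {t : R}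
    (ht : t ∈ Algebra.adjoin k (insert r s)) :
    ∃ a ∈ Algebra.adjoin k s, ∃ b ∈ Algebra.adjoin k (insert r s), t = a + r * b := by
  have hr : r ∈ Algebra.adjoin k (insert r s) := Algebra.subset_adjoin (s.mem_insert r)
  have hle := Algebra.adjoin_mono (R := k) (s.subset_insert r)
  induction ht using Algebra.adjoin_induction with
  | mem x hx =>
    obtain rfl | hx := hx
    · exact ⟨0, Subalgebra.zero_mem _, 1, Subalgebra.one_mem _, by ring⟩
    · exact ⟨x, Algebra.subset_adjoin hx, 0, Subalgebra.zero_mem _, by ring⟩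
  | algebraMap c => exact ⟨_, Subalgebra.algebraMap_mem _ c, 0, Subalgebra.zero_mem _, by ring⟩
  | add x y _ _ hx hy =>
    obtain ⟨a, ha, b, hb, rfl⟩ := hx
    obtain ⟨a', ha', b', hb', rfl⟩ := hy
    exact ⟨_, add_mem ha ha', _, add_mem hb hb', by ring⟩
  | mul x y _ hy' hx hy =>
    obtain ⟨a, ha, b, hb, rfl⟩ := hx
    obtain ⟨a', ha', b', hb', rfl⟩ := hy
    exact ⟨_, mul_mem ha ha', _, add_mem (mul_mem (hle ha) hb') (mul_mem hb hy'), by ring⟩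

theorem linearIndependent_adjoin_insert {r : R} (hr : ∀ a, (∀ n, r ^ n ∣ a) → a = 0) {s : Set R}
    {L ι : Type*} [AddCommGroup L] [Module R L] (hreg : IsSMulRegular L r) {v : ι → L}
    (hv : LinearIndependent (Algebra.adjoin k s) ((r • (⊤ : Submodule R L)).mkQ ∘ v)) :
    LinearIndependent (Algebra.adjoin k (insert r s)) v := by
  rw [linearIndependent_iff'] at hv ⊢
  intro t c hc i hi
  suffices h : ∀ n (c : ι → Algebra.adjoin k (insert r s)), ∑ i ∈ t, c i • v i = 0 →
      r ^ n ∣ (c i : R) from Subtype.ext (hr _ fun n => h n c hc)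
  intro n
  induction n with
  | zero => exact fun _ _ => (pow_zero r).symm ▸ one_dvd _
  | succ n ih =>
    intro c hc
    choose a ha b hb hab using fun i => exists_add_mul_of_mem_adjoin_insert (c i).2
    have hsum : ∑ i ∈ t, a i • v i + r • ∑ i ∈ t, b i • v i = 0 := by
      rw [← hc, Finset.smul_sum, ← Finset.sum_add_distrib]
      exact Finset.sum_congr rfl fun i _ => by
        rw [smul_smul, ← add_smul, ← hab]; rfl
    have ha0 : ∀ i ∈ t, a i = 0 := fun i hi => by
      refine congrArg Subtype.val (hv t (fun i => ⟨a i, ha i⟩) ?_ i hi)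
      have hq := congrArg (r • (⊤ : Submodule R L)).mkQ hsum
      rwa [map_add, map_sum, map_zero, Submodule.mkQ_apply _ (r • _),
        (Submodule.Quotient.mk_eq_zero _).2 (Submodule.smul_mem_pointwise_smul _ r ⊤ trivial),
        add_zero] at hq
    rw [Finset.sum_eq_zero fun i hi => by rw [ha0 i hi, zero_smul], zero_add] at hsum
    obtain ⟨d, hd⟩ := ih (fun i => ⟨b i, hb i⟩) (hreg (hsum.trans (smul_zero r).symm))
    exact ⟨d, by rw [hab, ha0 i hi, zero_add, pow_succ', mul_assoc]; exact congrArg (r * ·) hd⟩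

theorem exists_eq_sum_add_smul {S : Subalgebra k R} {r : R} {L ι : Type*} [AddCommGroup L]
    [Module R L] (b : Module.Basis ι S (L ⧸ r • (⊤ : Submodule R L))) {v : ι → L}
    (hv : ∀ i, (r • (⊤ : Submodule R L)).mkQ (v i) = b i) (x : L) :
    ∃ (t : Finset ι) (c : ι → S) (z : L), x = ∑ i ∈ t, c i • v i + r • z := by
  let c := b.repr ((r • (⊤ : Submodule R L)).mkQ x)
  have hx : x - ∑ i ∈ c.support, (c i : R) • v i ∈ r • (⊤ : Submodule R L) := by
    rw [← Submodule.ker_mkQ (r • ⊤), LinearMap.mem_ker, map_sub, map_sum, sub_eq_zero]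
    refine (b.linearCombination_repr _).symm.trans (Finset.sum_congr rfl fun i _ => ?_)
    exact congrArg ((c i : R) • ·) (hv i).symm
  obtain ⟨z, -, hz⟩ := (Submodule.mem_smul_pointwise_iff_exists _ _ _).1 hx
  exact ⟨c.support, c, z, (sub_eq_iff_eq_add'.1 hz.symm)⟩

variable {𝒜 : ℕ → Submodule k R}

variable (𝒜) in
/-- A homogeneous subalgebra: it is spanned by homogeneous elements of the ambient algebra. -/
def IsHomogeneousSubalgebra (S : Subalgebra k R) : Prop :=
  Submodule.span k {a : S | ∃ e, (a : R) ∈ 𝒜 e} = ⊤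

theorem isHomogeneousSubalgebra_adjoin [GradedAlgebra 𝒜] {s : Set R}
    (hs : ∀ r ∈ s, ∃ e, r ∈ 𝒜 e) : IsHomogeneousSubalgebra 𝒜 (Algebra.adjoin k s) := by
  refine Submodule.map_injective_of_injective (f := (Algebra.adjoin k s).val.toLinearMap)
    Subtype.val_injective ?_
  have hclosure : Submonoid.closure s ≤ SetLike.homogeneousSubmonoid 𝒜 :=
    Submonoid.closure_le.2 hs
  rw [Submodule.map_span, Submodule.map_top]
  refine le_antisymm (Submodule.span_le.2 ?_) ?_
  · rintro _ ⟨a, -, rfl⟩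
    exact ⟨a, rfl⟩
  · rintro _ ⟨a, rfl⟩
    have ha : (a : R) ∈ Submodule.span k (Submonoid.closure s) :=
      (Algebra.adjoin_eq_span k s).le a.2
    refine Submodule.span_mono (fun x hx => ?_) ha
    have hxS : x ∈ Algebra.adjoin k s := (Algebra.adjoin_eq_span k s).ge (Submodule.subset_span hx)
    exact ⟨⟨x, hxS⟩, hclosure hx, rfl⟩

namespace GrMod

theorem restrictScalars_span_eq {S : Subalgebra k R} (hS : IsHomogeneousSubalgebra 𝒜 S)
    (M : GrMod 𝒜) (s : Set M.carrier) :
    Submodule.span k ({a : S | ∃ e, (a : R) ∈ 𝒜 e} • s) = (Submodule.span S s).restrictScalars k :=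
  Submodule.span_smul_of_span_eq_top hS s

theorem homogeneous_smul_mem_deg {S : Subalgebra k R} (M : GrMod 𝒜) {s : Set M.carrier}
    (hs : ∀ x ∈ s, ∃ n, x ∈ M.deg n) {x : M.carrier}
    (hx : x ∈ {a : S | ∃ e, (a : R) ∈ 𝒜 e} • s) : ∃ n, x ∈ M.deg n := by
  obtain ⟨a, ⟨e, ha⟩, y, hy, rfl⟩ := hx
  exact (hs y hy).imp' (· + (e : ℤ)) fun n hn => M.smul_mem e n a y ha hn

variable [GradedAlgebra 𝒜]

theorem span_eq_top_of_span_sup_smul_eq_top {S : Subalgebra k R}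
    (hS : IsHomogeneousSubalgebra 𝒜 S) (L : GrMod 𝒜) {e : ℕ} (he : 0 < e) {r : R} (hr : r ∈ 𝒜 e)
    (hrS : r ∈ S) {s : Set L.carrier} (hs : ∀ x ∈ s, ∃ n, x ∈ L.deg n)
    (h : ∀ x, ∃ p ∈ Submodule.span S s, ∃ z, x = p + r • z) : Submodule.span S s = ⊤ := by
  have hproj : ∀ n, ∀ x ∈ Submodule.span S s, L.proj n x ∈ Submodule.span S s := by
    intro n x hx
    have hspan := restrictScalars_span_eq hS L s
    exact hspan.le (gradedProj_mem_span L.deg (fun x => L.homogeneous_smul_mem_deg hs)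
      (hspan.ge hx) n)
  obtain ⟨b, hb⟩ := L.exists_ge_eq_top
  have hdeg : ∀ m : ℕ, ∀ n < b + m, ∀ x ∈ L.deg n, x ∈ Submodule.span S s := by
    intro m
    induction m with
    | zero =>
      intro n hn x hx
      rw [deg_eq_bot_of_ge_eq_top hb (by simpa using hn), Submodule.mem_bot] at hx
      exact hx ▸ Submodule.zero_mem _
    | succ m ih =>
      intro n hn x hx
      obtain ⟨p, hp, z, hz⟩ := h x
      have hproj_z := ih (n - e) (by push_cast at hn; lia) _ (gradedProj_mem L.deg (n - e) z)
      rw [← gradedProj_of_mem hx, hz, map_add, L.proj_smul hr]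
      exact Submodule.add_mem _ (hproj n p hp) (Submodule.smul_mem _ (⟨r, hrS⟩ : S) hproj_z)
  refine eq_top_iff.2 fun x _ => homogeneous_induction L.deg (fun n x hx => ?_)
    (fun _ _ => Submodule.add_mem _) x
  exact hdeg (n - b + 1).toNat n (by lia) x hx

theorem eq_zero_of_forall_pow_dvd {e : ℕ} (he : 0 < e) {r : R} (hr : r ∈ 𝒜 e) {a : R}
    (ha : ∀ n, r ^ n ∣ a) : a = 0 := by
  refine ext_gradedProj (ℳ := 𝒜) fun i => ?_
  obtain ⟨b, rfl⟩ := ha (i + 1)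
  rw [map_zero]
  refine DirectSum.coe_decompose_mul_of_left_mem_of_not_le 𝒜 (SetLike.pow_mem_graded _ hr) ?_
  exact (Nat.lt_of_lt_of_le i.lt_succ_self (Nat.le_mul_of_pos_right _ he)).not_ge

theorem exists_lift_basis {e : ℕ} (he : 0 < e) {r : R} (hr : r ∈ 𝒜 e) {s : Set R}
    (hs : ∀ a ∈ s, ∃ e, a ∈ 𝒜 e) (L : GrMod 𝒜) (hreg : IsSMulRegular L.carrier r) {ι : Type*}
    {d : ι → ℤ} (b : Module.Basis ι (Algebra.adjoin k s)
      (L.ofQuot _ (L.isHomogeneous_smul_top hr)).carrier)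
    (hb : ∀ i, b i ∈ (L.ofQuot _ (L.isHomogeneous_smul_top hr)).deg (d i)) :
    ∃ b' : Module.Basis ι (Algebra.adjoin k (insert r s)) L.carrier, ∀ i, b' i ∈ L.deg (d i) := by
  choose v hv hvb using hb
  have hcomp : (r • (⊤ : Submodule R L.carrier)).mkQ ∘ v = b := funext hvb
  have hli := linearIndependent_adjoin_insert (k := k) (s := s)
    (fun _ => eq_zero_of_forall_pow_dvd he hr) hreg (v := v) (hcomp ▸ b.linearIndependent)
  have hspan : Submodule.span (Algebra.adjoin k (insert r s)) (Set.range v) = ⊤ := by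
    refine L.span_eq_top_of_span_sup_smul_eq_top ?_ he hr ?_ ?_ fun x => ?_
    · exact isHomogeneousSubalgebra_adjoin (Set.forall_mem_insert.2 ⟨⟨e, hr⟩, hs⟩)
    · exact Algebra.subset_adjoin (s.mem_insert r)
    · rintro _ ⟨i, rfl⟩
      exact ⟨d i, hv i⟩
    · obtain ⟨t, c, z, hz⟩ := exists_eq_sum_add_smul b hvb x
      refine ⟨_, Submodule.sum_mem _ fun i _ => ?_, z, hz⟩
      exact Submodule.smul_mem _
        (⟨c i, Algebra.adjoin_mono (s.subset_insert r) (c i).2⟩ : Algebra.adjoin k (insert r s))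
        (Submodule.subset_span ⟨i, rfl⟩)
  exact ⟨Module.Basis.mk hli hspan.ge, fun i => by rw [Module.Basis.mk_apply]; exact hv i⟩

theorem hilb_ofQuot_smul_top_add [IsNoetherianRing R]
    (hR0 : Function.Bijective (algebraMap k (𝒜 0))) (M : GrMod 𝒜) {e : ℕ} {r : R} (hr : r ∈ 𝒜 e)
    (hreg : IsSMulRegular M.carrier r) (n : ℤ) :
    (M.ofQuot _ (M.isHomogeneous_smul_top hr)).hilb n + M.hilb (n - e) = M.hilb n := by
  have := M.finite_deg hR0
  let f : M.deg (n - e) →ₗ[k] M.deg n := LinearMap.restrict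
    ((LinearMap.lsmul R M.carrier r).restrictScalars k) fun x hx => by
      have h := M.smul_mem e (n - e) r x hr hx
      rwa [sub_add_cancel] at h
  let F : M.deg n →ₗ[k] M.carrier ⧸ (r • (⊤ : Submodule R M.carrier)) :=
    ((r • (⊤ : Submodule R M.carrier)).mkQ.restrictScalars k).domRestrict (M.deg n)
  have hF : LinearMap.range F = (M.ofQuot _ (M.isHomogeneous_smul_top hr)).deg n :=
    LinearMap.range_domRestrict _ _
  have hf : Function.Injective f := fun x y hxy => Subtype.ext (hreg (congrArg Subtype.val hxy))
  have hker : LinearMap.ker F = LinearMap.range f := by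
    ext x
    refine (Submodule.Quotient.mk_eq_zero _).trans
      ((Submodule.mem_smul_pointwise_iff_exists _ _ _).trans ⟨?_, ?_⟩)
    · rintro ⟨y, -, hy⟩
      refine ⟨⟨M.proj (n - e) y, gradedProj_mem _ _ _⟩, Subtype.ext ?_⟩
      exact (M.proj_smul hr n y).symm.trans
        ((congrArg (M.proj n) hy).trans (gradedProj_of_mem x.2))
    · rintro ⟨y, rfl⟩
      exact ⟨y, trivial, rfl⟩
  have h := F.finrank_range_add_finrank_ker
  rw [hker, LinearMap.finrank_range_of_inj hf, hF] at h
  exact h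

theorem exists_basis_pair_bot [IsNoetherianRing R]
    (hR0 : Function.Bijective (algebraMap k (𝒜 0))) {M N : GrMod 𝒜} (hh : M.hilb = N.hilb)
    [Module.Finite k M.carrier] :
    ∃ (ι : Type) (_ : Finite ι) (d : ι → ℤ) (b : Module.Basis ι (⊥ : Subalgebra k R) M.carrier)
      (c : Module.Basis ι (⊥ : Subalgebra k R) N.carrier),
      (∀ i, b i ∈ M.deg (d i)) ∧ ∀ i, c i ∈ N.deg (d i) := by
  classical
  have := M.finite_deg hR0
  have := N.finite_deg hR0
  let b n := Module.finBasis k (M.deg n)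
  let c n := (Module.finBasis k (N.deg n)).reindex (finCongr (congrFun hh n).symm)
  let B := M.isInternal.collectedBasis b
  let C := N.isInternal.collectedBasis c
  have hinj : Function.Injective (algebraMap k R) := fun x y hxy =>
    hR0.1 (Subtype.ext hxy)
  let e := (Algebra.botEquivOfInjective hinj).symm.toRingEquiv
  have he : ∀ (a : k) (L : GrMod 𝒜) (x : L.carrier), e a • x = a • x := fun a L x =>
    algebraMap_smul R a x
  refine ⟨_, Module.Finite.finite_basis B, fun x => x.1, B.mapCoeffs e (fun a => he a M),
    C.mapCoeffs e (fun a => he a N), fun i => ?_, fun i => ?_⟩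
  · exact (B.mapCoeffs_apply e _ i).symm ▸ M.isInternal.collectedBasis_mem b i
  · exact (C.mapCoeffs_apply e _ i).symm ▸ N.isInternal.collectedBasis_mem c i

theorem exists_basis_pair [IsNoetherianRing R] (hR0 : Function.Bijective (algebraMap k (𝒜 0)))
    {rs : List R} (hrs : ∀ r ∈ rs, ∃ i, 0 < i ∧ r ∈ 𝒜 i) {M N : GrMod 𝒜} (hh : M.hilb = N.hilb)
    (hM : IsWeaklyRegular M.carrier rs) (hN : IsWeaklyRegular N.carrier rs)
    (hfin : Module.Finite k (M.carrier ⧸ Ideal.ofList rs • (⊤ : Submodule R M.carrier))) :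
    ∃ (ι : Type) (_ : Finite ι) (d : ι → ℤ)
      (b : Module.Basis ι (Algebra.adjoin k {x | x ∈ rs}) M.carrier)
      (c : Module.Basis ι (Algebra.adjoin k {x | x ∈ rs}) N.carrier),
      (∀ i, b i ∈ M.deg (d i)) ∧ ∀ i, c i ∈ N.deg (d i) := by
  induction rs generalizing M N with
  | nil =>
    have h0 : Ideal.ofList ([] : List R) • (⊤ : Submodule R M.carrier) = ⊥ := by
      rw [Ideal.ofList_nil, Submodule.bot_smul]
    have := Module.Finite.equiv ((Submodule.quotEquivOfEqBot _ h0).restrictScalars k)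
    have hbot : Algebra.adjoin k {x | x ∈ ([] : List R)} = ⊥ := by simp
    rw [hbot]
    exact exists_basis_pair_bot hR0 hh
  | cons r rs ih =>
    obtain ⟨hr, hrs⟩ := List.forall_mem_cons.1 hrs
    obtain ⟨e, he, hr⟩ := hr
    rw [isWeaklyRegular_cons_iff] at hM hN
    have hquot : (M.ofQuot _ (M.isHomogeneous_smul_top hr)).hilb =
        (N.ofQuot _ (N.isHomogeneous_smul_top hr)).hilb := funext fun n => by
      have hMn := M.hilb_ofQuot_smul_top_add hR0 hr hM.1 n
      have hNn := N.hilb_ofQuot_smul_top_add hR0 hr hN.1 n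
      rw [hh] at hMn
      lia
    have hfin' := Module.Finite.equiv
      ((Submodule.quotOfListConsSMulTopEquivQuotSMulTopInner M.carrier r rs).restrictScalars k)
    obtain ⟨ι, hι, d, b, c, hb, hc⟩ := ih hrs hquot hM.2 hN.2 hfin'
    have hs : ∀ a ∈ {x | x ∈ rs}, ∃ i, a ∈ 𝒜 i := fun a ha => (hrs a ha).imp fun _ h => h.2
    obtain ⟨b', hb'⟩ := M.exists_lift_basis he hr hs hM.1 b hb
    obtain ⟨c', hc'⟩ := N.exists_lift_basis he hr hs hN.1 c hc
    have hinsert : {x | x ∈ r :: rs} = insert r {x | x ∈ rs} := by ext; simp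
    rw [hinsert]
    exact ⟨ι, hι, d, b', c', hb', hc'⟩

end GrMod

end HomogeneousBases

section Coinduced

theorem exists_leftInverse_of_exact {A M N P : Type*} [Ring A] [AddCommGroup M] [AddCommGroup N]
    [AddCommGroup P] [Module A M] [Module A N] [Module A P] {f : M →ₗ[A] N} {g : N →ₗ[A] P}
    (h : Function.Exact f g) (hg : Function.Surjective g) {l : N →ₗ[A] M}
    (hl : Function.LeftInverse l f) : ∃ s : P →ₗ[A] N, Function.LeftInverse g s := by
  obtain ⟨-, s, hs⟩ := (h.split_tfae'.out 1 0 rfl rfl).1 ⟨hg, l, LinearMap.ext hl⟩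
  exact ⟨s, LinearMap.congr_fun hs⟩

open RingTheory.Sequence

theorem isWeaklyRegular_pi {A : Type*} [CommRing A] {ι : Type*} [Finite ι] {N : Type*}
    [AddCommGroup N] [Module A N] {rs : List A} (h : IsWeaklyRegular N rs) :
    IsWeaklyRegular (ι → N) rs := by
  classical
  have := Fintype.ofFinite ι
  exact ((TensorProduct.piScalarRight A A N ι).isWeaklyRegular_congr rs).1
    (h.isWeaklyRegular_rTensor (M₂ := ι → A))

variable {k : Type*} [Field k] {R : Type*} [CommRing R] [Algebra k R]

/-- The coinduced module `Hom_S(R, X)`, on which `R` acts through the first argument. -/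
def Coind (S : Subalgebra k R) (X : Type*) [AddCommGroup X] [Module R X] : Type _ := R →ₗ[S] X

namespace Coind

variable (S : Subalgebra k R) (X : Type*) [AddCommGroup X] [Module R X]

instance : AddCommGroup (Coind S X) := inferInstanceAs (AddCommGroup (R →ₗ[S] X))

instance [Module k X] [IsScalarTower k R X] : Module k (Coind S X) :=
  inferInstanceAs (Module k (R →ₗ[S] X))

variable {S X}

/-- An element of the coinduced module, as a linear map. -/
def app (f : Coind S X) : R →ₗ[S] X := f

theorem ext_app {f g : Coind S X} (h : ∀ r, f.app r = g.app r) : f = g := LinearMap.ext h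

instance : Module R (Coind S X) where
  smul r f := (f.app ∘ₗ LinearMap.mulLeft S r : R →ₗ[S] X)
  one_smul f := ext_app fun x => congrArg f.app (one_mul x)
  mul_smul r s f := ext_app fun x => congrArg f.app ((congrArg (· * x) (mul_comm r s)).trans
    (mul_assoc s r x))
  smul_zero _ := rfl
  smul_add _ _ _ := rfl
  add_smul r s f := ext_app fun x => (congrArg f.app (add_mul r s x)).trans (map_add f.app _ _)
  zero_smul f := ext_app fun x => (congrArg f.app (zero_mul x)).trans (map_zero f.app)

theorem smul_app (r : R) (f : Coind S X) (x : R) : (r • f).app x = f.app (r * x) := rfl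

instance [Module k X] [IsScalarTower k R X] : IsScalarTower k R (Coind S X) where
  smul_assoc c r f := ext_app fun x => by
    rw [smul_app, smul_mul_assoc, ← algebraMap_smul S c (r * x), map_smul, algebraMap_smul]
    rfl

/-- Evaluation on a basis of `R`. -/
noncomputable def evalBasis (X : Type*) [AddCommGroup X] [Module R X] {ι : Type*}
    (b : Module.Basis ι S R) : Coind S X ≃ₗ[S] (ι → X) where
  __ := (b.constr S (M' := X)).symm.toAddEquiv
  map_smul' s f := funext fun i => by
    exact (congrArg f.app (Subalgebra.smul_def s (b i)).symm).trans (f.app.map_smul s (b i))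

theorem finite {ι : Type*} [Finite ι] (b : Module.Basis ι S R) [Module.Finite S X] :
    Module.Finite R (Coind S X) := by
  have := Module.Finite.equiv (evalBasis X b).symm
  exact Module.Finite.of_restrictScalars_finite S R _

variable (S X)

/-- The embedding of a module into its coinduced module. -/
def embed : X →ₗ[R] Coind S X where
  toFun x := (LinearMap.toSpanSingleton R X x).restrictScalars S
  map_add' x y := ext_app fun r => smul_add r x y
  map_smul' a x := ext_app fun r => (smul_smul r a x).trans (by rw [mul_comm]; rfl)

/-- Evaluation at `1`, as an `S`-linear map. -/
def evalOne : Coind S X →ₗ[S] X where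
  toFun f := f.app 1
  map_add' _ _ := rfl
  map_smul' s f := f.app.map_smul s 1

theorem evalOne_embed : Function.LeftInverse (evalOne S X) (embed S X) := one_smul R

variable {X S} in
theorem isWeaklyRegular_quotient_range_embed {ι : Type*} [Finite ι] (b : Module.Basis ι S R)
    {rs : List R} (hrs : ∀ r ∈ rs, r ∈ S) (h : IsWeaklyRegular X rs) :
    IsWeaklyRegular (Coind S X ⧸ LinearMap.range (embed S X)) rs := by
  lift rs to List S using hrs
  have hex := LinearMap.exact_map_mkQ_range (embed S X)
  have hg := Submodule.mkQ_surjective (LinearMap.range (embed S X))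
  obtain ⟨l, hl⟩ := exists_leftInverse_of_exact (f := (embed S X).restrictScalars S)
    (g := (LinearMap.range (embed S X)).mkQ.restrictScalars S) hex hg (evalOne_embed S X)
  replace h : IsWeaklyRegular X rs := (isWeaklyRegular_map_algebraMap_iff R X rs).1 h
  refine (isWeaklyRegular_map_algebraMap_iff R _ rs).2 ?_
  have hW : IsWeaklyRegular (Coind S X) rs :=
    ((evalBasis X b).isWeaklyRegular_congr rs).2 (isWeaklyRegular_pi h)
  exact isWeaklyRegular_of_leftInverse rs hl hW

variable {S X} [Module k X] [IsScalarTower k R X] {M : Type*} [AddCommGroup M] [Module k M]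
  [Module R M] [IsScalarTower k R M]

/-- The adjunction between restriction of scalars and coinduction. -/
def homEquiv : (M →ₗ[R] Coind S X) ≃ₗ[k] (M →ₗ[S] X) where
  toFun f :=
    { toFun := fun m => (f m).app 1
      map_add' := fun x y => congrArg (app · 1) (map_add f x y)
      map_smul' := fun s x =>
        (congrArg (app · 1) (f.map_smul (s : R) x)).trans ((f x).app.map_smul s 1) }
  map_add' _ _ := rfl
  map_smul' _ _ := rfl
  invFun h :=
    { toFun := fun m => (h ∘ₗ (LinearMap.toSpanSingleton R M m).restrictScalars S : R →ₗ[S] X)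
      map_add' := fun x y => ext_app fun r => (congrArg h (smul_add r x y)).trans (map_add h _ _)
      map_smul' := fun a x => ext_app fun r =>
        congrArg h ((smul_smul r a x).trans (by rw [mul_comm]; rfl)) }
  left_inv f := LinearMap.ext fun m => ext_app fun r =>
    (congrArg (app · 1) (f.map_smul r m)).trans (congrArg (f m).app (mul_one r))
  right_inv h := LinearMap.ext fun m => congrArg h (one_smul R m)

end Coind

end Coinduced

section GradedCoinduced

open scoped Pointwise

variable {k : Type v} [Field k] {R : Type u} [CommRing R] [Algebra k R] {𝒜 : ℕ → Submodule k R}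

namespace GrMod

theorem span_isHomogeneousScalar_subalgebra_eq_top {S : Subalgebra k R}
    (hS : IsHomogeneousSubalgebra 𝒜 S) (M N : GrMod 𝒜) :
    Submodule.span k {a : S | ∃ e, IsHomogeneousScalar M.deg N.deg a e} = ⊤ := by
  refine top_unique (hS.ge.trans (Submodule.span_mono ?_))
  rintro a ⟨e, he⟩
  exact ⟨e, fun n x hx => M.smul_mem e n a x he hx, fun n x hx => N.smul_mem e n a x he hx⟩

theorem apply_mem_deg_of_basis {S : Subalgebra k R} (hS : IsHomogeneousSubalgebra 𝒜 S)
    {M N : GrMod 𝒜} {ι : Type*} {d : ι → ℤ} (b : Module.Basis ι S M.carrier)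
    (hb : ∀ i, b i ∈ M.deg (d i)) {φ : M.carrier →ₗ[S] N.carrier}
    (hφ : ∀ i, φ (b i) ∈ N.deg (d i)) {n : ℤ} {x : M.carrier} (hx : x ∈ M.deg n) :
    φ x ∈ N.deg n := by
  have hspan : x ∈ Submodule.span k ({a : S | ∃ e, (a : R) ∈ 𝒜 e} • Set.range b) := by
    rw [restrictScalars_span_eq hS, b.span_eq]
    trivial
  have hproj : φ (M.proj n x) ∈ N.deg n := by
    clear hx
    induction hspan using Submodule.span_induction with
    | mem x hx =>
      obtain ⟨a, ⟨e, ha⟩, _, ⟨i, rfl⟩, rfl⟩ := hx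
      have haM : a • b i ∈ M.deg (d i + e) := M.smul_mem e (d i) a _ ha (hb i)
      obtain rfl | hne := eq_or_ne (d i + e) n
      · refine (congrArg φ (gradedProj_of_mem haM)).trans (map_smul φ a (b i)) ▸ ?_
        exact N.smul_mem e (d i) a _ ha (hφ i)
      · refine (congrArg φ (gradedProj_of_mem_ne haM hne)).trans (map_zero φ) ▸ ?_
        exact Submodule.zero_mem _
    | zero => simp
    | add x y _ _ hx hy => rw [map_add, map_add]; exact Submodule.add_mem _ hx hy
    | smul c x _ hx =>
      rw [map_smul]
      exact (φ.restrictScalars k).map_smul c _ ▸ Submodule.smul_mem _ c hx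
  rwa [gradedProj_of_mem hx] at hproj

theorem finrank_homDeg_congr {S : Subalgebra k R} {M N : GrMod 𝒜} (X : GrMod 𝒜)
    {φ : M.carrier ≃ₗ[S] N.carrier}
    (hφ : ∀ n x, x ∈ M.deg n ↔ φ x ∈ N.deg n) (l : ℤ) :
    Module.finrank k (homDeg S M.deg X.deg l) = Module.finrank k (homDeg S N.deg X.deg l) := by
  have h : homDeg S M.deg X.deg l =
      (homDeg S N.deg X.deg l).comap (LinearEquiv.congrLeft X.carrier k φ).toLinearMap := by
    ext f
    refine ⟨fun hf n x hx => hf n (φ.symm x) ((hφ n _).2 ?_), fun hf n x hx => ?_⟩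
    · rwa [φ.apply_symm_apply]
    · exact φ.symm_apply_apply x ▸ hf n (φ x) ((hφ n x).1 hx)
  rw [h]
  exact (LinearEquiv.ofSubmodule' _ _).finrank_eq

variable [GradedAlgebra 𝒜]

theorem span_isHomogeneousScalar_eq_top (M N : GrMod 𝒜) :
    Submodule.span k {a : R | ∃ e, IsHomogeneousScalar M.deg N.deg a e} = ⊤ := by
  refine top_unique ((span_homogeneous_eq_top 𝒜).ge.trans (Submodule.span_mono ?_))
  rintro a ⟨e, he⟩
  exact ⟨e, fun n x hx => M.smul_mem e n a x he hx, fun n x hx => N.smul_mem e n a x he hx⟩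

theorem smul_mem_of_mem_self {X : GrMod 𝒜} {m n : ℤ} {r : R} (hr : r ∈ (GrMod.self 𝒜).deg m)
    {x : X.carrier} (hx : x ∈ X.deg n) : r • x ∈ X.deg (n + m) := by
  cases m with
  | ofNat i => exact X.smul_mem i n r x hr hx
  | negSucc i =>
    rw [(Submodule.mem_bot k).1 hr, zero_smul]
    exact Submodule.zero_mem _

/-- The coinduced module, graded by the degrees of `S`-linear maps. -/
noncomputable def coind {S : Subalgebra k R} (hS : IsHomogeneousSubalgebra 𝒜 S)
    (X : GrMod 𝒜) (hSR : Module.Finite S R) (hfin : Module.Finite R (Coind S X.carrier)) :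
    GrMod 𝒜 where
  carrier := Coind S X.carrier
  moduleBase := inferInstance
  isScalarTower := Coind.instIsScalarTower
  deg := homDeg S (V := (GrMod.self 𝒜).carrier) (GrMod.self 𝒜).deg X.deg
  isInternal :=
    have : Module.Finite S (GrMod.self 𝒜).carrier := hSR
    isInternal_homDeg (V := (GrMod.self 𝒜).carrier)
      (span_isHomogeneousScalar_subalgebra_eq_top hS (GrMod.self 𝒜) X)
  smul_mem i n r f hr hf m x hx := by
    have h := hf _ _ ((GrMod.self 𝒜).smul_mem i m r x hr hx)
    rw [add_right_comm, add_assoc] at h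
    exact h

section Coind

variable {S : Subalgebra k R} (hS : IsHomogeneousSubalgebra 𝒜 S) (X : GrMod 𝒜)
  (hSR : Module.Finite S R) (hfin : Module.Finite R (Coind S X.carrier))

theorem embed_mem_hom : Coind.embed S X.carrier ∈ hom X (coind hS X hSR hfin) :=
  fun n _ hx m _ hr => add_comm n m ▸ smul_mem_of_mem_self (R := R) hr hx

theorem hom_shift_coind (M : GrMod 𝒜) (l : ℤ) :
    hom M ((coind hS X hSR hfin).shift l) =
      (homDeg S M.deg X.deg l).comap (Coind.homEquiv (k := k)).toLinearMap := by
  ext f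
  refine ⟨fun hf n x hx => ?_, fun hf n x hx m (r : R) hr => ?_⟩
  · have h := hf n x hx 0 (1 : R) (SetLike.one_mem_graded 𝒜)
    rw [zero_add] at h
    exact h
  · have hfr : (f (r • x)).app 1 = (f x).app r :=
      (congrArg (Coind.app · 1) (f.map_smul r x)).trans (congrArg (f x).app (mul_one r))
    have h : (f (r • x)).app 1 ∈ X.deg (n + m + l) :=
      hf _ _ (smul_mem_of_mem_self (R := R) hr hx)
    rw [hfr, add_assoc, add_left_comm] at h
    exact h

theorem homDim_shift_coind (M : GrMod 𝒜) (l : ℤ) :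
    M.homDim ((coind hS X hSR hfin).shift l) = Module.finrank k (homDeg S M.deg X.deg l) := by
  let e : (M.carrier →ₗ[R] ((coind hS X hSR hfin).shift l).carrier) ≃ₗ[k]
      (M.carrier →ₗ[S] X.carrier) := Coind.homEquiv
  rw [homDim, hom_shift_coind]
  exact (e.ofSubmodule' _).finrank_eq

theorem homDim_shift_coind_eq {M N : GrMod 𝒜} {φ : M.carrier ≃ₗ[S] N.carrier}
    (hφ : ∀ n x, x ∈ M.deg n ↔ φ x ∈ N.deg n) (l : ℤ) :
    M.homDim ((coind hS X hSR hfin).shift l) = N.homDim ((coind hS X hSR hfin).shift l) := by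
  rw [homDim_shift_coind, homDim_shift_coind, finrank_homDeg_congr X hφ]

end Coind

section NoetherNormalization

open RingTheory.Sequence

variable [IsNoetherianRing R] (hR0 : Function.Bijective (algebraMap k (𝒜 0)))

include hR0

theorem exists_parameters (hR : IsGradedCM 𝒜 R) (Z : GrMod 𝒜) (hZ : Z.IsCM) :
    ∃ rs : List R, (∀ r ∈ rs, ∃ i, 0 < i ∧ r ∈ 𝒜 i) ∧ IsWeaklyRegular R rs ∧
      IsWeaklyRegular Z.carrier rs ∧ grMaxIdeal 𝒜 ≤ (Ideal.ofList rs).radical ∧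
      ∀ Y : GrMod 𝒜, IsWeaklyRegular Y.carrier rs → Y.IsCM := by
  have := finiteRingKrullDim_of_isGradedCM hR0 hR
  obtain ⟨d, hd⟩ : ∃ d : ℕ, ringKrullDim R = d :=
    ⟨_, Order.krullDim_eq_length_of_finiteDimensionalOrder⟩
  obtain ⟨rs, rfl, hrs, hw⟩ := exists_homogeneous_isWeaklyRegular d ((GrMod.self 𝒜).prod Z)
    ((isGradedCM_iff_extVanish hd _).1 (isGradedCM_prod hR hZ))
  have hwR : IsWeaklyRegular R rs :=
    isWeaklyRegular_of_leftInverse (f := LinearMap.inl R R Z.carrier) (g := LinearMap.fst R R _) rs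
      (fun _ => rfl) hw
  have hwZ : IsWeaklyRegular Z.carrier rs :=
    isWeaklyRegular_of_leftInverse (f := LinearMap.inr R R Z.carrier) (g := LinearMap.snd R R _) rs
      (fun _ => rfl) hw
  refine ⟨rs, hrs, hwR, hwZ, grMaxIdeal_le_radical_ofList hR0 hd hrs hwR, fun Y hY =>
    (isGradedCM_iff_extVanish hd _).2 (extVanish_of_isWeaklyRegular Y (fun r hr => ?_) hY)⟩
  obtain ⟨i, hi, hri⟩ := hrs r hr
  exact mem_grMaxIdeal_of_mem 𝒜 hi hri

theorem exists_equiv_of_hilb_eq {rs : List R} (hrs : ∀ r ∈ rs, ∃ i, 0 < i ∧ r ∈ 𝒜 i)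
    (hrad : grMaxIdeal 𝒜 ≤ (Ideal.ofList rs).radical) {M N : GrMod 𝒜} (hh : M.hilb = N.hilb)
    (hM : IsWeaklyRegular M.carrier rs) (hN : IsWeaklyRegular N.carrier rs) :
    ∃ φ : M.carrier ≃ₗ[Algebra.adjoin k {x | x ∈ rs}] N.carrier,
      ∀ n x, x ∈ M.deg n ↔ φ x ∈ N.deg n := by
  have hS : IsHomogeneousSubalgebra 𝒜 (Algebra.adjoin k {x | x ∈ rs}) :=
    isHomogeneousSubalgebra_adjoin fun r hr => (hrs r hr).imp fun _ h => h.2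
  obtain ⟨ι, _, d, b, c, hb, hc⟩ := exists_basis_pair hR0 hrs hh hM hN
    (finite_quotient_ofList_smul_top hR0 hrad M.carrier)
  let φ := b.equiv c (Equiv.refl ι)
  refine ⟨φ, fun n x => ⟨fun hx => ?_, fun hx => ?_⟩⟩
  · exact apply_mem_deg_of_basis hS b hb (φ := φ.toLinearMap)
      (fun i => (b.equiv_apply i c _).symm ▸ hc i) hx
  · have hi (i : ι) : φ.symm (c i) ∈ M.deg (d i) :=
      (φ.symm_apply_eq.2 (b.equiv_apply i c (Equiv.refl ι)).symm).symm ▸ hb i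
    have h := apply_mem_deg_of_basis hS c hc (φ := φ.symm.toLinearMap) hi hx
    exact φ.symm_apply_apply x ▸ h

theorem exists_basis_adjoin {rs : List R} (hrs : ∀ r ∈ rs, ∃ i, 0 < i ∧ r ∈ 𝒜 i)
    (hrad : grMaxIdeal 𝒜 ≤ (Ideal.ofList rs).radical) {M : GrMod 𝒜}
    (hM : IsWeaklyRegular M.carrier rs) :
    ∃ (ι : Type) (_ : Finite ι),
      Nonempty (Module.Basis ι (Algebra.adjoin k {x | x ∈ rs}) M.carrier) := by
  obtain ⟨ι, hι, _, b, -⟩ := exists_basis_pair hR0 hrs rfl hM hM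
    (finite_quotient_ofList_smul_top hR0 hrad M.carrier)
  exact ⟨ι, hι, ⟨b⟩⟩

/-- A short exact sequence `0 → X → W → Y → 0` of graded modules and degree-preserving maps. -/
structure IsShortExact {X W Y : GrMod 𝒜} (j : X.carrier →ₗ[R] W.carrier)
    (q : W.carrier →ₗ[R] Y.carrier) : Prop where
  left_mem_hom : j ∈ hom X W
  right_mem_hom : q ∈ hom W Y
  injective : Function.Injective j
  exact : Function.Exact j q
  surjective : Function.Surjective q

theorem exists_coinduced_embedding (hR : IsGradedCM 𝒜 R) {M N X : GrMod 𝒜} (hM : M.IsCM)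
    (hN : N.IsCM) (hX : X.IsCM) (hh : M.hilb = N.hilb) :
    ∃ (W Y : GrMod 𝒜) (j : X.carrier →ₗ[R] W.carrier) (q : W.carrier →ₗ[R] Y.carrier),
      IsShortExact j q ∧ Y.IsCM ∧ ∀ l, M.homDim (W.shift l) = N.homDim (W.shift l) := by
  obtain ⟨rs, hrs, hwR, hw, hrad, hCM⟩ := exists_parameters hR0 hR ((M.prod N).prod X)
    (isGradedCM_prod (isGradedCM_prod hM hN) hX)
  have hwX : IsWeaklyRegular X.carrier rs := isWeaklyRegular_of_leftInverse
    (f := LinearMap.inr R (M.carrier × N.carrier) X.carrier) (g := LinearMap.snd R _ _) rs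
    (fun _ => rfl) hw
  have hwMN : IsWeaklyRegular (M.carrier × N.carrier) rs := isWeaklyRegular_of_leftInverse
    (f := LinearMap.inl R (M.carrier × N.carrier) X.carrier) (g := LinearMap.fst R _ _) rs
    (fun _ => rfl) hw
  have hwM : IsWeaklyRegular M.carrier rs := isWeaklyRegular_of_leftInverse
    (f := LinearMap.inl R M.carrier N.carrier) (g := LinearMap.fst R _ _) rs (fun _ => rfl) hwMN
  have hwN : IsWeaklyRegular N.carrier rs := isWeaklyRegular_of_leftInverse
    (f := LinearMap.inr R M.carrier N.carrier) (g := LinearMap.snd R _ _) rs (fun _ => rfl) hwMN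
  obtain ⟨φ, hφ⟩ := exists_equiv_of_hilb_eq hR0 hrs hrad hh hwM hwN
  have hS : IsHomogeneousSubalgebra 𝒜 (Algebra.adjoin k {x | x ∈ rs}) :=
    isHomogeneousSubalgebra_adjoin fun r hr => (hrs r hr).imp fun _ h => h.2
  obtain ⟨ι, _, ⟨b⟩⟩ := exists_basis_adjoin hR0 hrs hrad (M := GrMod.self 𝒜) hwR
  obtain ⟨ι', _, ⟨c⟩⟩ := exists_basis_adjoin hR0 hrs hrad hwX
  have hSR : Module.Finite (Algebra.adjoin k {x | x ∈ rs}) R := .of_basis b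
  have : Module.Finite (Algebra.adjoin k {x | x ∈ rs}) X.carrier := .of_basis c
  have hfin := Coind.finite (X := X.carrier) b
  let W := coind hS X hSR hfin
  let Y := W.ofQuot _ (isHomogeneous_range (embed_mem_hom hS X hSR hfin))
  have hY : IsWeaklyRegular Y.carrier rs :=
    Coind.isWeaklyRegular_quotient_range_embed b (fun _ hr => Algebra.subset_adjoin hr) hwX
  exact ⟨W, Y, Coind.embed _ X.carrier, Submodule.mkQ _, ⟨embed_mem_hom hS X hSR hfin,
    W.mkQ_mem_hom _ _, (Coind.evalOne_embed _ _).injective, LinearMap.exact_map_mkQ_range _,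
    Submodule.mkQ_surjective _⟩, hCM Y hY, homDim_shift_coind_eq hS X hSR hfin hφ⟩

end NoetherNormalization

end GrMod

end GradedCoinduced

section InternalHom

open Filter

variable {k : Type v} [Field k] {R : Type u} [CommRing R] [Algebra k R]
  {𝒜 : ℕ → Submodule k R}

namespace GrMod

variable {M X W Y : GrMod 𝒜} {j : X.carrier →ₗ[R] W.carrier} {q : W.carrier →ₗ[R] Y.carrier}

theorem mem_deg_of_apply_mem_deg (hj : j ∈ hom X W) (hinj : Function.Injective j) {n : ℤ}
    {x : X.carrier} (hx : j x ∈ W.deg n) : x ∈ X.deg n := by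
  have h : X.proj n x = x := hinj (by rw [← proj_map hj, gradedProj_of_mem hx])
  exact h ▸ gradedProj_mem X.deg n x

/-- Postcomposition with a degree-preserving map. -/
def homMap (M : GrMod 𝒜) (hq : q ∈ hom W Y) : hom M W →ₗ[k] hom M Y :=
  (q.compRight k).restrict fun _ hf n x hx => hq n _ (hf n x hx)

theorem exists_pow_smul_mem {L : Submodule R M.carrier} {r : R}
    (h : ∀ e, ∀ x ∈ M.deg e, ∃ n : ℕ, r ^ n • x ∈ L) (x : M.carrier) : ∃ n : ℕ, r ^ n • x ∈ L := by
  have hmono {x : M.carrier} {m n : ℕ} (hmn : m ≤ n) (hx : r ^ m • x ∈ L) : r ^ n • x ∈ L := by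
    rw [← Nat.sub_add_cancel hmn, pow_add, mul_smul]
    exact L.smul_mem _ hx
  refine homogeneous_induction M.deg (P := fun x => ∃ n : ℕ, r ^ n • x ∈ L) h ?_ x
  rintro x y ⟨m, hm⟩ ⟨n, hn⟩
  exact ⟨max m n, smul_add (r ^ max m n) x y ▸
    L.add_mem (hmono (le_max_left m n) hm) (hmono (le_max_right m n) hn)⟩

theorem exact_homMap (h : IsShortExact j q) :
    Function.Exact (homMap M h.left_mem_hom) (homMap M h.right_mem_hom) := by
  rintro ⟨f, hf⟩
  refine ⟨fun hqf => ?_, ?_⟩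
  · have hrange (x : M.carrier) : f x ∈ Set.range j :=
      (h.exact (f x)).1 (LinearMap.congr_fun (congrArg Subtype.val hqf) x)
    let g := LinearMap.codRestrictOfInjective f j h.injective hrange
    have hg (x : M.carrier) : j (g x) = f x := LinearMap.codRestrictOfInjective_comp_apply ..
    exact ⟨⟨g, fun n x hx => mem_deg_of_apply_mem_deg h.left_mem_hom h.injective
      (hg x ▸ hf n x hx)⟩, Subtype.ext (LinearMap.ext hg)⟩
  · rintro ⟨g, hg⟩
    rw [← hg]
    exact Subtype.ext (LinearMap.ext fun x => h.exact.apply_apply_eq_zero _)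

variable [GradedAlgebra 𝒜] [IsNoetherianRing R]

/-- The graded module `⨁_l Hom(M, Y(l))` of all homomorphisms, in which the maps raising degrees by
`l` have degree `l`. -/
noncomputable def ihom (M Y : GrMod 𝒜) : GrMod 𝒜 where
  carrier := M.carrier →ₗ[R] Y.carrier
  deg := homDeg R M.deg Y.deg
  isInternal := isInternal_homDeg (span_isHomogeneousScalar_eq_top M Y)
  smul_mem i n a f ha hf m x hx := by
    have h := Y.smul_mem i _ a _ ha (hf m x hx)
    rwa [add_assoc] at h

/-- Every homogeneous homomorphism from `M` lifts along `q` up to powers of the homogeneous elements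
of positive degree: the cokernel of `Hom(M, W) → Hom(M, Y)` is `𝔪`-torsion. -/
def LiftsUpToPowers (M : GrMod 𝒜) {W Y : GrMod 𝒜} (q : W.carrier →ₗ[R] Y.carrier) : Prop :=
  ∀ ⦃e : ℤ⦄ ⦃f⦄, f ∈ (M.ihom Y).deg e → ∀ ⦃i r⦄, 0 < i → r ∈ 𝒜 i →
    ∃ n : ℕ, (r ^ n • f : (M.ihom Y).carrier) ∈
      LinearMap.range (q.compRight R : (M.ihom W).carrier →ₗ[R] (M.ihom Y).carrier)

theorem compRight_mem_hom (hq : q ∈ hom W Y) :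
    (q.compRight R : (M.ihom W).carrier →ₗ[R] (M.ihom Y).carrier) ∈ hom (M.ihom W) (M.ihom Y) :=
  fun _ _ hf m x hx => hq _ _ (hf m x hx)

variable (hR0 : Function.Bijective (algebraMap k (𝒜 0)))

include hR0

theorem finite_quotient_of_forall_pow_smul_mem (M : GrMod 𝒜) {L : Submodule R M.carrier}
    (h : ∀ ⦃e x⦄, x ∈ M.deg e → ∀ ⦃i r⦄, 0 < i → r ∈ 𝒜 i → ∃ n : ℕ, r ^ n • x ∈ L) :
    Module.Finite k (M.carrier ⧸ L) := by
  have hrad : grMaxIdeal 𝒜 ≤ (Module.annihilator R (M.carrier ⧸ L)).radical := by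
    rw [grMaxIdeal_eq_span, Ideal.span_le]
    rintro r ⟨i, hi, hr⟩
    have hnil : IsNilpotent (algebraMap R (Module.End R (M.carrier ⧸ L)) r) := by
      refine Module.End.isNilpotent_iff_of_finite.2 fun x => ?_
      obtain ⟨x, rfl⟩ := L.mkQ_surjective x
      obtain ⟨n, hn⟩ := exists_pow_smul_mem (fun e x hx => h hx hi hr) x
      rw [← Submodule.Quotient.mk_eq_zero] at hn
      exact ⟨n, by rwa [← map_pow]⟩
    obtain ⟨n, hn⟩ := hnil
    rw [← map_pow] at hn
    exact ⟨n, Module.mem_annihilator.2 (LinearMap.congr_fun hn)⟩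
  obtain ⟨K, hK⟩ := Ideal.exists_pow_le_of_le_radical_of_fg hrad (IsNoetherian.noetherian _)
  refine finite_of_pow_smul_top_eq_bot 𝒜 hR0 K (eq_bot_iff.2 (Submodule.smul_le.2 ?_))
  exact fun r hr x _ => (Submodule.mem_bot R).2 (Module.mem_annihilator.1 (hK hr) x)

theorem eventually_forall_exists_lift (hq : q ∈ hom W Y) (H : M.LiftsUpToPowers q) :
    ∀ᶠ l in cofinite, ∀ f ∈ (M.ihom Y).deg l, ∃ h ∈ (M.ihom W).deg l, q ∘ₗ h = f := by
  let L := LinearMap.range (q.compRight R : (M.ihom W).carrier →ₗ[R] (M.ihom Y).carrier)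
  let C := (M.ihom Y).ofQuot L (isHomogeneous_range (compRight_mem_hom hq))
  have : Module.Finite k C.carrier := finite_quotient_of_forall_pow_smul_mem hR0 (M.ihom Y) H
  filter_upwards [(finite_setOf_ne_bot_of_isInternal C.isInternal).eventually_cofinite_notMem]
    with l hl f hf
  have hbot : C.deg l = ⊥ := not_not.1 hl
  have hmk : L.mkQ f ∈ C.deg l := (M.ihom Y).mkQ_mem_hom L _ l f hf
  rw [hbot] at hmk
  obtain ⟨h, hh⟩ := (Submodule.Quotient.mk_eq_zero L).1 ((Submodule.mem_bot k).1 hmk)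
  refine ⟨(M.ihom W).proj l h, gradedProj_mem _ _ _, ?_⟩
  exact (proj_map (compRight_mem_hom (M := M) hq) l h).symm.trans
    ((congrArg _ hh).trans (gradedProj_of_mem hf))

theorem homDim_add_homDim (h : IsShortExact j q)
    (hlift : ∀ f ∈ hom M Y, ∃ g ∈ hom M W, q ∘ₗ g = f) :
    M.homDim X + M.homDim Y = M.homDim W := by
  have := M.finite_hom hR0 W
  have hinj : Function.Injective (homMap M h.left_mem_hom) := fun f g hfg =>
    Subtype.ext (LinearMap.ext fun x =>
      h.injective (LinearMap.congr_fun (congrArg Subtype.val hfg) x))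
  have hsurj : Function.Surjective (homMap M h.right_mem_hom) := by
    rintro ⟨f, hf⟩
    obtain ⟨g, hg, rfl⟩ := hlift f hf
    exact ⟨⟨g, hg⟩, rfl⟩
  have hrank := LinearMap.finrank_range_add_finrank_ker (homMap M h.right_mem_hom)
  rw [LinearMap.range_eq_top.2 hsurj, finrank_top, (exact_homMap h).linearMap_ker_eq,
    LinearMap.finrank_range_of_inj hinj, add_comm] at hrank
  exact hrank

theorem eventually_homDim_shift_eq (hR : IsGradedCM 𝒜 R) {M N : GrMod 𝒜} (hM : M.IsCM)
    (hN : N.IsCM) (hh : M.hilb = N.hilb) (hle : M.HomLE N) {X : GrMod 𝒜} (hX : X.IsCM)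
    (H : ∀ ⦃W Y : GrMod 𝒜⦄ ⦃j : X.carrier →ₗ[R] W.carrier⦄ ⦃q : W.carrier →ₗ[R] Y.carrier⦄,
      IsShortExact j q → ∀ L : GrMod 𝒜, L.IsCM → L.LiftsUpToPowers q) :
    ∀ᶠ l in cofinite, M.homDim (X.shift l) = N.homDim (X.shift l) := by
  obtain ⟨W, Y, j, q, hjq, hY, hW⟩ := exists_coinduced_embedding hR0 hR hM hN hX hh
  filter_upwards [eventually_forall_exists_lift hR0 hjq.right_mem_hom (H hjq M hM),
    eventually_forall_exists_lift hR0 hjq.right_mem_hom (H hjq N hN)] with l hliftM hliftN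
  have hshift : IsShortExact (X := X.shift l) (W := W.shift l) (Y := Y.shift l) j q :=
    { hjq with
      left_mem_hom := fun n => hjq.left_mem_hom (n + l)
      right_mem_hom := fun n => hjq.right_mem_hom (n + l) }
  have hdimM := homDim_add_homDim hR0 hshift hliftM
  have hdimN := homDim_add_homDim hR0 hshift hliftN
  have hleX := hle (X.shift l) hX
  have hleY := hle (Y.shift l) hY
  have := hW l
  lia

end GrMod

end InternalHom

section IsolatedSingularity

variable {k : Type v} [Field k] {R : Type u} [CommRing R] [Algebra k R]
  {𝒜 : ℕ → Submodule k R} [GradedAlgebra 𝒜]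

theorem isRegularLocalRing_atPrime_of_homogeneousCompl (p : Ideal R) [p.IsPrime]
    (h : IsRegularRing (Localization (homogeneousCompl 𝒜 p))) :
    IsRegularLocalRing (Localization.AtPrime p) := by
  let S := homogeneousCompl 𝒜 p
  let P := p.map (algebraMap R (Localization S))
  have hdisj : Disjoint (S : Set R) p := Set.disjoint_left.2 fun x hx hxp => hx.2 hxp
  have hprime : P.IsPrime :=
    IsLocalization.isPrime_of_isPrime_disjoint S (Localization S) p ‹_› hdisj
  have hcompl : p.primeCompl = (P.comap (algebraMap R (Localization S))).primeCompl := by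
    ext x
    exact not_congr (IsLocalization.under_map_of_isPrime_disjoint S (Localization S) ‹_› hdisj ▸
      Iff.rfl)
  have hloc : IsLocalization p.primeCompl (Localization.AtPrime P) :=
    hcompl ▸ IsLocalization.isLocalization_atPrime_localization_atPrime S P
  have := h.isRegularLocalRing_localization P
  exact IsRegularLocalRing.of_ringEquiv (IsLocalization.algEquiv p.primeCompl
    (Localization.AtPrime P) (Localization.AtPrime p)).toRingEquiv

theorem exists_isPrime_isHomogeneous_notMem {J : Ideal R} (hJ : J.IsHomogeneous 𝒜) {r : R}
    (hr : r ∉ J.radical) : ∃ p : Ideal R, p.IsPrime ∧ p.IsHomogeneous 𝒜 ∧ J ≤ p ∧ r ∉ p := by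
  rw [Ideal.radical_eq_sInf, Ideal.mem_sInf] at hr
  push Not at hr
  obtain ⟨p, ⟨hJp, hp⟩, hrp⟩ := hr
  refine ⟨(p.homogeneousCore 𝒜).toIdeal, hp.homogeneousCore, (p.homogeneousCore 𝒜).isHomogeneous,
    ?_, fun h => hrp (Ideal.toIdeal_homogeneousCore_le 𝒜 p h)⟩
  exact hJ.toIdeal_homogeneousCore_eq_self.ge.trans (Ideal.homogeneousCore_mono 𝒜 hJp)

namespace GrMod

variable (M : GrMod 𝒜)

theorem proj_smul_of_mem {e : ℤ} {x : M.carrier} (hx : x ∈ M.deg e) (r : R) (i : ℕ) :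
    M.proj (e + i) (r • x) = (DirectSum.decompose 𝒜 r i : R) • x := by
  induction r using DirectSum.Decomposition.inductionOn 𝒜 with
  | zero => simp
  | @homogeneous j a =>
    have hax := M.smul_mem j e a x a.2 hx
    obtain rfl | hij := eq_or_ne j i
    · rw [gradedProj_of_mem hax, DirectSum.decompose_of_mem_same 𝒜 a.2]
    · rw [gradedProj_of_mem_ne hax (by lia), DirectSum.decompose_of_mem_ne 𝒜 a.2 hij, zero_smul]
  | add a b ha hb =>
    rw [add_smul, map_add, ha, hb, DirectSum.decompose_add, ← add_smul]
    rfl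

theorem isHomogeneous_comap_toSpanSingleton {L : Submodule R M.carrier}
    (hL : L.IsHomogeneous M.deg) {e : ℤ} {x : M.carrier} (hx : x ∈ M.deg e) :
    (L.comap (LinearMap.toSpanSingleton R M.carrier x)).IsHomogeneous 𝒜 := by
  intro i a ha
  change (DirectSum.decompose 𝒜 a i : R) • x ∈ L
  rw [← M.proj_smul_of_mem hx]
  exact hL _ ha

variable [IsNoetherianRing R] (hR0 : Function.Bijective (algebraMap k (𝒜 0)))
  (hR : IsGradedCM 𝒜 R)

include hR0 hR

theorem exists_notMem_comp_eq_smul_id_of_isCM {M : GrMod 𝒜} (hM : M.IsCM) (p : Ideal R) [p.IsPrime]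
    [IsRegularLocalRing (Localization.AtPrime p)] :
    ∃ s ∉ p, ∃ (m : ℕ) (j : M.carrier →ₗ[R] (Fin m → R)) (g : (Fin m → R) →ₗ[R] M.carrier),
      g ∘ₗ j = s • LinearMap.id := by
  obtain ⟨rs, hrs, hRr, hMr, hrad, -⟩ := exists_parameters hR0 hR M hM
  let S := Algebra.adjoin k {x | x ∈ rs}
  obtain ⟨ι, _, ⟨b⟩⟩ : ∃ (ι : Type) (_ : Finite ι), Nonempty (Module.Basis ι S R) :=
    exists_basis_adjoin hR0 hrs hrad (M := GrMod.self 𝒜) hRr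
  obtain ⟨ι', _, ⟨b'⟩⟩ := exists_basis_adjoin hR0 hrs hrad hMr
  have : Module.Finite S R := .of_basis b
  have : Module.Projective S R := .of_basis b
  have : Module.Projective S M.carrier := .of_basis b'
  have : Algebra.IsIntegral S R := .of_finite S R
  have := free_localizedModule_of_isRegularLocalRing (S := S) p M.carrier
  exact exists_notMem_comp_eq_smul_id p

theorem liftsUpToPowers_of_isGradedIsolatedSingularity (hiso : IsGradedIsolatedSingularity 𝒜)
    {M W Y : GrMod 𝒜} (hM : M.IsCM) {q : W.carrier →ₗ[R] Y.carrier} (hq : q ∈ hom W Y)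
    (hsurj : Function.Surjective q) : M.LiftsUpToPowers q := by
  intro e (f : M.carrier →ₗ[R] Y.carrier) hf i r hi hr
  let J : Ideal R := (LinearMap.range
    (q.compRight R : (M.ihom W).carrier →ₗ[R] (M.ihom Y).carrier)).comap
      (LinearMap.toSpanSingleton R (M.ihom Y).carrier f)
  suffices h : r ∈ J.radical from h
  by_contra hrJ
  have hJ : J.IsHomogeneous 𝒜 := (M.ihom Y).isHomogeneous_comap_toSpanSingleton
    (isHomogeneous_range (compRight_mem_hom hq)) hf
  obtain ⟨p, _, hp, hJp, hrp⟩ := exists_isPrime_isHomogeneous_notMem hJ hrJ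
  have hpm : p ≠ grMaxIdeal 𝒜 := fun h => hrp (h ▸ mem_grMaxIdeal_of_mem 𝒜 hi hr)
  have := isRegularLocalRing_atPrime_of_homogeneousCompl p (hiso p hp hpm)
  obtain ⟨s, hs, m, j, g, hgj⟩ := exists_notMem_comp_eq_smul_id_of_isCM hR0 hR hM p
  obtain ⟨h, hh⟩ := Module.projective_lifting_property q (f ∘ₗ g) hsurj
  have hlift : q ∘ₗ h ∘ₗ j = s • f := by
    rw [← LinearMap.comp_assoc, hh, LinearMap.comp_assoc, hgj, LinearMap.comp_smul,
      LinearMap.comp_id]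
  exact hs (hJp ⟨h ∘ₗ j, hlift⟩)

end GrMod

end IsolatedSingularity

section LocalSplitting

variable {R : Type*} [CommRing R] {X E M T : Type*} [AddCommGroup X] [AddCommGroup E]
  [AddCommGroup M] [AddCommGroup T] [Module R X] [Module R E] [Module R M] [Module R T]

theorem linearMap_mem_smul_top {ι : Type*} [Finite ι] {I : Ideal R} {f : (ι → R) →ₗ[R] X}
    (hf : ∀ y, f y ∈ I • (⊤ : Submodule R X)) : f ∈ I • (⊤ : Submodule R ((ι → R) →ₗ[R] X)) := by
  classical
  have := Fintype.ofFinite ι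
  let c (a : ι) : X →ₗ[R] (ι → R) →ₗ[R] X :=
    LinearMap.smulRightₗ (LinearMap.proj a : (ι → R) →ₗ[R] R)
  have hsum : f = ∑ a, c a (f (Pi.single a 1)) := by
    refine LinearMap.pi_ext' fun b => LinearMap.ext_ring ?_
    simp [c, Pi.single_apply]
  rw [hsum]
  refine Submodule.sum_mem _ fun a _ => ?_
  have hmap := Submodule.mem_map_of_mem (f := c a) (hf (Pi.single a 1))
  rw [Submodule.map_smul''] at hmap
  exact Submodule.smul_mono le_rfl le_top hmap

variable [IsNoetherianRing R]

theorem exists_one_sub_smul_mem_of_forall_mem_sup [Module.Finite R X] (I : Ideal R)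
    {U : Submodule R X} {x : X} (h : ∀ n : ℕ, x ∈ U ⊔ I ^ n • ⊤) : ∃ r ∈ I, (1 - r) • x ∈ U := by
  have hx : U.mkQ x ∈ (⨅ n : ℕ, I ^ n • ⊤ : Submodule R (X ⧸ U)) := by
    refine Submodule.mem_iInf _ |>.2 fun n => ?_
    rw [← map_mkQ_smul_top, ← Submodule.mem_comap, Submodule.comap_map_mkQ]
    exact h n
  obtain ⟨⟨r, hr⟩, hrx⟩ := (I.mem_iInf_smul_pow_eq_bot_iff _).1 hx
  refine ⟨r, hr, (Submodule.Quotient.mk_eq_zero U).1 ?_⟩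
  rw [sub_smul, one_smul, Submodule.Quotient.mk_sub, sub_eq_zero]
  exact hrx.symm

theorem exists_exact_fin_pi [Module.Finite R M] : ∃ (m n : ℕ) (τ : (Fin m → R) →ₗ[R] (Fin n → R))
    (π : (Fin n → R) →ₗ[R] M), Function.Exact τ π ∧ Function.Surjective π := by
  obtain ⟨n, π, hπ⟩ := Module.Finite.exists_fin' R M
  obtain ⟨m, τ, hτ⟩ := Module.Finite.exists_fin' R π.ker
  refine ⟨m, n, π.ker.subtype ∘ₗ τ, π, LinearMap.exact_iff.2 ?_, hπ⟩
  rw [LinearMap.range_comp_of_range_eq_top _ (LinearMap.range_eq_top.2 hτ), Submodule.range_subtype]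

theorem exists_comp_eq_one_sub_smul_id [Module.Finite R X] [Module.Finite R M] (I : Ideal R)
    {i : X →ₗ[R] E} {p : E →ₗ[R] M} (hi : Function.Injective i) (hex : Function.Exact i p)
    (hp : Function.Surjective p)
    (h : ∀ n : ℕ, ∃ v : E →ₗ[R] X ⧸ I ^ n • (⊤ : Submodule R X), v ∘ₗ i = Submodule.mkQ _) :
    ∃ r ∈ I, ∃ σ : M →ₗ[R] E, p ∘ₗ σ = (1 - r) • LinearMap.id := by
  obtain ⟨a, b, τ, π, hτπ, hπ⟩ := exists_exact_fin_pi (R := R) (M := M)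
  obtain ⟨G, hG⟩ := Module.projective_lifting_property p π hp
  have hpGτ (y) : p (G (τ y)) = 0 :=
    (LinearMap.congr_fun hG _).trans (hτπ.apply_apply_eq_zero y)
  let θ := LinearMap.codRestrictOfInjective (G ∘ₗ τ) i hi fun y => (hex _).1 (hpGτ y)
  have hθ (y) : i (θ y) = G (τ y) := LinearMap.codRestrictOfInjective_comp_apply ..
  have hmem (n : ℕ) : θ ∈ LinearMap.range (LinearMap.lcomp R X τ) ⊔ I ^ n • ⊤ := by
    obtain ⟨v, hv⟩ := h n
    obtain ⟨φ, hφ⟩ := Module.projective_lifting_property _ (v ∘ₗ G) (Submodule.mkQ_surjective _)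
    refine Submodule.mem_sup.2 ⟨φ ∘ₗ τ, ⟨φ, rfl⟩, θ - φ ∘ₗ τ, linearMap_mem_smul_top fun y => ?_,
      add_sub_cancel _ _⟩
    have hφτ := LinearMap.congr_fun hφ (τ y)
    have hvθ := LinearMap.congr_fun hv (θ y)
    rw [LinearMap.comp_apply, LinearMap.comp_apply] at hφτ
    rw [LinearMap.comp_apply, hθ, ← hφτ] at hvθ
    exact (Submodule.Quotient.eq _).1 hvθ.symm
  obtain ⟨r, hr, φ, hφ⟩ := exists_one_sub_smul_mem_of_forall_mem_sup I hmem
  have hzero : ((1 - r) • G - i ∘ₗ φ) ∘ₗ τ = 0 := by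
    refine LinearMap.ext fun y => ?_
    have hφy : φ (τ y) = (1 - r) • θ y := LinearMap.congr_fun hφ y
    simp [hφy, hθ]
  obtain ⟨σ, hσ⟩ := (LinearMap.exact_lcomp_of_exact_of_surjective E hτπ hπ
    ((1 - r) • G - i ∘ₗ φ)).1 hzero
  refine ⟨r, hr, σ, (LinearMap.cancel_right hπ).1 ?_⟩
  rw [LinearMap.lcomp_apply'] at hσ
  rw [LinearMap.comp_assoc, hσ, LinearMap.comp_sub, LinearMap.comp_smul, hG, ← LinearMap.comp_assoc,
    hex.linearMap_comp_eq_zero, LinearMap.zero_comp, sub_zero, LinearMap.smul_comp,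
    LinearMap.id_comp]

end LocalSplitting

section HomCount

variable {k : Type*} [Field k] {R : Type*} [CommRing R] [Algebra k R] {X E M T : Type*}
  [AddCommGroup X] [AddCommGroup E] [AddCommGroup M] [AddCommGroup T] [Module R X] [Module R E]
  [Module R M] [Module R T] [Module k T] [IsScalarTower k R T]

section

variable [Module.Finite k T]

theorem finite_linearMap_of_finite [Module.Finite R X] : Module.Finite k (X →ₗ[R] T) := by
  obtain ⟨m, g, hg⟩ := Module.Finite.exists_fin' R X
  have := Module.Finite.equiv ((Pi.basisFun R (Fin m)).constr k (M' := T))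
  exact Module.Finite.of_injective _
    (LinearMap.lcomp_injective_of_surjective (S := k) (N := T) g hg)

theorem finrank_linearMap_add_finrank_range_lcomp [Module.Finite R E] {i : X →ₗ[R] E}
    {p : E →ₗ[R] M} (hex : Function.Exact i p) (hp : Function.Surjective p) :
    Module.finrank k (M →ₗ[R] T) + Module.finrank k (LinearMap.range (LinearMap.lcomp k T i)) =
      Module.finrank k (E →ₗ[R] T) := by
  have := finite_linearMap_of_finite (k := k) (R := R) (X := E) (T := T)
  have hker : LinearMap.ker (LinearMap.lcomp k T i) = LinearMap.range (LinearMap.lcomp k T p) :=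
    LinearMap.exact_iff.1 (LinearMap.exact_lcomp_of_exact_of_surjective T hex hp)
  have hrank := LinearMap.finrank_range_add_finrank_ker (LinearMap.lcomp k T i)
  rwa [hker, LinearMap.finrank_range_of_inj (LinearMap.lcomp_injective_of_surjective p hp),
    add_comm] at hrank

theorem finrank_linearMap_prod [Module.Finite R X] [Module.Finite R E] :
    Module.finrank k (X × E →ₗ[R] T) =
      Module.finrank k (X →ₗ[R] T) + Module.finrank k (E →ₗ[R] T) := by
  have := finite_linearMap_of_finite (k := k) (R := R) (X := X) (T := T)
  have := finite_linearMap_of_finite (k := k) (R := R) (X := E) (T := T)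
  rw [← (LinearMap.coprodEquiv k (R := R) (M := X) (M₂ := E) (M₃ := T)).finrank_eq,
    Module.finrank_prod]

end

theorem exists_comp_eq_of_exact_prod [Module.Finite R X] [Module.Finite R E]
    {i : X →ₗ[R] E} {a : R} {ψ : X × E →ₗ[R] E}
    (hex : Function.Exact ((a • LinearMap.id).prod i) ψ) (hψ : Function.Surjective ψ)
    (k : Type*) [Field k] [Algebra k R] [Module k T] [IsScalarTower k R T] [Module.Finite k T]
    {n : ℕ} (ha : ∀ y : T, a ^ n • y = 0) (t : X →ₗ[R] T) : ∃ s : E →ₗ[R] T, s ∘ₗ i = t := by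
  have := finite_linearMap_of_finite (k := k) (R := R) (X := X) (T := T)
  have hrank := finrank_linearMap_add_finrank_range_lcomp (k := k) (T := T) hex hψ
  rw [finrank_linearMap_prod, add_comm] at hrank
  have hsurj := LinearMap.range_eq_top.1
    (Submodule.eq_top_of_finrank_eq (Nat.add_right_cancel hrank))
  have hstep (t : X →ₗ[R] T) : ∃ (s₁ : X →ₗ[R] T) (s₂ : E →ₗ[R] T), t = a • s₁ + s₂ ∘ₗ i := by
    obtain ⟨s, rfl⟩ := hsurj t
    refine ⟨s ∘ₗ LinearMap.inl R X E, s ∘ₗ LinearMap.inr R X E, LinearMap.ext fun x => ?_⟩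
    simp [← map_smul, ← map_add]
  have hiterate (m : ℕ) : ∃ (s₁ : X →ₗ[R] T) (s₂ : E →ₗ[R] T), t = a ^ m • s₁ + s₂ ∘ₗ i := by
    induction m with
    | zero => exact ⟨t, 0, by simp⟩
    | succ m ih =>
      obtain ⟨s₁, s₂, hs⟩ := ih
      obtain ⟨s₁', s₂', rfl⟩ := hstep s₁
      refine ⟨s₁', a ^ m • s₂' + s₂, ?_⟩
      rw [hs, smul_add, smul_smul, ← pow_succ, LinearMap.add_comp, LinearMap.smul_comp, add_assoc]
  obtain ⟨s₁, s₂, hs⟩ := hiterate n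
  exact ⟨s₂, LinearMap.ext fun x => by simp [hs, ha]⟩

end HomCount

section Pullback

variable {R : Type*} [CommRing R] {M X W Y : Type*} [AddCommGroup M] [AddCommGroup X]
  [AddCommGroup W] [AddCommGroup Y] [Module R M] [Module R X] [Module R W] [Module R Y]

/-- The pullback `M ×_Y W` of two linear maps, as a submodule of `M × W`. -/
def pullback (g : M →ₗ[R] Y) (q : W →ₗ[R] Y) : Submodule R (M × W) :=
  (g ∘ₗ LinearMap.fst R M W).eqLocus (q ∘ₗ LinearMap.snd R M W)

/-- The projection `M ×_Y W → M` of the pullback. -/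
def pullbackFst (g : M →ₗ[R] Y) (q : W →ₗ[R] Y) : pullback g q →ₗ[R] M :=
  LinearMap.fst R M W ∘ₗ (pullback g q).subtype

variable {g : M →ₗ[R] Y} {q : W →ₗ[R] Y} {j : X →ₗ[R] W}

theorem mem_pullback {z : M × W} : z ∈ pullback g q ↔ g z.1 = q z.2 := Iff.rfl

/-- The inclusion `X → M ×_Y W` of the kernel of the projection to `M`, where `j : X → W` is the
kernel of `q : W → Y`. -/
def pullbackInl (g : M →ₗ[R] Y) (hjq : Function.Exact j q) : X →ₗ[R] pullback g q :=
  LinearMap.codRestrict _ (LinearMap.inr R M W ∘ₗ j) fun x => by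
    simp [mem_pullback, hjq.apply_apply_eq_zero]

/-- The map `X × (M ×_Y W) → M ×_Y W` from the pullback along `g` to the pullback along `a • g`
with components `(m, w) ↦ (m, a • w)` and `x ↦ (0, - j x)`. -/
def pullbackSmul (g : M →ₗ[R] Y) (hjq : Function.Exact j q) (a : R) :
    X × pullback g q →ₗ[R] pullback (a • g) q :=
  LinearMap.codRestrict _
    ((LinearMap.id.prodMap (a • LinearMap.id)) ∘ₗ (pullback g q).subtype ∘ₗ LinearMap.snd R X _ -
      LinearMap.inr R M W ∘ₗ j ∘ₗ LinearMap.fst R X _) fun z => by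
    simpa [mem_pullback, hjq.apply_apply_eq_zero] using congrArg (a • ·) (mem_pullback.1 z.2.2)

theorem pullbackInl_injective (hjq : Function.Exact j q) (hj : Function.Injective j) :
    Function.Injective (pullbackInl g hjq) := fun _ _ h =>
  hj (congrArg (fun z : pullback g q => z.1.2) h)

theorem pullbackFst_surjective (hq : Function.Surjective q) :
    Function.Surjective (pullbackFst g q) := fun m =>
  let ⟨w, hw⟩ := hq (g m)
  ⟨⟨(m, w), hw.symm⟩, rfl⟩

theorem exact_pullbackInl_pullbackFst (hjq : Function.Exact j q) :
    Function.Exact (pullbackInl g hjq) (pullbackFst g q) := by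
  rintro ⟨⟨m, w⟩, hz : g m = q w⟩
  constructor
  · rintro (rfl : m = 0)
    obtain ⟨x, rfl⟩ := (hjq w).1 (hz.symm.trans (map_zero g))
    exact ⟨x, rfl⟩
  · rintro ⟨x, hx⟩
    exact (congrArg (fun z : pullback g q => z.1.1) hx).symm

theorem pullbackSmul_surjective (hjq : Function.Exact j q) (hq : Function.Surjective q) (a : R) :
    Function.Surjective (pullbackSmul g hjq a) := by
  rintro ⟨⟨m, w⟩, hz : a • g m = q w⟩
  obtain ⟨w', hw'⟩ := hq (g m)
  obtain ⟨x, hx⟩ := (hjq (a • w' - w)).1 (by rw [map_sub, map_smul, hw', hz, sub_self])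
  refine ⟨(x, ⟨(m, w'), hw'.symm⟩), Subtype.ext (Prod.ext (sub_zero m) ?_)⟩
  exact (congrArg (a • w' - ·) hx).trans (sub_sub_cancel _ _)

theorem exact_prod_pullbackInl_pullbackSmul (hjq : Function.Exact j q)
    (hj : Function.Injective j) (a : R) :
    Function.Exact ((a • LinearMap.id).prod (pullbackInl g hjq)) (pullbackSmul g hjq a) := by
  rintro ⟨x, ⟨⟨m, w⟩, hz : g m = q w⟩⟩
  constructor
  · intro h
    have hm : m - 0 = 0 := congrArg (fun z : pullback (a • g) q => z.1.1) h
    have hw : a • w - j x = 0 := congrArg (fun z : pullback (a • g) q => z.1.2) h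
    obtain rfl : m = 0 := by rwa [sub_zero] at hm
    obtain ⟨y, rfl⟩ := (hjq w).1 (hz.symm.trans (map_zero g))
    exact ⟨y, Prod.ext (hj ((map_smul j a y).trans (sub_eq_zero.1 hw))) rfl⟩
  · rintro ⟨y, hy⟩
    obtain rfl : a • y = x := congrArg Prod.fst hy
    obtain ⟨rfl, rfl⟩ :=
      Prod.mk.inj (congrArg (fun z : X × pullback g q => (z.2 : M × W)) hy)
    refine Subtype.ext (Prod.ext (sub_zero 0) ?_)
    exact sub_eq_zero.2 (map_smul j a y).symm

theorem exists_comp_eq_one_sub_smul_of_pullback_equiv [IsNoetherianRing R] [Module.Finite R M]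
    [Module.Finite R X] [Module.Finite R W] (hj : Function.Injective j)
    (hjq : Function.Exact j q) (hq : Function.Surjective q) {I : Ideal R} {a : R} (ha : a ∈ I)
    (e : pullback g q ≃ₗ[R] pullback (a • g) q) (k : Type*) [Field k] [Algebra k R] [Module k X]
    [IsScalarTower k R X] (hfin : ∀ n : ℕ, Module.Finite k (X ⧸ I ^ n • (⊤ : Submodule R X))) :
    ∃ r ∈ I, ∃ h : M →ₗ[R] W, q ∘ₗ h = (1 - r) • g := by
  have hsplit (n : ℕ) : ∃ v : pullback g q →ₗ[R] X ⧸ I ^ n • (⊤ : Submodule R X),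
      v ∘ₗ pullbackInl g hjq = Submodule.mkQ _ := by
    have hexact : Function.Exact ((a • LinearMap.id).prod (pullbackInl g hjq))
        (e.symm.toLinearMap ∘ₗ pullbackSmul g hjq a) :=
      (exact_prod_pullbackInl_pullbackSmul hjq hj a).comp_injective e.symm e.symm.injective
        (map_zero e.symm)
    refine exists_comp_eq_of_exact_prod hexact
      (e.symm.surjective.comp (pullbackSmul_surjective hjq hq a)) k (n := n) (fun y => ?_) _
    obtain ⟨x, rfl⟩ := Submodule.mkQ_surjective _ y
    rw [← map_smul]
    exact (Submodule.Quotient.mk_eq_zero _).2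
      (Submodule.smul_mem_smul (Ideal.pow_mem_pow ha n) Submodule.mem_top)
  obtain ⟨r, hr, σ, hσ⟩ := exists_comp_eq_one_sub_smul_id I (pullbackInl_injective hjq hj)
    (exact_pullbackInl_pullbackFst hjq) (pullbackFst_surjective hq) hsplit
  refine ⟨r, hr, LinearMap.snd R M W ∘ₗ (pullback g q).subtype ∘ₗ σ, LinearMap.ext fun m => ?_⟩
  have hm : (σ m).1.1 = (1 - r) • m := LinearMap.congr_fun hσ m
  exact (mem_pullback.1 (σ m).2).symm.trans ((congrArg g hm).trans (map_smul g _ m))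

end Pullback

section GeneratorCount

theorem exists_linearMap_quotient_ne_zero {R : Type*} [CommRing R] (I : Ideal R) [I.IsMaximal]
    {M : Type*} [AddCommGroup M] [Module R M] (h : I • (⊤ : Submodule R M) ≠ ⊤) :
    ∃ φ : M →ₗ[R] R ⧸ I, φ ≠ 0 := by
  let := Ideal.Quotient.field I
  obtain ⟨x, hx⟩ := SetLike.exists_not_mem_of_ne_top _ h rfl
  obtain ⟨φ, hφ⟩ := not_forall.1 <|
    (Module.forall_dual_apply_eq_zero_iff (R ⧸ I) (Submodule.Quotient.mk x)).not.2
      ((Submodule.Quotient.mk_eq_zero (I • ⊤)).not.2 hx)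
  exact ⟨φ.restrictScalars R ∘ₗ Submodule.mkQ _, fun h0 => hφ (LinearMap.congr_fun h0 x)⟩

variable {k : Type v} [Field k] {R : Type u} [CommRing R] [Algebra k R]
  (𝒜 : ℕ → Submodule k R) [GradedAlgebra 𝒜]

/-- The minimal number of generators of a graded module `E`, computed as the dimension of the
dual `Hom_R(E, R/𝔪)` of `E/𝔪E`. -/
noncomputable def genCount (E : Type*) [AddCommGroup E] [Module R E] : ℕ :=
  Module.finrank k (E →ₗ[R] R ⧸ grMaxIdeal 𝒜)

theorem genCount_congr {E E' : Type*} [AddCommGroup E] [AddCommGroup E'] [Module R E]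
    [Module R E'] (e : E ≃ₗ[R] E') : genCount 𝒜 E = genCount 𝒜 E' :=
  (LinearEquiv.congrLeft (R ⧸ grMaxIdeal 𝒜) k e).finrank_eq

variable (hR0 : Function.Bijective (algebraMap k (𝒜 0)))

include hR0

theorem finite_quotient_grMaxIdeal : Module.Finite k (R ⧸ grMaxIdeal 𝒜) := by
  refine .of_surjective (Algebra.linearMap k (R ⧸ grMaxIdeal 𝒜)) fun a => ?_
  obtain ⟨a, rfl⟩ := Ideal.Quotient.mk_surjective a
  obtain ⟨c, hc⟩ := exists_sub_mem_grMaxIdeal 𝒜 hR0 a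
  exact ⟨c, ((Ideal.Quotient.mk_eq_mk_iff_sub_mem _ _).2 hc).symm⟩

theorem genCount_prod {X E : Type*} [AddCommGroup X] [AddCommGroup E] [Module R X] [Module R E]
    [Module.Finite R X] [Module.Finite R E] :
    genCount 𝒜 (X × E) = genCount 𝒜 X + genCount 𝒜 E :=
  have := finite_quotient_grMaxIdeal 𝒜 hR0
  finrank_linearMap_prod

theorem genCount_le_add {X E M : Type*} [AddCommGroup X] [AddCommGroup E] [AddCommGroup M]
    [Module R X] [Module R E] [Module R M] [Module.Finite R X] [Module.Finite R E]
    {i : X →ₗ[R] E} {p : E →ₗ[R] M} (hex : Function.Exact i p) (hp : Function.Surjective p) :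
    genCount 𝒜 E ≤ genCount 𝒜 X + genCount 𝒜 M := by
  have := finite_quotient_grMaxIdeal 𝒜 hR0
  have := finite_linearMap_of_finite (k := k) (R := R) (X := X) (T := R ⧸ grMaxIdeal 𝒜)
  have hrank :=
    finrank_linearMap_add_finrank_range_lcomp (k := k) (T := R ⧸ grMaxIdeal 𝒜) hex hp
  have hle := Submodule.finrank_le
    (LinearMap.range (LinearMap.lcomp k (R ⧸ grMaxIdeal 𝒜) i))
  unfold genCount
  lia

theorem GrMod.genCount_pos (M : GrMod 𝒜) [Nontrivial M.carrier] : 0 < genCount 𝒜 M.carrier := by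
  have := finite_quotient_grMaxIdeal 𝒜 hR0
  have := finite_linearMap_of_finite (k := k) (R := R) (X := M.carrier) (T := R ⧸ grMaxIdeal 𝒜)
  have := grMaxIdeal_isMaximal 𝒜 hR0
  have hne : grMaxIdeal 𝒜 • (⊤ : Submodule R M.carrier) ≠ ⊤ := fun h =>
    not_subsingleton _ (M.subsingleton_of_smul_top_eq_top h)
  obtain ⟨φ, hφ⟩ := exists_linearMap_quotient_ne_zero _ hne
  exact Module.finrank_pos_iff_exists_ne_zero.2 ⟨φ, hφ⟩

end GeneratorCount

section FiniteRepType

variable {k : Type v} [Field k] {R : Type u} [CommRing R] [IsNoetherianRing R] [Algebra k R]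
  {𝒜 : ℕ → Submodule k R} [GradedAlgebra 𝒜]

namespace GrMod

variable {E M X W Y : GrMod 𝒜} {j : X.carrier →ₗ[R] W.carrier} {q : W.carrier →ₗ[R] Y.carrier}

theorem isCM_ofSub_of_isCompl (hE : E.IsCM) {A C : Submodule R E.carrier}
    (hA : A.IsHomogeneous E.deg) (hAC : IsCompl A C) : (E.ofSub A hA).IsCM :=
  isGradedCM_of_leftInverse (f := A.subtype) (g := A.projectionOnto C hAC)
    (Submodule.projectionOnto_apply_left hAC) hE

theorem IsCM.exists_equiv_prod_of_not_indecomposable [Nontrivial E.carrier] (hE : E.IsCM)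
    (h : ¬ E.Indecomposable) : ∃ A C : GrMod 𝒜, A.IsCM ∧ C.IsCM ∧ Nontrivial A.carrier ∧
      Nontrivial C.carrier ∧ Nonempty (E.carrier ≃ₗ[R] A.carrier × C.carrier) := by
  rw [Indecomposable, and_iff_right ‹_›] at h
  push Not at h
  obtain ⟨A, C, hA, hC, hAC, hA0, hC0⟩ := h
  exact ⟨E.ofSub A hA.isHomogeneous, E.ofSub C hC.isHomogeneous, isCM_ofSub_of_isCompl hE _ hAC,
    isCM_ofSub_of_isCompl hE _ hAC.symm, Submodule.nontrivial_iff_ne_bot.2 hA0,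
    Submodule.nontrivial_iff_ne_bot.2 hC0, ⟨(Submodule.prodEquivOfIsCompl A C hAC).symm⟩⟩

/-- The pullback of `g` and `q` as a graded module, for a degree-preserving `q` and a homogeneous
map `g` of degree `c`. -/
noncomputable def gradedPullback {c : ℤ} {g : M.carrier →ₗ[R] Y.carrier}
    (hg : g ∈ (M.ihom Y).deg c) (hq : q ∈ hom W Y) : GrMod 𝒜 :=
  (M.prod (W.shift c)).ofSub (pullback g q) <| by
    let d : (M.prod (W.shift c)).carrier →ₗ[R] (Y.shift c).carrier :=
      g ∘ₗ LinearMap.fst R M.carrier W.carrier - q ∘ₗ LinearMap.snd R M.carrier W.carrier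
    have hd : d ∈ hom (M.prod (W.shift c)) (Y.shift c) := fun n x hx =>
      (Y.deg (n + c)).sub_mem (hg n x.1 hx.1) (hq (n + c) x.2 hx.2)
    have hker : pullback g q = LinearMap.ker d := LinearMap.eqLocus_eq_ker_sub _ _
    exact hker ▸ isHomogeneous_ker hd

variable (hR0 : Function.Bijective (algebraMap k (𝒜 0)))

include hR0

theorem exists_finite_representatives (hfin : IsGradedFiniteRepType 𝒜) (B : ℕ) :
    ∃ s : Set (ModuleCat.{u} R), s.Finite ∧ ∀ E : GrMod 𝒜, E.IsCM →
      genCount 𝒜 E.carrier < B → ∃ G ∈ s, Nonempty (E.carrier ≃ₗ[R] G) := by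
  obtain ⟨r, Y, hY⟩ := hfin
  induction B with
  | zero => exact ⟨∅, Set.finite_empty, by simp⟩
  | succ B ih =>
    obtain ⟨s, hs, hG⟩ := ih
    refine ⟨{ModuleCat.of R PUnit} ∪ Set.range (fun i => ModuleCat.of R (Y i).carrier) ∪
      Set.image2 (fun G G' : ModuleCat.{u} R => ModuleCat.of R (G × G')) s s,
      ((Set.finite_singleton _).union (Set.finite_range _)).union (hs.image2 _ hs),
      fun E hE hEB => ?_⟩
    obtain hsub | hnt := subsingleton_or_nontrivial E.carrier
    · exact ⟨_, .inl (.inl rfl), ⟨⟨0, 0, fun _ => Subsingleton.elim _ _, fun _ => rfl⟩⟩⟩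
    by_cases hind : E.Indecomposable
    · obtain ⟨i, _, e, -⟩ := hY E hE hind
      exact ⟨_, .inl (.inr ⟨i, rfl⟩), ⟨e⟩⟩
    · obtain ⟨A, C, hA, hC, hA0, hC0, ⟨e⟩⟩ := hE.exists_equiv_prod_of_not_indecomposable hind
      have hAC := (genCount_congr 𝒜 e).trans (genCount_prod 𝒜 hR0)
      have hApos := A.genCount_pos 𝒜 hR0
      have hCpos := C.genCount_pos 𝒜 hR0
      obtain ⟨G, hGs, ⟨eA⟩⟩ := hG A hA (by lia)
      obtain ⟨G', hGs', ⟨eC⟩⟩ := hG C hC (by lia)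
      exact ⟨_, .inr ⟨G, hGs, G', hGs', rfl⟩, ⟨e.trans (eA.prodCongr eC)⟩⟩

theorem finite_quotient_grMaxIdeal_pow_smul_top (M : GrMod 𝒜) (n : ℕ) :
    Module.Finite k (M.carrier ⧸ grMaxIdeal 𝒜 ^ n • (⊤ : Submodule R M.carrier)) := by
  refine finite_of_pow_smul_top_eq_bot 𝒜 hR0 n ?_
  rw [← map_mkQ_smul_top, Submodule.mkQ_map_self]

theorem exists_lift_of_pullback_equiv (h : IsShortExact j q) {c : ℤ}
    {g : M.carrier →ₗ[R] Y.carrier} (hg : g ∈ (M.ihom Y).deg c) {a : R} (ha : a ∈ grMaxIdeal 𝒜)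
    (e : pullback g q ≃ₗ[R] pullback (a • g) q) :
    g ∈ LinearMap.range (q.compRight R : (M.carrier →ₗ[R] W.carrier) →ₗ[R] _) := by
  let L := LinearMap.range (q.compRight R : (M.ihom W).carrier →ₗ[R] (M.ihom Y).carrier)
  let J : Ideal R := L.comap (LinearMap.toSpanSingleton R (M.ihom Y).carrier g)
  have hJ : J.IsHomogeneous 𝒜 := (M.ihom Y).isHomogeneous_comap_toSpanSingleton
    (isHomogeneous_range (compRight_mem_hom h.right_mem_hom)) hg
  obtain ⟨r, hr, f, hf⟩ := exists_comp_eq_one_sub_smul_of_pullback_equiv h.injective h.exact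
    h.surjective ha e k (finite_quotient_grMaxIdeal_pow_smul_top hR0 X)
  have hrJ : 1 - r ∈ J := ⟨f, hf⟩
  have htop : J = ⊤ := by
    by_contra hne
    have hmem := le_grMaxIdeal_of_isHomogeneous 𝒜 hR0 hJ hne hrJ
    exact grMaxIdeal_ne_top 𝒜 hR0 ((Ideal.eq_top_iff_one _).2
      (sub_add_cancel 1 r ▸ Ideal.add_mem _ hmem hr))
  obtain ⟨f, hf⟩ := (htop ▸ Submodule.mem_top : (1 : R) ∈ J)
  exact ⟨f, hf.trans (one_smul R g)⟩

theorem liftsUpToPowers_of_isGradedFiniteRepType (hfin : IsGradedFiniteRepType 𝒜) (hM : M.IsCM)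
    (hX : X.IsCM) (h : IsShortExact j q) : M.LiftsUpToPowers q := by
  intro c (f : M.carrier →ₗ[R] Y.carrier) hf i r hi hr
  have hdeg (n : ℕ) : r ^ n • f ∈ (M.ihom Y).deg (c + (n • i : ℕ)) :=
    (M.ihom Y).smul_mem _ _ _ f (SetLike.pow_mem_graded n hr) hf
  obtain ⟨s, hs, hG⟩ := exists_finite_representatives hR0 hfin
    (genCount 𝒜 X.carrier + genCount 𝒜 M.carrier + 1)
  have hrep (n : ℕ) : ∃ G ∈ s, Nonempty (pullback (r ^ n • f) q ≃ₗ[R] G) :=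
    hG (gradedPullback (hdeg n) h.right_mem_hom)
      (isGradedCM_of_exact (pullbackInl_injective h.exact h.injective)
        (exact_pullbackInl_pullbackFst h.exact) (pullbackFst_surjective h.surjective) hX hM)
      (Nat.lt_succ_of_le (genCount_le_add 𝒜 hR0
        (exact_pullbackInl_pullbackFst h.exact) (pullbackFst_surjective h.surjective)))
  choose G hGs e using hrep
  obtain ⟨n, m, hnm, hG'⟩ := hs.exists_lt_map_eq_of_forall_mem hGs
  obtain ⟨e₁⟩ := e n
  obtain ⟨e₂⟩ := e m
  have hpow : r ^ m • f = r ^ (m - n) • r ^ n • f := by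
    rw [smul_smul, ← pow_add, Nat.sub_add_cancel hnm.le]
  rw [← hG', hpow] at e₂
  exact ⟨n, exists_lift_of_pullback_equiv hR0 h (hdeg n) (Ideal.pow_mem_of_mem _
    (mem_grMaxIdeal_of_mem 𝒜 hi hr) (m - n) (Nat.sub_pos_of_lt hnm)) (e₁.trans e₂.symm)⟩

end GrMod

end FiniteRepType

section HomDim

open Filter

variable {k : Type v} [Field k] {R : Type u} [CommRing R] [Algebra k R]
  {𝒜 : ℕ → Submodule k R}

namespace GrMod

variable {X X' : GrMod 𝒜}

theorem homDim_congr (M : GrMod 𝒜) (h : X.Iso X') : M.homDim X = M.homDim X' := by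
  obtain ⟨e, he⟩ := h
  have h : hom M X = (hom M X').comap (e.congrRight.restrictScalars k).toLinearMap :=
    Submodule.ext fun f => forall₃_congr fun n x _ => he n (f x)
  rw [homDim, h]
  exact (LinearEquiv.ofSubmodule' _ _).finrank_eq

theorem IsCM.of_iso [GradedAlgebra 𝒜] (hX : X.IsCM) (h : X.Iso X') : X'.IsCM :=
  let ⟨e, _⟩ := h
  isGradedCM_of_leftInverse (f := e.symm.toLinearMap) (g := e.toLinearMap) e.apply_symm_apply hX

theorem exists_iso_of_homDim_ne [GradedAlgebra 𝒜] (hfin : IsGradedFiniteRepType 𝒜)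
    {M N : GrMod 𝒜} (h : ∀ X : GrMod 𝒜, X.IsCM →
      ∀ᶠ l in cofinite, M.homDim (X.shift l) = N.homDim (X.shift l)) :
    ∃ (r : ℕ) (Y : Fin r → GrMod 𝒜), ∀ X : GrMod 𝒜, X.IsCM → X.Indecomposable →
      M.homDim X ≠ N.homDim X → ∃ i : Fin r, X.Iso (Y i) := by
  obtain ⟨r, Y, hY⟩ := hfin
  let S : Set ℤ := {l | ¬ ∀ i, (Y i).IsCM → M.homDim ((Y i).shift l) = N.homDim ((Y i).shift l)}
  have hS : S.Finite := eventually_cofinite.1 <|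
    eventually_all.2 fun i => eventually_imp_distrib_left.2 fun hi => h (Y i) hi
  have := hS.to_subtype
  let e := Finite.equivFin (Fin r × S)
  refine ⟨_, fun a => (Y (e.symm a).1).shift (e.symm a).2, fun X hX hind hne => ?_⟩
  obtain ⟨i, l, hiso⟩ := hY X hX hind
  have hl : l ∈ S := fun hall => hne <| by
    rw [homDim_congr M hiso, homDim_congr N hiso, hall i (hX.of_iso (X' := (Y i).shift l) hiso)]
  exact ⟨e (i, ⟨l, hl⟩), by simpa only [Equiv.symm_apply_apply] using hiso⟩

end GrMod

theorem exists_forall_le_and_neg {p : ℤ → Prop} (h : ∀ᶠ l in cofinite, p l) :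
    ∃ l₀ : ℤ, ∀ l, l₀ ≤ l → p l ∧ p (-l) := by
  rw [Int.cofinite_eq, eventually_sup] at h
  exact eventually_atTop.1 (h.2.and (tendsto_neg_atTop_atBot.eventually h.1))

end HomDim

theorem lemma3p5_general {k : Type v} [Field k]
    {R : Type u} [CommRing R] [IsNoetherianRing R] [Algebra k R]
    (𝒜 : ℕ → Submodule k R) [GradedAlgebra 𝒜]
    (hR0 : Function.Bijective (algebraMap k (𝒜 0)))
    (hR : IsGradedCM 𝒜 R)
    (M N : GrMod 𝒜) (hM : M.IsCM) (hN : N.IsCM)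
    (hh : M.hilb = N.hilb) (hom : M.HomLE N) :
    (IsGradedIsolatedSingularity 𝒜 →
      ∀ X : GrMod 𝒜, X.IsCM → ∃ l₀ : ℤ, ∀ l : ℤ, l₀ ≤ l →
        M.homDim (X.shift l) = N.homDim (X.shift l) ∧
        M.homDim (X.shift (-l)) = N.homDim (X.shift (-l))) ∧
    (IsGradedFiniteRepType 𝒜 →
      ∃ (r : ℕ) (Y : Fin r → GrMod 𝒜), ∀ X : GrMod 𝒜, X.IsCM → X.Indecomposable →
        0 < (N.homDim X : ℤ) - (M.homDim X : ℤ) → ∃ i : Fin r, X.Iso (Y i)) := by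
  refine ⟨fun hiso X hX => ?_, fun hfin => ?_⟩
  · exact exists_forall_le_and_neg <| GrMod.eventually_homDim_shift_eq hR0 hR hM hN hh hom hX
      fun _ _ _ _ h _ hL => GrMod.liftsUpToPowers_of_isGradedIsolatedSingularity hR0 hR hiso hL
        h.right_mem_hom h.surjective
  · have hev (X : GrMod 𝒜) (hX : X.IsCM) :=
      GrMod.eventually_homDim_shift_eq hR0 hR hM hN hh hom hX fun _ _ _ _ h _ hL =>
        GrMod.liftsUpToPowers_of_isGradedFiniteRepType hR0 hfin hL hX h
    obtain ⟨r, Y, hY⟩ := GrMod.exists_iso_of_homDim_ne hfin hev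
    exact ⟨r, Y, fun X hX hind hpos => hY X hX hind (by lia)⟩

/-- `R` is a Noetherian `ℕ`-graded Cohen-Macaulay ring with `R_0 = k` a field of characteristic
zero; `M` and `N` are graded Cohen-Macaulay modules with `h(M) = h(N)` and `M ≤_hom N`. -/
theorem lemma3p5 {k : Type v} [Field k] [CharZero k]
    {R : Type u} [CommRing R] [IsNoetherianRing R] [Algebra k R]
    (𝒜 : ℕ → Submodule k R) [GradedAlgebra 𝒜]
    (hR0 : Function.Bijective (algebraMap k (𝒜 0)))
    (hR : IsGradedCM 𝒜 R)
    (M N : GrMod 𝒜) (hM : M.IsCM) (hN : N.IsCM)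
    (hh : M.hilb = N.hilb) (hom : M.HomLE N) :
    (IsGradedIsolatedSingularity 𝒜 →
      ∀ X : GrMod 𝒜, X.IsCM → ∃ l₀ : ℤ, ∀ l : ℤ, l₀ ≤ l →
        M.homDim (X.shift l) = N.homDim (X.shift l) ∧
        M.homDim (X.shift (-l)) = N.homDim (X.shift (-l))) ∧
    (IsGradedFiniteRepType 𝒜 →
      ∃ (r : ℕ) (Y : Fin r → GrMod 𝒜), ∀ X : GrMod 𝒜, X.IsCM → X.Indecomposable →
        0 < (N.homDim X : ℤ) - (M.homDim X : ℤ) → ∃ i : Fin r, X.Iso (Y i)) :=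
  lemma3p5_general 𝒜 hR0 hR M N hM hN hh hom
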